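/- Let $m\ge 1$, $k\ge 0$, $n=m+k$, write points of $\mathbb T^n=\mathbb R^n/\mathbb Z^n$ as $(x,y)\in\mathbb T^m\times\mathbb T^{k}$, and let $\lambda$ denote Lebesgue measure. Let $\beta>0$ and let $\mathcal F=(\mathcal F_1,\mathcal F_2)\in C^1(\mathbb T^n,\mathbb R^m\times\mathbb R^{k})$ (not necessarily a gradient). Let $M\ge 0$ be such that, for every $x\in\mathbb T^m$, the map $y\mapsto\mathcal F_1(x,y)$ is $M$-Lipschitz. For a probability density $\pi$ on $\mathbb T^n$ put $$\pi^\xi(x)=\int_{\mathbb T^{k}}\pi(x,y)\,dy,\qquad \pi_x(y)=\frac{\pi(x,y)}{\pi^\xi(x)},\qquad G_\pi(x)=-\int_{\mathbb T^{k}}\mathcal F_1(x,y)\,\pi_x(y)\,dy .$$ The bias associated with $\pi$ is $B_\pi=G_\pi$ for the ABF algorithm and $B_\pi=\mathsf P_{L^2(\lambda)}(G_\pi)$ for the PABF algorithm, where the Helmholtz projection $\mathsf P_{L^2(\lambda)}(G)$ is $\nabla H$ for the minimizer $H$ of $g\mapsto\int_{\mathbb T^m}|G-\nabla g|^2\,dx$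 over the $g\in H^1(\mathbb T^m)$ with $\int g=0$. For either algorithm consider the nonlinear Fokker--Planck equation $$\partial_t\pi_t=\beta^{-1}\Delta\pi_t-\nabla\cdot(\mathcal F\pi_t)-\nabla_x\cdot(B_t\pi_t),\qquad B_t=B_{\pi_t}.\tag{1}$$ A solution of (1) is a family $(\pi_t,B_t)_{t\ge0}$ of probability densities and associated biases such that $(t,z)\mapsto\pi_t(z)$ is continuous on $[0,\infty)\times\mathbb T^n$ and $C^1$ on $(0,\infty)\times\mathbb T^n$, and such that, for every $t>0$, (1) holds when tested against all $\varphi\in C^\infty(\mathbb T^n)$. A stationary state of (1) is a pair $(\pi,B)$ with $\pi$ a continuous probability density such that $\pi^\xi>0$, with $B=B_\pi$, and with $\int_{\mathbb T^n}(\beta^{-1}\Delta\varphi+\mathcal F\cdot\nabla\varphi+B\cdot\nabla_x\varphi)\,\pi=0$ for all $\varphi\in C^\infty(\mathbb T^n)$. For probability measures let $\mathcal H(\mu|\nu)=\int\ln\frac{d\mu}{d\nu}\,d\mu$ if $\mu\ll\nu$ and $+\infty$ otherwise; $\nu$ satisfies a log-Sobolev inequality with constant $r>0$ if $\mathcal H(\mu|\nu)\le\frac1{2r}\int|\nabla\ln\frac{d\mu}{d\nu}|^2\,d\mu$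 for all probability measures $\mu\ll\nu$ (the right-hand side being $+\infty$ if $\frac{d\mu}{d\nu}$ has no weak gradient). Let $(\pi_\infty,B_\infty)$ be a stationary state of (1) with $\pi_\infty>0$, and let $R,\rho>0$ be such that $\pi_\infty$ satisfies a log-Sobolev inequality with constant $R$ and, for every $x\in\mathbb T^m$, the conditional density $\pi_{\infty,x}$ satisfies a log-Sobolev inequality with constant $\rho$. Suppose that $M\beta<2\rho$. Then, for either algorithm: (i) for every solution $(\pi_t,B_t)_{t\ge0}$ of (1) whose initial density $\pi_0$ is smooth with $\pi_0^\xi>0$ everywhere, there exists $K\ge0$ such that, for all $t\ge0$, $$\mathcal H(\pi_t|\pi_\infty)\le K e^{-\Lambda t},\qquad \Lambda=2R\Big(1-\frac{M\beta}{2\rho}\Big)\beta^{-1};$$ (ii) the stationary state is unique: every stationary state $(\pi,B)$ of (1) satisfies $\pi=\pi_\infty$, and $B=B_\infty$ almost everywhere. -/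

import Mathlib

open MeasureTheory Set
open scoped NNReal ENNReal ContDiff

noncomputable section

namespace ABF

/-! ### Calculus on the torus `𝕋^ι = ℝ^ι / ℤ^ι`

`UnitAddTorus ι` carries the normalized Lebesgue measure `volume`. -/

/-- The projection `ℝ^ι → 𝕋^ι`. -/
def proj {ι : Type} (u : ι → ℝ) : UnitAddTorus ι := fun i => (u i : UnitAddCircle)

/-- `f` is of class `C^r` on the torus: its periodic lift to `ℝ^ι` is. -/
def TorusContDiff {ι : Type} [Fintype ι] {E : Type} [NormedAddCommGroup E] [NormedSpace ℝ E]
    (r : WithTop ℕ∞) (f : UnitAddTorus ι → E) : Prop :=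
  ContDiff ℝ r (fun u : ι → ℝ => f (proj u))

/-- The partial derivative `∂_i f (z)`: derivative at `s = 0` of `s ↦ f (z + s e_i)`. -/
def pderiv {ι : Type} [DecidableEq ι] (i : ι) (f : UnitAddTorus ι → ℝ) (z : UnitAddTorus ι) : ℝ :=
  deriv (fun s : ℝ => f (z + proj (Pi.single i s))) 0

/-- The Laplacian `∑_i ∂_i ∂_i f`. -/
def laplacian {ι : Type} [Fintype ι] [DecidableEq ι] (f : UnitAddTorus ι → ℝ)
    (z : UnitAddTorus ι) : ℝ :=
  ∑ i, pderiv i (pderiv i f) z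

/-- `h` is the weak (distributional) gradient of `g`; both are integrable. -/
structure IsWeakGradient {ι : Type} [Fintype ι] [DecidableEq ι] (g : UnitAddTorus ι → ℝ)
    (h : UnitAddTorus ι → EuclideanSpace ℝ ι) : Prop where
  integrable : Integrable g volume
  integrable_grad : Integrable h volume
  integral_eq : ∀ φ : UnitAddTorus ι → ℝ, TorusContDiff ∞ φ → ∀ i,
    ∫ z, g z * pderiv i φ z = - ∫ z, h z i * φ z

/-- `g` belongs to `H¹(𝕋^ι)`, has mean zero, and its weak gradient is `h`. -/
structure IsH1MeanZero {ι : Type} [Fintype ι] [DecidableEq ι] (g : UnitAddTorus ι → ℝ)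
    (h : UnitAddTorus ι → EuclideanSpace ℝ ι) : Prop where
  memLp : MemLp g 2 volume
  memLp_grad : MemLp h 2 volume
  weakGradient : IsWeakGradient g h
  mean_zero : ∫ z, g z = 0

/-- `B` is the Helmholtz projection of `G` with respect to the Lebesgue measure: the gradient of
a minimizer of `g ↦ ∫ |G - ∇g|²` over the mean-zero functions `g` of `H¹`. -/
def IsHelmholtzProjection {ι : Type} [Fintype ι] [DecidableEq ι]
    (G B : UnitAddTorus ι → EuclideanSpace ℝ ι) : Prop :=
  ∃ H : UnitAddTorus ι → ℝ, IsH1MeanZero H B ∧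
    ∀ (g : UnitAddTorus ι → ℝ) (h : UnitAddTorus ι → EuclideanSpace ℝ ι), IsH1MeanZero g h →
      ∫ x, ‖G x - B x‖ ^ 2 ≤ ∫ x, ‖G x - h x‖ ^ 2

/-! ### Relative entropy, Fisher information, log-Sobolev inequality -/

/-- The measure on the torus with density `p` with respect to the Lebesgue measure. -/
def law {ι : Type} [Fintype ι] (p : UnitAddTorus ι → ℝ) : Measure (UnitAddTorus ι) :=
  volume.withDensity (fun z => ENNReal.ofReal (p z))

/-- The relative entropy `H(p dz | q dz)`. -/
def entropy {ι : Type} [Fintype ι] (p q : UnitAddTorus ι → ℝ) : ℝ≥0∞ :=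
  InformationTheory.klDiv (law p) (law q)

/-- The Fisher information `∫ |∇ ln g|² dμ = ∫ |∇g / g|² dμ`, where `g = dμ/dν` and `∇g` is the
weak gradient of `g`. As `∇g` is unique up to null sets, the infimum is over one value;
it is `∞` if there is no weak gradient. -/
def fisherInfo {ι : Type} [Fintype ι] [DecidableEq ι] (μ ν : Measure (UnitAddTorus ι)) : ℝ≥0∞ :=
  ⨅ (h : UnitAddTorus ι → EuclideanSpace ℝ ι)
    (_ : IsWeakGradient (fun z => (μ.rnDeriv ν z).toReal) h),
    ∫⁻ z, ENNReal.ofReal (‖((μ.rnDeriv ν z).toReal)⁻¹ • h z‖ ^ 2) ∂μ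

/-- The probability density `q` on the torus satisfies the log-Sobolev inequality `LSI(r)`. -/
def SatisfiesLSI {ι : Type} [Fintype ι] [DecidableEq ι] (q : UnitAddTorus ι → ℝ) (r : ℝ) : Prop :=
  ∀ μ : Measure (UnitAddTorus ι), IsProbabilityMeasure μ → μ ≪ law q →
    InformationTheory.klDiv μ (law q) ≤ ENNReal.ofReal (1 / (2 * r)) * fisherInfo μ (law q)

/-! ### The (P)ABF dynamics on `𝕋^m × 𝕋^k`

A point `(x, y)` of `𝕋^m × 𝕋^k` is written `Sum.elim x y`; the transition coordinate is `x`. -/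

/-- The full state space `𝕋^n`, `n = m + k`. -/
abbrev State (m k : ℕ) : Type := UnitAddTorus (Fin m ⊕ Fin k)

/-- A vector field on `𝕋^n`. -/
abbrev Force (m k : ℕ) : Type := State m k → EuclideanSpace ℝ (Fin m ⊕ Fin k)

/-- A vector field on `𝕋^m`. -/
abbrev Bias (m : ℕ) : Type := UnitAddTorus (Fin m) → EuclideanSpace ℝ (Fin m)

/-- The component `𝓕₁` of the force in the direction of `x`. -/
def force₁ {m k : ℕ} (F : Force m k) (z : State m k) : EuclideanSpace ℝ (Fin m) :=
  WithLp.toLp 2 (fun j => F z (Sum.inl j))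

/-- For every `x`, the map `y ↦ 𝓕₁(x, y)` is `M`-Lipschitz for the Euclidean norm of `ℝ^m` and the
geodesic distance of the flat torus `𝕋^k` (equivalently, its periodic lift to Euclidean `ℝ^k` is
`M`-Lipschitz). -/
def IsLipschitzInY {m k : ℕ} (F : Force m k) (M : ℝ≥0) : Prop :=
  ∀ x : UnitAddTorus (Fin m),
    LipschitzWith M (fun u : EuclideanSpace ℝ (Fin k) => force₁ F (Sum.elim x (proj (fun i => u i))))

/-- The marginal density `p^ξ(x) = ∫ p(x, y) dy`. -/
def marginal {m k : ℕ} (p : State m k → ℝ) (x : UnitAddTorus (Fin m)) : ℝ :=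
  ∫ y : UnitAddTorus (Fin k), p (Sum.elim x y)

/-- The conditional density `p_x(y) = p(x, y) / p^ξ(x)`. -/
def conditional {m k : ℕ} (p : State m k → ℝ) (x : UnitAddTorus (Fin m))
    (y : UnitAddTorus (Fin k)) : ℝ :=
  p (Sum.elim x y) / marginal p x

/-- The mean force `G(x) = ∫ -𝓕₁(x, y) p(x, y) / p^ξ(x) dy`. -/
def meanForce {m k : ℕ} (F : Force m k) (p : State m k → ℝ) : Bias m := fun x =>
  ∫ y : UnitAddTorus (Fin k), conditional p x y • (-force₁ F (Sum.elim x y))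

/-- The two algorithms. -/
inductive Algorithm
  | abf
  | pabf

/-- `B` is the bias associated with the density `p`: the mean force in the ABF case, its Helmholtz
projection in the PABF case. -/
def IsBias {m k : ℕ} (alg : Algorithm) (F : Force m k) (p : State m k → ℝ) (B : Bias m) : Prop :=
  match alg with
  | Algorithm.abf => B = meanForce F p
  | Algorithm.pabf => IsHelmholtzProjection (meanForce F p) B

/-- The generator `β⁻¹ Δφ + 𝓕 · ∇φ + B · ∇_x φ`. -/
def generator {m k : ℕ} (β : ℝ) (F : Force m k) (B : Bias m) (φ : State m k → ℝ)
    (z : State m k) : ℝ :=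
  β⁻¹ * laplacian φ z + ∑ i, F z i * pderiv i φ z
    + ∑ j : Fin m, B (fun l => z (Sum.inl l)) j * pderiv (Sum.inl j) φ z

/-- `(π_t, B_t)_{t ≥ 0}` solves
`∂_t π_t = β⁻¹ Δ π_t - ∇·(𝓕 π_t) - ∇_x·(B_t π_t)`, with `B_t` the bias associated with `π_t`:
the `π_t` are probability densities, `π` is continuous on `[0, ∞) × 𝕋^n` and `C¹` on
`(0, ∞) × 𝕋^n`, and the equation holds against smooth test functions at every time `t > 0`. -/
structure IsSolution {m k : ℕ} (alg : Algorithm) (β : ℝ) (F : Force m k)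
    (π : ℝ → State m k → ℝ) (B : ℝ → Bias m) : Prop where
  nonneg : ∀ t, 0 ≤ t → ∀ z, 0 ≤ π t z
  mass : ∀ t, 0 ≤ t → ∫ z, π t z = 1
  continuousOn : ContinuousOn (fun q : ℝ × State m k => π q.1 q.2) (Ici 0 ×ˢ univ)
  contDiffOn : ContDiffOn ℝ 1 (fun q : ℝ × (Fin m ⊕ Fin k → ℝ) => π q.1 (proj q.2))
    (Ioi 0 ×ˢ univ)
  bias : ∀ t, 0 ≤ t → IsBias alg F (π t) (B t)
  equation : ∀ t, 0 < t → ∀ φ : State m k → ℝ, TorusContDiff ∞ φ →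
    HasDerivAt (fun s => ∫ z, φ z * π s z) (∫ z, generator β F (B t) φ z * π t z) t

/-- The initial density is smooth and its marginal in `x` is positive. -/
structure IsAdmissibleInitial {m k : ℕ} (p : State m k → ℝ) : Prop where
  smooth : TorusContDiff ∞ p
  marginal_pos : ∀ x, 0 < marginal p x

/-- `(p, B)` is a stationary state with a continuous density `p` (whose marginal in `x` is positive,
so that the conditional laws make sense). -/
structure IsStationaryState {m k : ℕ} (alg : Algorithm) (β : ℝ) (F : Force m k)
    (p : State m k → ℝ) (B : Bias m) : Prop where
  continuous : Continuous p
  nonneg : ∀ z, 0 ≤ p z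
  mass : ∫ z, p z = 1
  marginal_pos : ∀ x, 0 < marginal p x
  bias : IsBias alg F p B
  equation : ∀ φ : State m k → ℝ, TorusContDiff ∞ φ → ∫ z, generator β F B φ z * p z = 0

end ABF

end

open MeasureTheory Set
open scoped NNReal ENNReal ContDiff

noncomputable section

set_option linter.unusedSectionVars false

namespace ABF

open Filter Topology

/-! ### Differential calculus on the torus -/

/-! The proof is an entropy method: the relative entropy of `π_t` with respect to the stationary
density `p` is differentiated in time. Three facts carry it.

The marginal forgets the force. Integrating the equation in `y` turns `F₁` into minus the mean force
`G`, so the marginal `u` has drift `B - G` (`marginal_equation`). For ABF this is zero; for PABF it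
is orthogonal in `L²(dx)` to all gradients. When the equation is tested with a function of `u`, the
transport term pairs `B - G` with a gradient and vanishes. So `u` obeys the `L^q` energy identities
of the heat equation, though not the heat equation itself in the PABF case
(`integral_marginal_mul_pow`). Hence a stationary marginal is `1`
(`IsStationaryState.marginal_eq_one`), and for a solution the Poincaré inequality and a Nash–Moser
iteration give `|u - 1| ≤ C e^{-ct}` uniformly (`HeatEnergy.exists_abs_le_exp`).

The bias is controlled by the Fisher information in `y`. The passage from `G` to `B` is nonexpansive
in `L²(dx)`. At fixed `x` the difference of mean forces is a difference of means of an `M`-Lipschitz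
function under two conditional laws. Herbst's argument and Gibbs' variational inequality bound it by
the conditional entropy, and the log-Sobolev inequality by `M / ρ` times the square root of the
conditional Fisher information (`SatisfiesLSI.sq_integral_sub_le`,
`integral_sum_sq_forceExcess_le`).

The dissipation closes (`integral_mul_log_le`). With `f = π_t / p`, the equations of `π_t` and `p`
combine so that `F` disappears: the entropy decreases at rate `β⁻¹ I` up to the cross term `∫ π_t
(B_t - B_p) · ∇_x log f`. Young's inequality with weight `κ`, close to `M / ρ`, bounds this term by
`(κ / 2) (I_x + I_y) = (κ / 2) I`, where `I_x` and `I_y` are the parts of the Fisher information `I`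
in `x` and `y`. What is left is `-(β⁻¹ - M / (2ρ)) I` up to an exponentially small multiple of `I`;
the log-Sobolev inequality for `p` and Grönwall's lemma conclude, and the error, being integrable in
time, costs only a constant and not the rate. For a second stationary state the same inequality has
left-hand side zero, so `I = 0`: this is uniqueness.

Two technical devices recur. Densities may vanish, so `f` is replaced by `f + ε` and `ε` tends to
`0` at the end. Biases are only in `L²`, so everything is done in weak form with continuous test
functions of class `H¹` (`H1C`). -/

instance isProbabilityMeasure_volume_unitAddCircle :
    IsProbabilityMeasure (volume : Measure UnitAddCircle) :=
  ⟨by rw [AddCircle.measure_univ, ENNReal.ofReal_one]⟩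

instance isNegInvariant_volume_torus {ι : Type} [Fintype ι] :
    (volume : Measure (UnitAddTorus ι)).IsNegInvariant :=
  Measure.IsAddHaarMeasure.isNegInvariant_of_regular _

section Calculus

variable {ι : Type} [Fintype ι] [DecidableEq ι]

lemma proj_add (u v : ι → ℝ) : proj (u + v) = proj u + proj v := by
  ext i; simp [proj]

@[simp] lemma proj_zero : proj (0 : ι → ℝ) = 0 := by
  ext i; simp [proj]

lemma isOpenQuotientMap_proj : IsOpenQuotientMap (proj : (ι → ℝ) → UnitAddTorus ι) :=
  IsOpenQuotientMap.piMap (f := fun _ : ι => ((↑) : ℝ → UnitAddCircle))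
    fun _ => QuotientAddGroup.isOpenQuotientMap_mk

lemma continuous_proj : Continuous (proj : (ι → ℝ) → UnitAddTorus ι) :=
  isOpenQuotientMap_proj.continuous

/-- `f` is of class `C¹` on the torus with partial derivatives `g i`. -/
structure HasGrad (f : UnitAddTorus ι → ℝ) (g : ι → UnitAddTorus ι → ℝ) : Prop where
  cont : Continuous f
  cont_grad : ∀ i, Continuous (g i)
  hasDerivAt_zero : ∀ i z, HasDerivAt (fun s : ℝ => f (z + proj (Pi.single i s))) (g i z) 0

namespace HasGrad

variable {f f₁ f₂ : UnitAddTorus ι → ℝ} {g g₁ g₂ : ι → UnitAddTorus ι → ℝ}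

/-- The derivative at time `s` is the derivative at time `0` from the translated base point. -/
lemma hasDerivAt (h : HasGrad f g) (i : ι) (z : UnitAddTorus ι) (s : ℝ) :
    HasDerivAt (fun s : ℝ => f (z + proj (Pi.single i s)))
      (g i (z + proj (Pi.single i s))) s := by
  have h1 := h.hasDerivAt_zero i (z + proj (Pi.single i s))
  have h2 : HasDerivAt (fun r : ℝ => r - s) 1 s := (hasDerivAt_id s).sub_const s
  have h3 := HasDerivAt.comp s (h₂ := fun s' : ℝ => f (z + proj (Pi.single i s) +
    proj (Pi.single i s'))) (h := fun r : ℝ => r - s) (by simpa using h1) h2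
  have h4 : (fun s' : ℝ => f (z + proj (Pi.single i s) + proj (Pi.single i s'))) ∘
      (fun r : ℝ => r - s) = fun s : ℝ => f (z + proj (Pi.single i s)) := by
    ext r
    simp only [Function.comp]
    rw [add_assoc, ← proj_add, ← Pi.single_add, add_sub_cancel]
  rw [h4] at h3
  simpa using h3

lemma pderiv_eq (h : HasGrad f g) (i : ι) : pderiv i f = g i :=
  funext fun z => (h.hasDerivAt_zero i z).deriv

lemma const (c : ℝ) : HasGrad (fun _ : UnitAddTorus ι => c) (fun _ _ => 0) :=
  ⟨continuous_const, fun _ => continuous_const, fun _ _ => hasDerivAt_const _ _⟩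

lemma sub (h₁ : HasGrad f₁ g₁) (h₂ : HasGrad f₂ g₂) :
    HasGrad (fun z => f₁ z - f₂ z) (fun i z => g₁ i z - g₂ i z) :=
  ⟨h₁.cont.sub h₂.cont, fun i => (h₁.cont_grad i).sub (h₂.cont_grad i),
    fun i z => (h₁.hasDerivAt_zero i z).sub (h₂.hasDerivAt_zero i z)⟩

lemma mul (h₁ : HasGrad f₁ g₁) (h₂ : HasGrad f₂ g₂) :
    HasGrad (fun z => f₁ z * f₂ z) (fun i z => g₁ i z * f₂ z + f₁ z * g₂ i z) :=
  ⟨h₁.cont.mul h₂.cont, fun i => ((h₁.cont_grad i).mul h₂.cont).add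
    (h₁.cont.mul (h₂.cont_grad i)),
    fun i z => by simpa using (h₁.hasDerivAt_zero i z).fun_mul (h₂.hasDerivAt_zero i z)⟩

lemma const_mul (c : ℝ) (h : HasGrad f g) :
    HasGrad (fun z => c * f z) (fun i z => c * g i z) := by
  simpa using (HasGrad.const (ι := ι) c).mul h

lemma comp (h : HasGrad f g) {Ψ Ψ' : ℝ → ℝ} (hΨ : ∀ z, HasDerivAt Ψ (Ψ' (f z)) (f z))
    (hΨ' : Continuous fun z => Ψ' (f z)) :
    HasGrad (fun z => Ψ (f z)) (fun i z => Ψ' (f z) * g i z) := by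
  refine ⟨?_, fun i => hΨ'.mul (h.cont_grad i), fun i z => ?_⟩
  · exact continuous_iff_continuousAt.2 fun z =>
      ContinuousAt.comp (g := Ψ) (hΨ z).continuousAt h.cont.continuousAt
  · have := h.hasDerivAt_zero i z
    exact HasDerivAt.comp (h₂ := Ψ) (0 : ℝ) (by simpa using hΨ z) this

end HasGrad

lemma exists_bound {X : Type*} [TopologicalSpace X] [CompactSpace X] {f : X → ℝ}
    (hf : Continuous f) : ∃ C, 0 ≤ C ∧ ∀ x, |f x| ≤ C := by
  obtain ⟨C, hC⟩ := isCompact_univ.exists_bound_of_continuousOn hf.continuousOn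
  exact ⟨max C 0, le_max_right _ _, fun x => (hC x (mem_univ _)).trans (le_max_left _ _)⟩

lemma integrable_of_continuous {X : Type*} [TopologicalSpace X] [CompactSpace X]
    [MeasurableSpace X] [OpensMeasurableSpace X] {μ : Measure X} [IsFiniteMeasure μ]
    {E : Type*} [NormedAddCommGroup E] [SecondCountableTopologyEither X E]
    {f : X → E} (hf : Continuous f) : Integrable f μ := by
  obtain ⟨C, hC⟩ := isCompact_univ.exists_bound_of_continuousOn hf.continuousOn
  exact Integrable.of_bound hf.aestronglyMeasurable C (ae_of_all _ fun x => hC x (mem_univ _))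

/-- By translation invariance the integral of `f (z + s e_i)` does not depend on `s`; differentiate
at `s = 0`. All integrations by parts below come from this. -/
lemma HasGrad.integral_eq_zero {f : UnitAddTorus ι → ℝ} {g : ι → UnitAddTorus ι → ℝ}
    (h : HasGrad f g) (i : ι) : ∫ z, g i z = 0 := by
  obtain ⟨C, -, hC⟩ := exists_bound (h.cont_grad i)
  have h1 := (hasDerivAt_integral_of_dominated_loc_of_deriv_le (μ := volume) (x₀ := (0 : ℝ))
    (s := univ) (F := fun (s : ℝ) (z : UnitAddTorus ι) => f (z + proj (Pi.single i s)))
    (F' := fun s z => g i (z + proj (Pi.single i s))) (bound := fun _ => C) univ_mem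
    (Eventually.of_forall fun s => (h.cont.comp (continuous_id.add continuous_const)).aestronglyMeasurable)
    (integrable_of_continuous (h.cont.comp (continuous_id.add continuous_const)))
    ((h.cont_grad i).comp (continuous_id.add continuous_const)).aestronglyMeasurable
    (ae_of_all _ fun z s _ => hC _) (integrable_const _)
    (ae_of_all _ fun z s _ => h.hasDerivAt i z s)).2
  have h2 : (fun s : ℝ => ∫ z, f (z + proj (Pi.single i s))) = fun _ => ∫ z, f z := by
    ext s
    exact integral_add_right_eq_self f _
  rw [h2] at h1
  simpa using h1.unique (hasDerivAt_const _ _)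

lemma HasGrad.integral_mul_eq {f₁ f₂ : UnitAddTorus ι → ℝ} {g₁ g₂ : ι → UnitAddTorus ι → ℝ}
    (h₁ : HasGrad f₁ g₁) (h₂ : HasGrad f₂ g₂) (i : ι) :
    ∫ z, f₁ z * g₂ i z = - ∫ z, g₁ i z * f₂ z := by
  have h := (h₁.mul h₂).integral_eq_zero i
  rw [integral_add (integrable_of_continuous ((h₁.cont_grad i).fun_mul h₂.cont))
    (integrable_of_continuous (h₁.cont.fun_mul (h₂.cont_grad i)))] at h
  linarith

lemma TorusContDiff.continuous {E : Type} [NormedAddCommGroup E] [NormedSpace ℝ E]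
    {r : WithTop ℕ∞} {f : UnitAddTorus ι → E} (h : TorusContDiff r f) :
    Continuous f :=
  isOpenQuotientMap_proj.isQuotientMap.continuous_iff.2 (ContDiff.continuous h)

lemma TorusContDiff.pderiv_proj {r : WithTop ℕ∞} (hr : r ≠ 0) {f : UnitAddTorus ι → ℝ}
    (h : TorusContDiff r f) (i : ι) (u : ι → ℝ) :
    HasDerivAt (fun s : ℝ => f (proj u + proj (Pi.single i s)))
      (fderiv ℝ (fun u => f (proj u)) u (Pi.single i 1)) 0 := by
  have hd : HasFDerivAt (fun u => f (proj u)) (fderiv ℝ (fun u => f (proj u)) u) u :=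
    (ContDiff.differentiable h hr u).hasFDerivAt
  have h1 : HasDerivAt (fun s : ℝ => u + Pi.single i s) (Pi.single i 1) 0 := by
    have : HasDerivAt (fun s : ℝ => u + s • (Pi.single i (1 : ℝ) : ι → ℝ))
        ((1 : ℝ) • (Pi.single i (1 : ℝ) : ι → ℝ)) 0 :=
      ((hasDerivAt_id (0 : ℝ)).smul_const _).const_add u
    simpa [← Pi.single_smul] using this
  have h2 := HasFDerivAt.comp_hasDerivAt (0 : ℝ) (l := fun u => f (proj u))
    (f := fun s : ℝ => u + Pi.single i s) (by simpa using hd) h1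
  refine h2.congr_of_eventuallyEq (Eventually.of_forall fun s => ?_)
  simp [proj_add]

lemma TorusContDiff.pderiv_comp_proj {r : WithTop ℕ∞} (hr : r ≠ 0) {f : UnitAddTorus ι → ℝ}
    (h : TorusContDiff r f) (i : ι) :
    (fun u => pderiv i f (proj u)) =
      fun u => fderiv ℝ (fun u => f (proj u)) u (Pi.single i 1) :=
  funext fun u => (h.pderiv_proj hr i u).deriv

lemma TorusContDiff.hasGrad {r : WithTop ℕ∞} (hr : r ≠ 0) {f : UnitAddTorus ι → ℝ}
    (h : TorusContDiff r f) : HasGrad f (fun i => pderiv i f) := by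
  refine ⟨h.continuous, fun i => ?_, fun i z => ?_⟩
  · refine isOpenQuotientMap_proj.isQuotientMap.continuous_iff.2 ?_
    change Continuous (fun u => pderiv i f (proj u))
    rw [h.pderiv_comp_proj hr]
    exact (ContDiff.continuous_fderiv h hr).clm_apply continuous_const
  · obtain ⟨u, rfl⟩ := isOpenQuotientMap_proj.surjective z
    have := h.pderiv_proj hr i u
    rwa [← this.deriv] at this

lemma TorusContDiff.pderiv {f : UnitAddTorus ι → ℝ}
    (h : TorusContDiff ∞ f) (i : ι) : TorusContDiff ∞ (pderiv i f) := by
  unfold TorusContDiff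
  rw [h.pderiv_comp_proj (by simp)]
  exact (ContDiff.fderiv_right (m := ∞) h (by norm_cast)).clm_apply contDiff_const

lemma TorusContDiff.mul {r : WithTop ℕ∞} {f g : UnitAddTorus ι → ℝ}
    (hf : TorusContDiff r f) (hg : TorusContDiff r g) : TorusContDiff r (fun z => f z * g z) :=
  ContDiff.mul hf hg

lemma TorusContDiff.const {r : WithTop ℕ∞} (c : ℝ) :
    TorusContDiff r (fun _ : UnitAddTorus ι => c) := contDiff_const

lemma TorusContDiff.sub {r : WithTop ℕ∞} {f g : UnitAddTorus ι → ℝ}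
    (hf : TorusContDiff r f) (hg : TorusContDiff r g) : TorusContDiff r (fun z => f z - g z) :=
  ContDiff.sub hf hg

lemma TorusContDiff.sum {r : WithTop ℕ∞} {κ : Type} {s : Finset κ} {f : κ → UnitAddTorus ι → ℝ}
    (hf : ∀ j ∈ s, TorusContDiff r (f j)) : TorusContDiff r (fun z => ∑ j ∈ s, f j z) :=
  ContDiff.sum hf

lemma TorusContDiff.comp {f : UnitAddTorus ι → ℝ} (hf : TorusContDiff ∞ f) {Ψ : ℝ → ℝ}
    (hΨ : ∀ z, ContDiffAt ℝ ∞ Ψ (f z)) : TorusContDiff ∞ (fun z => Ψ (f z)) :=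
  contDiff_iff_contDiffAt.2 fun u =>
    ContDiffAt.comp (g := Ψ) u (hΨ _) (ContDiff.contDiffAt hf)

lemma HasGrad.integral_laplacian {f φ : UnitAddTorus ι → ℝ} {g : ι → UnitAddTorus ι → ℝ}
    (h : HasGrad f g) (hφ : TorusContDiff ∞ φ) :
    ∫ z, f z * laplacian φ z = - ∫ z, ∑ i, g i z * ABF.pderiv i φ z := by
  have h2 : ∀ i, HasGrad (ABF.pderiv i φ) (fun j => ABF.pderiv j (ABF.pderiv i φ)) :=
    fun i => (hφ.pderiv i).hasGrad (by simp)
  simp only [laplacian, Finset.mul_sum]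
  rw [integral_finsetSum _ fun i _ => integrable_of_continuous
      (h.cont.fun_mul ((h2 i).cont_grad i)),
    integral_finsetSum _ fun i _ => integrable_of_continuous ((h.cont_grad i).fun_mul (h2 i).cont),
    ← Finset.sum_neg_distrib]
  exact Finset.sum_congr rfl fun i _ => h.integral_mul_eq (h2 i) i

end Calculus

/-! ### Convergence in `L²` -/

section L2

variable {X : Type*} [MeasurableSpace X] {μ : Measure X}

lemma eLpNorm_two_eq {f : X → ℝ} (hf : MemLp f 2 μ) :
    eLpNorm f 2 μ = ENNReal.ofReal (Real.sqrt (∫ x, f x ^ 2 ∂μ)) := by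
  rw [hf.eLpNorm_eq_integral_rpow_norm (by norm_num) (by norm_num), Real.sqrt_eq_rpow]
  norm_num

lemma integrable_sq {f : X → ℝ} (hf : MemLp f 2 μ) : Integrable (fun x => f x ^ 2) μ :=
  hf.integrable_sq

lemma integrable_mul_of_memLp {f g : X → ℝ} (hf : MemLp f 2 μ) (hg : MemLp g 2 μ) :
    Integrable (fun x => f x * g x) μ := hf.integrable_mul hg

lemma inner_toLp {f g : X → ℝ} (hf : MemLp f 2 μ) (hg : MemLp g 2 μ) :
    inner ℝ (hf.toLp f) (hg.toLp g) = ∫ x, f x * g x ∂μ := by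
  rw [L2.inner_def]
  refine integral_congr_ae ?_
  filter_upwards [hf.coeFn_toLp, hg.coeFn_toLp] with x h1 h2
  rw [h1, h2]
  simp [mul_comm]

lemma tendsto_integral_mul_of_tendsto_eLpNorm {β γ : ℕ → X → ℝ} {b c : X → ℝ}
    (hβ : ∀ n, MemLp (β n) 2 μ) (hb : MemLp b 2 μ)
    (hβb : Tendsto (fun n => eLpNorm (β n - b) 2 μ) atTop (𝓝 0))
    (hγ : ∀ n, MemLp (γ n) 2 μ) (hc : MemLp c 2 μ)
    (hγc : Tendsto (fun n => eLpNorm (γ n - c) 2 μ) atTop (𝓝 0)) :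
    Tendsto (fun n => ∫ x, β n x * γ n x ∂μ) atTop (𝓝 (∫ x, b x * c x ∂μ)) := by
  have h1 := (Lp.tendsto_Lp_iff_tendsto_eLpNorm'' β hβ b hb).2 hβb
  have h2 := (Lp.tendsto_Lp_iff_tendsto_eLpNorm'' γ hγ c hc).2 hγc
  have h3 := h1.inner h2 (𝕜 := ℝ)
  simpa only [inner_toLp] using h3

lemma tendsto_integral_sq_of_tendsto_eLpNorm {β : ℕ → X → ℝ} {b : X → ℝ}
    (hβ : ∀ n, MemLp (β n) 2 μ) (hb : MemLp b 2 μ)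
    (h : Tendsto (fun n => eLpNorm (β n - b) 2 μ) atTop (𝓝 0)) :
    Tendsto (fun n => ∫ x, (β n x - b x) ^ 2 ∂μ) atTop (𝓝 0) := by
  have h0 : Tendsto (fun n => eLpNorm ((β n - b) - 0) 2 μ) atTop (𝓝 0) := by simpa using h
  have := tendsto_integral_mul_of_tendsto_eLpNorm (fun n => (hβ n).sub hb) MemLp.zero h0
    (fun n => (hβ n).sub hb) MemLp.zero h0
  simpa [sq] using this

/-- Completeness of `L²`. -/
lemma exists_tendsto_eLpNorm_of_cauchy {β : ℕ → X → ℝ}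
    (hβ : ∀ n, MemLp (β n) 2 μ)
    (h : ∀ ε > 0, ∃ N, ∀ m ≥ N, ∀ n ≥ N, ∫ x, (β m x - β n x) ^ 2 ∂μ < ε) :
    ∃ b, MemLp b 2 μ ∧ Tendsto (fun n => eLpNorm (β n - b) 2 μ) atTop (𝓝 0) := by
  have hc : CauchySeq fun n => (hβ n).toLp (β n) := by
    refine Metric.cauchySeq_iff.2 fun ε hε => ?_
    obtain ⟨N, hN⟩ := h (ε ^ 2) (by positivity)
    refine ⟨N, fun m hm n hn => ?_⟩
    rw [dist_eq_norm, ← MemLp.toLp_sub, Lp.norm_toLp, eLpNorm_two_eq ((hβ m).sub (hβ n)),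
      ENNReal.toReal_ofReal (Real.sqrt_nonneg _), Real.sqrt_lt' hε]
    exact hN m hm n hn
  obtain ⟨b, hb⟩ := cauchySeq_tendsto_of_complete hc
  refine ⟨b, Lp.memLp b, ?_⟩
  rw [← Lp.tendsto_Lp_iff_tendsto_eLpNorm'' β hβ b (Lp.memLp b)]
  simpa using hb

lemma memLp_of_continuous [TopologicalSpace X] [CompactSpace X] [OpensMeasurableSpace X]
    [IsFiniteMeasure μ] {f : X → ℝ} (hf : Continuous f) {p : ℝ≥0∞} : MemLp f p μ := by
  obtain ⟨C, -, hC⟩ := exists_bound hf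
  exact MemLp.of_bound hf.aestronglyMeasurable C (ae_of_all _ hC)

lemma memLp_continuous_mul [TopologicalSpace X] [CompactSpace X] [OpensMeasurableSpace X]
    {f g : X → ℝ} (hf : Continuous f) (hg : MemLp g 2 μ) : MemLp (fun x => f x * g x) 2 μ := by
  obtain ⟨C, -, hC⟩ := exists_bound hf
  refine hg.of_le_mul (c := C) (hf.aestronglyMeasurable.mul hg.1) (ae_of_all _ fun x => ?_)
  rw [norm_mul]
  exact mul_le_mul_of_nonneg_right (hC x) (norm_nonneg _)

/-- Write `α β - a b = α (β - b) + (α - a) b`: the first factor of each product is uniformly bounded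
or uniformly small. This is what makes `H1C` stable under products and composition. -/
lemma tendsto_eLpNorm_mul_of_tendstoUniformly [TopologicalSpace X] [CompactSpace X]
    [OpensMeasurableSpace X] {α β : ℕ → X → ℝ} {a b : X → ℝ}
    (hα : ∀ n, Continuous (α n)) (ha : Continuous a) (hαa : TendstoUniformly α a atTop)
    (hβ : ∀ n, MemLp (β n) 2 μ) (hb : MemLp b 2 μ)
    (hβb : Tendsto (fun n => eLpNorm (β n - b) 2 μ) atTop (𝓝 0)) :
    Tendsto (fun n => eLpNorm ((fun x => α n x * β n x) - fun x => a x * b x) 2 μ)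
      atTop (𝓝 0) := by
  obtain ⟨C, hC0, hC⟩ := exists_bound ha
  have key : ∀ ε : ℝ, 0 < ε → ε ≤ 1 → ∀ᶠ n in atTop,
      eLpNorm ((fun x => α n x * β n x) - fun x => a x * b x) 2 μ ≤
        ENNReal.ofReal (C + 1) * eLpNorm (β n - b) 2 μ + ENNReal.ofReal ε * eLpNorm b 2 μ := by
    intro ε hε hε1
    filter_upwards [Metric.tendstoUniformly_iff.1 hαa ε hε] with n hn
    have e : ((fun x => α n x * β n x) - fun x => a x * b x) =
        (fun x => α n x * (β n - b) x) + fun x => (α n x - a x) * b x := by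
      ext x; simp; ring
    rw [e]
    refine (eLpNorm_add_le (memLp_continuous_mul (hα n) ((hβ n).sub hb)).1
      (memLp_continuous_mul ((hα n).sub ha) hb).1 (by norm_num)).trans (add_le_add ?_ ?_)
    · refine eLpNorm_le_mul_eLpNorm_of_ae_le_mul (ae_of_all _ fun x => ?_) _
      rw [norm_mul]
      refine mul_le_mul_of_nonneg_right ?_ (norm_nonneg _)
      have h1 := hn x
      rw [Real.dist_eq] at h1
      have h2 := abs_lt.1 h1
      have h3 := abs_le.1 (hC x)
      rw [Real.norm_eq_abs, abs_le]
      constructor <;> linarith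
    · refine eLpNorm_le_mul_eLpNorm_of_ae_le_mul (ae_of_all _ fun x => ?_) _
      rw [norm_mul]
      refine mul_le_mul_of_nonneg_right ?_ (norm_nonneg _)
      have h1 := hn x
      rw [dist_comm, Real.dist_eq] at h1
      exact h1.le
  rw [ENNReal.tendsto_nhds_zero]
  intro δ hδ
  have hb' := hb.eLpNorm_ne_top
  obtain ⟨ε, hε, hε1, hεb⟩ : ∃ ε : ℝ, 0 < ε ∧ ε ≤ 1 ∧
      ENNReal.ofReal ε * eLpNorm b 2 μ ≤ δ / 2 := by
    have h1 : Tendsto (fun ε : ℝ => ENNReal.ofReal ε * eLpNorm b 2 μ) (𝓝[>] 0) (𝓝 0) := by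
      have := ENNReal.Tendsto.mul_const (b := eLpNorm b 2 μ) (ENNReal.tendsto_ofReal
        (tendsto_nhdsWithin_of_tendsto_nhds (s := Ioi 0) (tendsto_id (x := 𝓝 (0 : ℝ)))))
        (Or.inr hb')
      simpa using this
    have h2 := (h1.eventually_le_const (show (0 : ℝ≥0∞) < δ / 2 by simpa using hδ.ne'))
    have h3 : ∀ᶠ ε : ℝ in 𝓝[>] 0, ε ∈ Ioc (0 : ℝ) 1 := Ioc_mem_nhdsGT one_pos
    obtain ⟨ε, h4, h5⟩ := (h2.and h3).exists
    exact ⟨ε, h5.1, h5.2, h4⟩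
  have h6 : Tendsto (fun n => ENNReal.ofReal (C + 1) * eLpNorm (β n - b) 2 μ) atTop (𝓝 0) := by
    simpa using ENNReal.Tendsto.const_mul (a := ENNReal.ofReal (C + 1)) hβb (Or.inr (by simp))
  filter_upwards [key ε hε hε1,
    h6.eventually_le_const (show (0 : ℝ≥0∞) < δ / 2 by simpa using hδ.ne')] with n h7 h8
  exact h7.trans ((add_le_add h8 hεb).trans_eq (ENNReal.add_halves δ))

lemma tendsto_eLpNorm_of_tendstoUniformly [TopologicalSpace X] [CompactSpace X]
    [OpensMeasurableSpace X] [IsFiniteMeasure μ] {α : ℕ → X → ℝ} {a : X → ℝ}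
    (hα : ∀ n, Continuous (α n)) (ha : Continuous a) (hαa : TendstoUniformly α a atTop) :
    Tendsto (fun n => eLpNorm (α n - a) 2 μ) atTop (𝓝 0) := by
  have h := tendsto_eLpNorm_mul_of_tendstoUniformly (μ := μ) (β := fun _ _ => 1)
    (b := fun _ => 1) hα ha hαa (fun _ => memLp_const _) (memLp_const _) (by simp)
  simp only [mul_one] at h
  exact h

lemma tendsto_integral_of_tendstoUniformly [IsFiniteMeasure μ] [TopologicalSpace X]
    [CompactSpace X] [OpensMeasurableSpace X] {α : ℕ → X → ℝ} {a : X → ℝ}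
    (hα : ∀ n, Continuous (α n)) (ha : Continuous a) (hαa : TendstoUniformly α a atTop) :
    Tendsto (fun n => ∫ x, α n x ∂μ) atTop (𝓝 (∫ x, a x ∂μ)) := by
  simpa using tendsto_integral_mul_of_tendsto_eLpNorm (μ := μ) (fun n => memLp_of_continuous (hα n))
    (memLp_of_continuous ha) (tendsto_eLpNorm_of_tendstoUniformly hα ha hαa)
    (γ := fun _ _ => 1) (c := fun _ => 1) (fun _ => memLp_const _) (memLp_const _) (by simp)

end L2

/-! ### Mollification on the torus -/

section Mollifier

variable {ι : Type} [Fintype ι] [DecidableEq ι]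

/-- The function `∏ i, (1 + cos (2 π z_i)) / 2`, whose maximum is attained only at `0`. -/
def bump (z : UnitAddTorus ι) : ℝ := ∏ i, (1 + (fourier 1 (z i)).re) / 2

lemma continuous_bump : Continuous (bump : UnitAddTorus ι → ℝ) := by
  unfold bump
  fun_prop

lemma norm_fourier_apply (x : UnitAddCircle) : ‖fourier 1 x‖ = 1 := by
  rw [fourier_apply]; exact Circle.norm_coe _

lemma bump_factor_nonneg (x : UnitAddCircle) : 0 ≤ (1 + (fourier 1 x).re) / 2 := by
  have h := (abs_le.1 (Complex.abs_re_le_norm (fourier 1 x))).1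
  rw [norm_fourier_apply] at h
  linarith

lemma bump_factor_le (x : UnitAddCircle) : (1 + (fourier 1 x).re) / 2 ≤ 1 := by
  have h := (abs_le.1 (Complex.abs_re_le_norm (fourier 1 x))).2
  rw [norm_fourier_apply] at h
  linarith

lemma bump_factor_lt {x : UnitAddCircle} (hx : x ≠ 0) : (1 + (fourier 1 x).re) / 2 < 1 := by
  refine (bump_factor_le x).lt_of_ne fun h => hx ?_
  have hre : (fourier 1 x).re = 1 := by linarith
  have hn := norm_fourier_apply x
  have him : (fourier 1 x).im = 0 := by
    have := Complex.sq_norm_sub_sq_re (fourier 1 x)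
    rw [hn, hre] at this
    nlinarith
  have h1 : fourier 1 x = 1 := Complex.ext hre him
  rw [fourier_one] at h1
  have h2 : AddCircle.toCircle x = AddCircle.toCircle (0 : UnitAddCircle) := by
    rw [AddCircle.toCircle_zero]
    exact Subtype.ext h1
  exact AddCircle.injective_toCircle one_ne_zero h2

lemma bump_nonneg (z : UnitAddTorus ι) : 0 ≤ bump z :=
  Finset.prod_nonneg fun _ _ => bump_factor_nonneg _

lemma bump_zero : bump (0 : UnitAddTorus ι) = 1 := by
  simp [bump]

lemma bump_lt {z : UnitAddTorus ι} (hz : z ≠ 0) : bump z < 1 := by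
  obtain ⟨i, hi⟩ := Function.ne_iff.1 hz
  rw [bump, ← Finset.mul_prod_erase _ _ (Finset.mem_univ i)]
  have h1 : ∏ j ∈ Finset.univ.erase i, (1 + (fourier 1 (z j)).re) / 2 ≤ 1 :=
    Finset.prod_le_one (fun _ _ => bump_factor_nonneg _) fun _ _ => bump_factor_le _
  have h2 : 0 ≤ ∏ j ∈ Finset.univ.erase i, (1 + (fourier 1 (z j)).re) / 2 :=
    Finset.prod_nonneg fun _ _ => bump_factor_nonneg _
  have h3 := bump_factor_lt hi
  have h4 := bump_factor_nonneg (z i)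
  nlinarith

lemma bump_neg (z : UnitAddTorus ι) : bump (-z) = bump z := by
  unfold bump
  refine Finset.prod_congr rfl fun i _ => ?_
  rw [Pi.neg_apply, fourier_one, fourier_one, AddCircle.toCircle_neg, Circle.coe_inv_eq_conj,
    Complex.conj_re]

/-- The normalized power `bump ^ n / ∫ bump ^ n`. -/
def mollKernel (n : ℕ) (z : UnitAddTorus ι) : ℝ := (∫ w : UnitAddTorus ι, bump w ^ n)⁻¹ * bump z ^ n

lemma continuous_mollKernel (n : ℕ) : Continuous (mollKernel n : UnitAddTorus ι → ℝ) :=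
  continuous_const.mul (continuous_bump.pow n)

lemma integral_bump_pow_pos (n : ℕ) : 0 < ∫ w : UnitAddTorus ι, bump w ^ n := by
  have hc : Continuous fun w : UnitAddTorus ι => bump w ^ n := continuous_bump.pow n
  refine (integral_pos_iff_support_of_nonneg (fun w => pow_nonneg (bump_nonneg w) n)
    (integrable_of_continuous hc)).2 ?_
  refine hc.isOpen_support.measure_pos _ ⟨0, ?_⟩
  simp [bump_zero]

lemma mollKernel_nonneg (n : ℕ) (z : UnitAddTorus ι) : 0 ≤ mollKernel n z :=
  mul_nonneg (inv_nonneg.2 (integral_bump_pow_pos n).le) (pow_nonneg (bump_nonneg z) n)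

lemma integral_mollKernel (n : ℕ) : ∫ z : UnitAddTorus ι, mollKernel n z = 1 := by
  unfold mollKernel
  rw [integral_const_mul, inv_mul_cancel₀ (integral_bump_pow_pos n).ne']

lemma mollKernel_neg (n : ℕ) (z : UnitAddTorus ι) : mollKernel n (-z) = mollKernel n z := by
  simp [mollKernel, bump_neg]

/-- The mollification `mollKernel n * f`. -/
def moll (n : ℕ) (f : UnitAddTorus ι → ℝ) (z : UnitAddTorus ι) : ℝ :=
  ∫ w, mollKernel n (z - w) * f w

lemma moll_eq (n : ℕ) (f : UnitAddTorus ι → ℝ) (z : UnitAddTorus ι) :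
    moll n f z = ∫ w, mollKernel n w * f (z - w) := by
  rw [moll, ← integral_sub_left_eq_self (fun w => mollKernel n (z - w) * f w) volume z]
  simp

/-- `k (z - w)` is a finite sum of products of smooth functions of `z` and of continuous functions
of `w`. -/
def IsSeparable (k : UnitAddTorus ι → ℝ) : Prop :=
  ∃ (J : Type) (_ : Fintype J) (a b : J → UnitAddTorus ι → ℝ),
    (∀ j, TorusContDiff ∞ (a j)) ∧ (∀ j, Continuous (b j)) ∧
      ∀ z w, k (z - w) = ∑ j, a j z * b j w

lemma IsSeparable.const (c : ℝ) : IsSeparable (fun _ : UnitAddTorus ι => c) :=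
  ⟨Unit, inferInstance, fun _ _ => c, fun _ _ => 1, fun _ => TorusContDiff.const _,
    fun _ => continuous_const, by simp⟩

lemma IsSeparable.mul {k l : UnitAddTorus ι → ℝ} (hk : IsSeparable k) (hl : IsSeparable l) :
    IsSeparable (fun z => k z * l z) := by
  obtain ⟨J, _, a, b, ha, hb, h⟩ := hk
  obtain ⟨J', _, a', b', ha', hb', h'⟩ := hl
  refine ⟨J × J', inferInstance, fun j z => a j.1 z * a' j.2 z, fun j z => b j.1 z * b' j.2 z,
    fun j => (ha _).mul (ha' _), fun j => (hb _).mul (hb' _), fun z w => ?_⟩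
  change k (z - w) * l (z - w) = _
  rw [h, h', Finset.sum_mul_sum, Fintype.sum_prod_type]
  exact Finset.sum_congr rfl fun i _ => Finset.sum_congr rfl fun j _ => by ring

lemma IsSeparable.prod {κ : Type} (s : Finset κ) {k : κ → UnitAddTorus ι → ℝ}
    (hk : ∀ j, IsSeparable (k j)) : IsSeparable (fun z => ∏ j ∈ s, k j z) := by
  classical
  induction s using Finset.induction_on with
  | empty => simpa using IsSeparable.const (ι := ι) 1
  | insert j s hj ih =>
    simp only [Finset.prod_insert hj]
    exact (hk j).mul ih

lemma IsSeparable.pow {k : UnitAddTorus ι → ℝ} (hk : IsSeparable k) (n : ℕ) :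
    IsSeparable (fun z => k z ^ n) := by
  simpa using IsSeparable.prod (Finset.range n) (k := fun _ => k) fun _ => hk

lemma torusContDiff_fourier_re (i : ι) :
    TorusContDiff ∞ (fun z : UnitAddTorus ι => (fourier 1 (z i)).re) := by
  have : (fun u : ι → ℝ => (fourier 1 (proj u i)).re) =
      fun u => Real.cos (2 * Real.pi * u i) := by
    ext u
    rw [proj, fourier_coe_apply, Complex.exp_re]
    simp
  unfold TorusContDiff
  rw [this]
  fun_prop

lemma torusContDiff_fourier_im (i : ι) :
    TorusContDiff ∞ (fun z : UnitAddTorus ι => (fourier 1 (z i)).im) := by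
  have : (fun u : ι → ℝ => (fourier 1 (proj u i)).im) =
      fun u => Real.sin (2 * Real.pi * u i) := by
    ext u
    rw [proj, fourier_coe_apply, Complex.exp_im]
    simp
  unfold TorusContDiff
  rw [this]
  fun_prop

/-- This is the addition formula for the cosine, with three products. -/
lemma isSeparable_bump_factor (i : ι) :
    IsSeparable (fun z : UnitAddTorus ι => (1 + (fourier 1 (z i)).re) / 2) := by
  refine ⟨Fin 3, inferInstance,
    ![fun _ => 1 / 2, fun z => 1 / 2 * (fourier 1 (z i)).re, fun z => 1 / 2 * (fourier 1 (z i)).im],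
    ![fun _ => 1, fun z => (fourier 1 (z i)).re, fun z => (fourier 1 (z i)).im],
    fun j => ?_, fun j => ?_, fun z w => ?_⟩
  · fin_cases j
    · exact TorusContDiff.const _
    · exact (TorusContDiff.const _).mul (torusContDiff_fourier_re i)
    · exact (TorusContDiff.const _).mul (torusContDiff_fourier_im i)
  · fin_cases j
    · exact continuous_const
    · exact (torusContDiff_fourier_re i).continuous
    · exact (torusContDiff_fourier_im i).continuous
  · rw [Fin.sum_univ_three]
    simp only [Matrix.cons_val_zero, Matrix.cons_val_one, Matrix.cons_val, Pi.sub_apply]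
    rw [fourier_one, fourier_one, fourier_one, sub_eq_add_neg, AddCircle.toCircle_add,
      AddCircle.toCircle_neg, Circle.coe_mul, Circle.coe_inv_eq_conj, Complex.mul_re,
      Complex.conj_re, Complex.conj_im]
    ring

lemma isSeparable_mollKernel (n : ℕ) : IsSeparable (mollKernel n : UnitAddTorus ι → ℝ) :=
  (IsSeparable.const _).mul ((IsSeparable.prod _ isSeparable_bump_factor).pow n)

/-- The kernel is a trigonometric polynomial, so `moll n f` is a finite combination of smooth
functions with coefficients `∫ b_j f`. Smoothness thus needs only integrability of `f`, and no
differentiation under the integral. -/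
lemma torusContDiff_moll (n : ℕ) {f : UnitAddTorus ι → ℝ} (hf : Integrable f) :
    TorusContDiff ∞ (moll n f) := by
  obtain ⟨J, _, a, b, ha, hb, h⟩ := isSeparable_mollKernel (ι := ι) n
  have hint : ∀ j, Integrable fun w => b j w * f w := fun j => by
    obtain ⟨C, -, hC⟩ := exists_bound (hb j)
    exact hf.bdd_mul (hb j).aestronglyMeasurable (ae_of_all _ hC)
  have : moll n f = fun z => ∑ j, a j z * ∫ w, b j w * f w := by
    ext z
    simp only [moll, h, Finset.sum_mul, mul_assoc]
    rw [integral_finsetSum _ fun j _ => (hint j).const_mul _]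
    exact Finset.sum_congr rfl fun j _ => integral_const_mul _ _
  rw [this]
  exact TorusContDiff.sum fun j _ => (ha j).mul (TorusContDiff.const _)

/-- With the translation put on `f`, the derivative falls on `f`: mollification commutes with the
gradient. -/
lemma HasGrad.moll {f : UnitAddTorus ι → ℝ} {g : ι → UnitAddTorus ι → ℝ} (h : HasGrad f g)
    (n : ℕ) : HasGrad (moll n f) (fun i => moll n (g i)) := by
  refine ⟨(torusContDiff_moll n (integrable_of_continuous h.cont)).continuous,
    fun i => (torusContDiff_moll n (integrable_of_continuous (h.cont_grad i))).continuous,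
    fun i z => ?_⟩
  obtain ⟨C, -, hC⟩ := exists_bound (h.cont_grad i)
  have hk := continuous_mollKernel (ι := ι) n
  have h0 := h.cont
  have h1 := h.cont_grad i
  have := (hasDerivAt_integral_of_dominated_loc_of_deriv_le (μ := volume) (x₀ := (0 : ℝ))
    (s := univ)
    (F := fun (s : ℝ) (w : UnitAddTorus ι) => mollKernel n w * f (z + proj (Pi.single i s) - w))
    (F' := fun s w => mollKernel n w * g i (z + proj (Pi.single i s) - w))
    (bound := fun w => mollKernel n w * C) univ_mem
    (Eventually.of_forall fun s => Continuous.aestronglyMeasurable (by fun_prop))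
    (integrable_of_continuous (by fun_prop))
    (Continuous.aestronglyMeasurable (by fun_prop))
    (ae_of_all _ fun w s _ => by
      rw [norm_mul, Real.norm_of_nonneg (mollKernel_nonneg n w)]
      exact mul_le_mul_of_nonneg_left (hC _) (mollKernel_nonneg n w))
    (integrable_of_continuous (by fun_prop))
    (ae_of_all _ fun w s _ => by
      have := (h.hasDerivAt i (z - w) s).const_mul (mollKernel n w)
      simpa only [sub_add_eq_add_sub] using this)).2
  simp only [moll_eq]
  simpa using this

/-- Mollification is symmetric. -/
lemma integral_moll_mul (n : ℕ) {f g : UnitAddTorus ι → ℝ} (hf : Integrable f)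
    (hg : Continuous g) : ∫ z, moll n f z * g z = ∫ z, f z * moll n g z := by
  have hk := continuous_mollKernel (ι := ι) n
  simp only [moll, ← integral_mul_const, ← integral_const_mul]
  rw [integral_integral_swap]
  · refine integral_congr_ae (ae_of_all _ fun w => integral_congr_ae (ae_of_all _ fun z => ?_))
    simp only
    rw [← mollKernel_neg, neg_sub]
    ring
  · have h1 : Continuous fun p : UnitAddTorus ι × UnitAddTorus ι =>
        mollKernel n (p.1 - p.2) * g p.1 := by fun_prop
    obtain ⟨C, -, hC⟩ := exists_bound h1
    have h2 := (hf.comp_snd (volume : Measure (UnitAddTorus ι))).bdd_mul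
      h1.aestronglyMeasurable (ae_of_all _ hC)
    refine h2.congr (ae_of_all _ fun p => ?_)
    simp only [Function.uncurry]
    ring

/-- Mollification is a contraction of `L²`. -/
lemma integral_sq_moll_le (n : ℕ) {f : UnitAddTorus ι → ℝ} (hf : MemLp f 2) :
    ∫ z, moll n f z ^ 2 ≤ ∫ z, f z ^ 2 := by
  have hk := continuous_mollKernel (ι := ι) n
  have hfi : Integrable f := hf.integrable (by norm_num)
  have hfs := integrable_sq hf
  have hkz : ∀ z : UnitAddTorus ι, Continuous fun w => mollKernel n (z - w) := fun z => by fun_prop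
  have hb : ∀ (z : UnitAddTorus ι) {u : UnitAddTorus ι → ℝ}, Integrable u →
      Integrable fun w => mollKernel n (z - w) * u w := fun z u hu => by
    obtain ⟨C, -, hC⟩ := exists_bound (hkz z)
    exact hu.bdd_mul (hkz z).aestronglyMeasurable (ae_of_all _ hC)
  have h1 : ∀ z, ∫ w : UnitAddTorus ι, mollKernel n (z - w) = 1 := fun z => by
    rw [integral_sub_left_eq_self (mollKernel n) volume z, integral_mollKernel]
  -- Jensen's inequality for the probability density `mollKernel n (z - ·)`, obtained from the
  -- nonnegativity of the variance.
  have hpt : ∀ z, moll n f z ^ 2 ≤ moll n (fun w => f w ^ 2) z := fun z => by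
    set m := moll n f z with hm
    have h2 : 0 ≤ ∫ w, mollKernel n (z - w) * (f w - m) ^ 2 :=
      integral_nonneg fun w => mul_nonneg (mollKernel_nonneg _ _) (sq_nonneg _)
    have h3 : ∫ w, mollKernel n (z - w) * (f w - m) ^ 2 =
        moll n (fun w => f w ^ 2) z - 2 * m * m + m ^ 2 := by
      have e : ∀ w, mollKernel n (z - w) * (f w - m) ^ 2 =
          mollKernel n (z - w) * f w ^ 2 - 2 * m * (mollKernel n (z - w) * f w) +
            m ^ 2 * mollKernel n (z - w) := fun w => by ring
      simp only [e]
      rw [integral_add (by exact (hb z hfs).sub ((hb z hfi).const_mul _))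
        ((integrable_of_continuous (hkz z)).const_mul _), integral_sub (hb z hfs)
        ((hb z hfi).const_mul _), integral_const_mul, integral_const_mul, h1, mul_one]
      rfl
    nlinarith
  have hsm : Continuous (moll n f) := (torusContDiff_moll n hfi).continuous
  have hsm2 : Continuous (moll n fun w => f w ^ 2) := (torusContDiff_moll n hfs).continuous
  calc ∫ z, moll n f z ^ 2 ≤ ∫ z, moll n (fun w => f w ^ 2) z * 1 := by
        simp only [mul_one]
        exact integral_mono (integrable_of_continuous (hsm.pow 2)) (integrable_of_continuous hsm2) hpt
    _ = ∫ z, f z ^ 2 * moll n (fun _ => 1) z := integral_moll_mul n hfs continuous_const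
    _ = ∫ z, f z ^ 2 := by
        simp only [moll, mul_one, h1]

lemma moll_sub (n : ℕ) {f g : UnitAddTorus ι → ℝ} (hf : Integrable f) (hg : Integrable g)
    (z : UnitAddTorus ι) : moll n (fun w => f w - g w) z = moll n f z - moll n g z := by
  have hkz : Continuous fun w => mollKernel n (z - w) :=
    (continuous_mollKernel n).comp (continuous_const.sub continuous_id)
  obtain ⟨C, -, hC⟩ := exists_bound hkz
  simp only [moll, mul_sub]
  exact integral_sub (hf.bdd_mul hkz.aestronglyMeasurable (ae_of_all _ hC))
    (hg.bdd_mul hkz.aestronglyMeasurable (ae_of_all _ hC))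

/-- The peak-function theorem is applied to `w ↦ f (· - w)` with values in the space of continuous
functions, so that convergence in the sup norm comes out directly. -/
lemma tendstoUniformly_moll {f : UnitAddTorus ι → ℝ} (hf : Continuous f) :
    TendstoUniformly (fun n => moll n f) f atTop := by
  let G : C(UnitAddTorus ι, C(UnitAddTorus ι, ℝ)) :=
    ContinuousMap.curry ⟨fun p : UnitAddTorus ι × UnitAddTorus ι => f (p.2 - p.1), by fun_prop⟩
  have h := tendsto_setIntegral_pow_smul_of_unique_maximum_of_isCompact_of_continuousOn
    (μ := (volume : Measure (UnitAddTorus ι))) (s := univ) (x₀ := 0) (c := bump) (g := G)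
    isCompact_univ continuous_bump.continuousOn (fun y _ hy => by rw [bump_zero]; exact bump_lt hy)
    (fun x _ => bump_nonneg x) (by rw [bump_zero]; exact one_pos) (by simp)
    G.continuous.continuousOn
  rw [ContinuousMap.tendsto_iff_tendstoUniformly] at h
  have h0 : ⇑(G 0) = f := by
    ext z; simp [G]
  rw [h0] at h
  convert h using 1
  ext n z
  have hi : Integrable (fun x : UnitAddTorus ι => bump x ^ n • G x) :=
    integrable_of_continuous ((continuous_bump.pow n).smul G.continuous)
  simp only [Measure.restrict_univ, ContinuousMap.coe_smul, Pi.smul_apply]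
  have he := ContinuousLinearMap.integral_comp_comm (ContinuousMap.evalCLM ℝ z) hi
  simp only [ContinuousMap.evalCLM_apply] at he
  rw [moll_eq, ← he]
  simp only [mollKernel, mul_assoc]
  rw [integral_const_mul]
  simp [G]

/-- Density argument: uniform convergence for a continuous approximation of `f`, and the `L²`
contraction for the difference. -/
lemma tendsto_eLpNorm_moll {f : UnitAddTorus ι → ℝ} (hf : MemLp f 2) :
    Tendsto (fun n => eLpNorm (moll n f - f) 2 volume) atTop (𝓝 0) := by
  have hfi : Integrable f := hf.integrable (by norm_num)
  have hm : ∀ n, ∀ {u : UnitAddTorus ι → ℝ}, Integrable u → MemLp (moll n u) 2 :=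
    fun n u hu => memLp_of_continuous (torusContDiff_moll n hu).continuous
  rw [ENNReal.tendsto_nhds_zero]
  intro δ hδ
  have hδ3 : δ / 3 ≠ 0 := by simpa using hδ.ne'
  obtain ⟨g, hg, hgm⟩ := hf.exists_boundedContinuous_eLpNorm_sub_le (by norm_num) hδ3
  have hgi : Integrable g := integrable_of_continuous g.continuous
  have h1 := tendsto_eLpNorm_of_tendstoUniformly (μ := (volume : Measure (UnitAddTorus ι)))
    (fun n => (torusContDiff_moll n hgi).continuous) g.continuous
    (tendstoUniformly_moll g.continuous)
  filter_upwards [h1.eventually_le_const (pos_iff_ne_zero.2 hδ3)] with n hn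
  have e : moll n f - f = (moll n (fun w => f w - g w) + (moll n g - g)) + (g - f) := by
    ext z
    simp only [Pi.add_apply, Pi.sub_apply, moll_sub n hfi hgi]
    ring
  have h2 : eLpNorm (moll n fun w => f w - g w) 2 volume ≤ δ / 3 := by
    refine le_trans ?_ hg
    have h4 : MemLp (moll n fun w => f w - g w) 2 := hm n (hfi.sub hgi)
    rw [eLpNorm_two_eq h4, eLpNorm_two_eq (hf.sub hgm)]
    exact ENNReal.ofReal_le_ofReal (Real.sqrt_le_sqrt (integral_sq_moll_le n (hf.sub hgm)))
  have h3 : eLpNorm (⇑g - f) 2 volume ≤ δ / 3 := by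
    rw [← eLpNorm_neg, neg_sub]; exact hg
  rw [e]
  calc _ ≤ eLpNorm (moll n fun w => f w - g w) 2 volume + eLpNorm (moll n g - ⇑g) 2 volume +
        eLpNorm (⇑g - f) 2 volume := by
        refine (eLpNorm_add_le ((hm n (hfi.sub hgi)).add ((hm n hgi).sub hgm)).1
          (hgm.sub hf).1 (by norm_num)).trans (add_le_add ?_ le_rfl)
        exact eLpNorm_add_le (hm n (hfi.sub hgi)).1 ((hm n hgi).sub hgm).1 (by norm_num)
    _ ≤ δ / 3 + δ / 3 + δ / 3 := add_le_add (add_le_add h2 hn) h3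
    _ = δ := ENNReal.add_thirds δ

end Mollifier

/-! ### Continuous functions of class `H¹` -/

section H1C

variable {ι : Type} [Fintype ι] [DecidableEq ι]

/-- `f` is continuous and of class `H¹` with gradient `g`: it is the limit of smooth functions, in
the uniform norm and in `H¹`. -/
structure H1C (f : UnitAddTorus ι → ℝ) (g : ι → UnitAddTorus ι → ℝ) : Prop where
  cont : Continuous f
  memLp : ∀ i, MemLp (g i) 2 volume
  approx : ∃ φ : ℕ → UnitAddTorus ι → ℝ, (∀ n, TorusContDiff ∞ (φ n)) ∧
    TendstoUniformly φ f atTop ∧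
    ∀ i, Tendsto (fun n => eLpNorm (pderiv i (φ n) - g i) 2 volume) atTop (𝓝 0)

lemma TorusContDiff.continuous_pderiv {φ : UnitAddTorus ι → ℝ} (h : TorusContDiff ∞ φ) (i : ι) :
    Continuous (ABF.pderiv i φ) := (h.hasGrad (by simp)).cont_grad i

lemma TorusContDiff.memLp_pderiv {φ : UnitAddTorus ι → ℝ} (h : TorusContDiff ∞ φ) (i : ι) :
    MemLp (ABF.pderiv i φ) 2 volume := memLp_of_continuous (h.continuous_pderiv i)

lemma HasGrad.h1C {f : UnitAddTorus ι → ℝ} {g : ι → UnitAddTorus ι → ℝ} (h : HasGrad f g) :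
    H1C f g := by
  refine ⟨h.cont, fun i => memLp_of_continuous (h.cont_grad i), fun n => ABF.moll n f,
    fun n => torusContDiff_moll n (integrable_of_continuous h.cont),
    tendstoUniformly_moll h.cont, fun i => ?_⟩
  simp only [(h.moll _).pderiv_eq]
  exact tendsto_eLpNorm_moll (memLp_of_continuous (h.cont_grad i))

lemma TendstoUniformly.mul_of_continuous {X : Type*} [TopologicalSpace X] [CompactSpace X]
    {α β : ℕ → X → ℝ} {a b : X → ℝ} (ha : Continuous a) (hb : Continuous b)
    (h : TendstoUniformly α a atTop) (h' : TendstoUniformly β b atTop) :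
    TendstoUniformly (fun n x => α n x * β n x) (fun x => a x * b x) atTop := by
  obtain ⟨A, hA0, hA⟩ := exists_bound ha
  obtain ⟨B, hB0, hB⟩ := exists_bound hb
  rw [Metric.tendstoUniformly_iff] at *
  intro ε hε
  set δ := min 1 (ε / (A + B + 2)) with hδ
  have hδ0 : 0 < δ := lt_min one_pos (by positivity)
  filter_upwards [h δ hδ0, h' δ hδ0] with n h1 h2 x
  have h3 := h1 x
  have h4 := h2 x
  rw [Real.dist_eq] at *
  have e : a x * b x - α n x * β n x =
      (a x - α n x) * b x + (a x * (b x - β n x) - (a x - α n x) * (b x - β n x)) := by ring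
  have hδ1 : δ ≤ 1 := min_le_left _ _
  have hδ2 : δ * (A + B + 2) ≤ ε := by
    have : δ ≤ ε / (A + B + 2) := min_le_right _ _
    rwa [le_div_iff₀ (by positivity)] at this
  calc |a x * b x - α n x * β n x|
      ≤ |a x - α n x| * |b x| + (|a x| * |b x - β n x| + |a x - α n x| * |b x - β n x|) := by
        rw [e, ← abs_mul, ← abs_mul, ← abs_mul]
        exact (abs_add_le _ _).trans (add_le_add le_rfl (abs_sub _ _))
    _ ≤ δ * B + (A * δ + δ * 1) := by
        gcongr
        · exact hB x
        · exact hA x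
        · exact h4.le.trans hδ1
    _ < δ * (A + B + 2) := by nlinarith
    _ ≤ ε := hδ2

namespace H1C

variable {f f₁ f₂ : UnitAddTorus ι → ℝ} {g g₁ g₂ : ι → UnitAddTorus ι → ℝ}

lemma congr (h : H1C f g) (hf : ∀ z, f₁ z = f z) (hg : ∀ i z, g₁ i z = g i z) : H1C f₁ g₁ := by
  obtain rfl : f₁ = f := funext hf
  obtain rfl : g₁ = g := funext fun i => funext (hg i)
  exact h

lemma mul (h₁ : H1C f₁ g₁) (h₂ : H1C f₂ g₂) :
    H1C (fun z => f₁ z * f₂ z) (fun i z => g₁ i z * f₂ z + f₁ z * g₂ i z) := by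
  obtain ⟨φ, hφ, hφf, hφg⟩ := h₁.approx
  obtain ⟨ψ, hψ, hψf, hψg⟩ := h₂.approx
  refine ⟨h₁.cont.mul h₂.cont, fun i => ?_, fun n z => φ n z * ψ n z, fun n => (hφ n).mul (hψ n),
    TendstoUniformly.mul_of_continuous h₁.cont h₂.cont hφf hψf, fun i => ?_⟩
  · have := (memLp_continuous_mul h₂.cont (h₁.memLp i)).add
      (memLp_continuous_mul h₁.cont (h₂.memLp i))
    refine this.ae_eq (ae_of_all _ fun z => ?_)
    simp [mul_comm]
  · have hp : ∀ n, pderiv i (fun z => φ n z * ψ n z) =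
        (fun z => ψ n z * pderiv i (φ n) z) + fun z => φ n z * pderiv i (ψ n) z := fun n => by
      rw [(((hφ n).hasGrad (by simp)).mul ((hψ n).hasGrad (by simp))).pderiv_eq]
      ext z
      simp [mul_comm]
    have e1 := tendsto_eLpNorm_mul_of_tendstoUniformly (fun n => (hψ n).continuous) h₂.cont hψf
      (fun n => (hφ n).memLp_pderiv i) (h₁.memLp i) (hφg i)
    have e2 := tendsto_eLpNorm_mul_of_tendstoUniformly (fun n => (hφ n).continuous) h₁.cont hφf
      (fun n => (hψ n).memLp_pderiv i) (h₂.memLp i) (hψg i)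
    have e3 := e1.add e2
    rw [add_zero] at e3
    refine tendsto_of_tendsto_of_tendsto_of_le_of_le tendsto_const_nhds e3 (fun _ => zero_le)
      fun n => ?_
    rw [hp n]
    refine le_trans (le_of_eq ?_) (eLpNorm_add_le
      ((memLp_continuous_mul (hψ n).continuous ((hφ n).memLp_pderiv i)).sub
        (memLp_continuous_mul h₂.cont (h₁.memLp i))).1
      ((memLp_continuous_mul (hφ n).continuous ((hψ n).memLp_pderiv i)).sub
        (memLp_continuous_mul h₁.cont (h₂.memLp i))).1 (by norm_num))
    congr 1
    ext z
    simp
    ring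

/-- By compactness `f` takes values in some `[a, C + 1]` with `a > c`. After a shift of the index
all approximants do too, and any `Θ` continuous on `(c, ∞)` is uniformly continuous there. This
allows composition with `log` and the inverse. -/
lemma exists_approx_gt (h : H1C f g) {c : ℝ} (hc : ∀ z, c < f z) :
    ∃ φ : ℕ → UnitAddTorus ι → ℝ, (∀ n, TorusContDiff ∞ (φ n)) ∧ (∀ n z, c < φ n z) ∧
      (∀ i, Tendsto (fun n => eLpNorm (pderiv i (φ n) - g i) 2 volume) atTop (𝓝 0)) ∧
      ∀ {Θ : ℝ → ℝ}, ContinuousOn Θ (Ioi c) →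
        TendstoUniformly (fun n z => Θ (φ n z)) (fun z => Θ (f z)) atTop := by
  obtain ⟨φ, hφ, hφf, hφg⟩ := h.approx
  obtain ⟨z₀, -, hz₀⟩ := isCompact_univ.exists_isMinOn univ_nonempty h.cont.continuousOn
  obtain ⟨C, -, hC⟩ := exists_bound h.cont
  set a := (c + f z₀) / 2 with ha
  have hca : c < a := by have := hc z₀; rw [ha]; linarith
  have haf : ∀ z, a + (f z₀ - c) / 2 ≤ f z := fun z => by
    have : f z₀ ≤ f z := hz₀ (mem_univ z)
    rw [ha]; linarith
  set K : Set ℝ := Icc a (C + 1) with hK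
  have hKc : K ⊆ Ioi c := fun x hx => hca.trans_le hx.1
  have hfK : ∀ z, f z ∈ K := fun z => ⟨by linarith [haf z, hc z₀], by
    linarith [(abs_le.1 (hC z)).2]⟩
  obtain ⟨N, hN⟩ : ∃ N, ∀ n ≥ N, ∀ z, φ n z ∈ K := by
    have hδ : 0 < min 1 ((f z₀ - c) / 2) := lt_min one_pos (by linarith [hc z₀])
    obtain ⟨N, hN⟩ := eventually_atTop.1 (Metric.tendstoUniformly_iff.1 hφf _ hδ)
    refine ⟨N, fun n hn z => ?_⟩
    have h1 := hN n hn z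
    rw [Real.dist_eq, abs_lt] at h1
    have h2 := min_le_left 1 ((f z₀ - c) / 2)
    have h3 := min_le_right 1 ((f z₀ - c) / 2)
    exact ⟨by linarith [haf z], by linarith [(abs_le.1 (hC z)).2]⟩
  have hψK : ∀ n z, φ (n + N) z ∈ K := fun n z => hN _ (Nat.le_add_left _ _) z
  have hψf : TendstoUniformly (fun n => φ (n + N)) f atTop := fun u hu =>
    (tendsto_add_atTop_nat N).eventually (hφf u hu)
  exact ⟨fun n => φ (n + N), fun n => hφ _, fun n z => hKc (hψK n z),
    fun i => (hφg i).comp (tendsto_add_atTop_nat N), fun {Θ} hΘ =>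
      (isCompact_Icc.uniformContinuousOn_of_continuous (hΘ.mono hKc)).comp_tendstoUniformly
        hψK hfK hψf⟩

/-- Chain rule. -/
lemma comp (h : H1C f g) {c : ℝ} (hc : ∀ z, c < f z) {Ψ Ψ' : ℝ → ℝ}
    (hΨ : ∀ x, c < x → ContDiffAt ℝ ∞ Ψ x) (hΨ' : ∀ x, c < x → HasDerivAt Ψ (Ψ' x) x) :
    H1C (fun z => Ψ (f z)) (fun i z => Ψ' (f z) * g i z) := by
  obtain ⟨ψ, hψ, hψc, hψg, huc⟩ := h.exists_approx_gt hc
  have hcΨ : ContinuousOn Ψ (Ioi c) := fun x hx => (hΨ' x hx).continuousAt.continuousWithinAt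
  have hcΨ' : ContinuousOn Ψ' (Ioi c) := by
    have h1 : ContDiffOn ℝ ∞ Ψ (Ioi c) := fun x hx => (hΨ x hx).contDiffWithinAt
    have h2 := h1.continuousOn_deriv_of_isOpen isOpen_Ioi (by simp)
    exact h2.congr fun x hx => (hΨ' x hx).deriv.symm
  have hgrad : ∀ n, HasGrad (fun z => Ψ (ψ n z)) (fun i z => Ψ' (ψ n z) * pderiv i (ψ n) z) :=
    fun n => ((hψ n).hasGrad (by simp)).comp (fun z => hΨ' _ (hψc n z))
      (hcΨ'.comp_continuous (hψ n).continuous fun z => hψc n z)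
  have hcf : Continuous fun z => Ψ' (f z) := hcΨ'.comp_continuous h.cont hc
  refine ⟨hcΨ.comp_continuous h.cont hc, fun i => memLp_continuous_mul hcf (h.memLp i),
    fun n z => Ψ (ψ n z), fun n => (hψ n).comp fun z => hΨ _ (hψc n z), huc hcΨ,
    fun i => ?_⟩
  simp only [(hgrad _).pderiv_eq]
  exact tendsto_eLpNorm_mul_of_tendstoUniformly
    (fun n => hcΨ'.comp_continuous (hψ n).continuous fun z => hψc n z) hcf (huc hcΨ')
    (fun n => (hψ n).memLp_pderiv i) (h.memLp i) (hψg i)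

/-- Weak equations may be tested against continuous functions of class `H¹`. -/
lemma integral_test (h : H1C f g) {W : ι → UnitAddTorus ι → ℝ} {r : UnitAddTorus ι → ℝ}
    (hW : ∀ i, MemLp (W i) 2 volume) (hr : MemLp r 2 volume)
    (hWr : ∀ φ : UnitAddTorus ι → ℝ, TorusContDiff ∞ φ →
      ∫ z, ∑ i, W i z * pderiv i φ z = ∫ z, r z * φ z) :
    ∫ z, ∑ i, W i z * g i z = ∫ z, r z * f z := by
  obtain ⟨φ, hφ, hφf, hφg⟩ := h.approx
  have h1 : Tendsto (fun n => ∑ i, ∫ z, W i z * pderiv i (φ n) z) atTop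
      (𝓝 (∑ i, ∫ z, W i z * g i z)) :=
    tendsto_finsetSum _ fun i _ => tendsto_integral_mul_of_tendsto_eLpNorm (fun _ => hW i) (hW i)
      (by simp) (fun n => (hφ n).memLp_pderiv i) (h.memLp i) (hφg i)
  have h2 : Tendsto (fun n => ∫ z, r z * φ n z) atTop (𝓝 (∫ z, r z * f z)) :=
    tendsto_integral_mul_of_tendsto_eLpNorm (fun _ => hr) hr
      (by simp) (fun n => memLp_of_continuous (hφ n).continuous) (memLp_of_continuous h.cont)
      (tendsto_eLpNorm_of_tendstoUniformly (fun n => (hφ n).continuous) h.cont hφf)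
  rw [integral_finsetSum _ fun i _ => integrable_mul_of_memLp (hW i) (h.memLp i)]
  refine tendsto_nhds_unique h1 (h2.congr fun n => ?_)
  rw [← hWr _ (hφ n), integral_finsetSum _ fun i _ =>
    integrable_mul_of_memLp (hW i) ((hφ n).memLp_pderiv i)]

lemma integral_laplacian (h : H1C f g) {φ : UnitAddTorus ι → ℝ} (hφ : TorusContDiff ∞ φ) :
    ∫ z, f z * laplacian φ z = - ∫ z, ∑ i, g i z * pderiv i φ z := by
  have hl : Continuous (laplacian φ) :=
    continuous_finsetSum _ fun i _ => (hφ.pderiv i).continuous_pderiv i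
  have := h.integral_test (W := fun i => pderiv i φ) (r := fun z => - laplacian φ z)
    (fun i => hφ.memLp_pderiv i) (memLp_of_continuous hl.neg) (fun ψ hψ => by
      have h1 := (hψ.hasGrad (by simp)).integral_laplacian hφ
      simp only [neg_mul, mul_comm (laplacian φ _), mul_comm (pderiv _ φ _)]
      rw [integral_neg, h1, neg_neg])
  simp only [neg_mul, integral_neg] at this
  simp only [mul_comm (f _), mul_comm (g _ _)]
  linarith

end H1C

/-- Interior regularity for the Poisson equation `Δ f = - ∇ · W` with `W ∈ L²`. -/
lemma exists_h1C_of_laplacian {f : UnitAddTorus ι → ℝ} (hf : Continuous f)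
    {W : ι → UnitAddTorus ι → ℝ} (hW : ∀ i, MemLp (W i) 2 volume)
    (h : ∀ φ : UnitAddTorus ι → ℝ, TorusContDiff ∞ φ →
      ∫ z, f z * laplacian φ z = ∫ z, ∑ i, W i z * pderiv i φ z) :
    ∃ g, H1C f g := by
  have hfi : Integrable f := integrable_of_continuous hf
  have hWi : ∀ i, Integrable (W i) := fun i => (hW i).integrable (by norm_num)
  have hs : ∀ n, TorusContDiff ∞ (moll n f) := fun n => torusContDiff_moll n hfi
  have hWs : ∀ n i, Continuous (moll n (W i)) := fun n i => (torusContDiff_moll n (hWi i)).continuous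
  -- Testing with `moll n φ` and moving the symmetric kernel to the other factor shows that `moll n
  -- f` solves the equation with mollified data.
  have heq : ∀ n, ∀ φ : UnitAddTorus ι → ℝ, TorusContDiff ∞ φ →
      ∑ i, ∫ z, pderiv i (moll n f) z * pderiv i φ z =
        - ∑ i, ∫ z, moll n (W i) z * pderiv i φ z := by
    intro n φ hφ
    have hmφ : TorusContDiff ∞ (moll n φ) :=
      torusContDiff_moll n (integrable_of_continuous hφ.continuous)
    have hp : ∀ i, pderiv i (moll n φ) = moll n (pderiv i φ) := fun i =>
      ((hφ.hasGrad (by simp)).moll n).pderiv_eq i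
    have hpp : ∀ i, pderiv i (pderiv i (moll n φ)) = moll n (pderiv i (pderiv i φ)) := fun i => by
      rw [hp]; exact (((hφ.pderiv i).hasGrad (by simp)).moll n).pderiv_eq i
    have h1 := h _ hmφ
    simp only [laplacian, Finset.mul_sum, hpp] at h1
    rw [integral_finsetSum _ fun i _ => integrable_of_continuous (hf.fun_mul (torusContDiff_moll n
        (integrable_of_continuous ((hφ.pderiv i).continuous_pderiv i))).continuous),
      integral_finsetSum _ fun i _ => integrable_mul_of_memLp (hW i) (hmφ.memLp_pderiv i)] at h1
    have h2 : ∀ i, ∫ z, f z * moll n (pderiv i (pderiv i φ)) z =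
        - ∫ z, pderiv i (moll n f) z * pderiv i φ z := fun i => by
      rw [← integral_moll_mul n hfi ((hφ.pderiv i).continuous_pderiv i)]
      exact ((hs n).hasGrad (by simp)).integral_mul_eq ((hφ.pderiv i).hasGrad (by simp)) i
    have h3 : ∀ i, ∫ z, W i z * pderiv i (moll n φ) z = ∫ z, moll n (W i) z * pderiv i φ z :=
      fun i => by
        rw [hp, integral_moll_mul n (hWi i) (hφ.continuous_pderiv i)]
    simp only [h2, h3, Finset.sum_neg_distrib] at h1
    linarith
  -- The equation of `moll m f - moll n f` is tested with this very difference. The mollified data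
  -- converge in `L²`, hence the gradients form a Cauchy sequence.
  have henergy : ∀ m n, ∑ i, ∫ z, (pderiv i (moll m f) z - pderiv i (moll n f) z) ^ 2 ≤
      ∑ i, ∫ z, (moll m (W i) z - moll n (W i) z) ^ 2 := by
    intro m n
    set φ : UnitAddTorus ι → ℝ := fun z => moll m f z - moll n f z with hφd
    have hφ : TorusContDiff ∞ φ := (hs m).sub (hs n)
    have hpφ : ∀ i, pderiv i φ = fun z => pderiv i (moll m f) z - pderiv i (moll n f) z :=
      fun i => (((hs m).hasGrad (by simp)).sub ((hs n).hasGrad (by simp))).pderiv_eq i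
    have hc : ∀ n i, Continuous (pderiv i (moll n f)) := fun n i => (hs n).continuous_pderiv i
    have h1 := heq m φ hφ
    have h2 := heq n φ hφ
    have h3 : ∑ i, ∫ z, (pderiv i (moll m f) z - pderiv i (moll n f) z) ^ 2 =
        - ∑ i, ∫ z, (moll m (W i) z - moll n (W i) z) * pderiv i φ z := by
      have e1 : ∀ i, ∫ z, (pderiv i (moll m f) z - pderiv i (moll n f) z) ^ 2 =
          (∫ z, pderiv i (moll m f) z * pderiv i φ z) -
            ∫ z, pderiv i (moll n f) z * pderiv i φ z := fun i => by
        rw [← integral_sub (integrable_of_continuous ((hc m i).fun_mul (hφ.continuous_pderiv i)))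
          (integrable_of_continuous ((hc n i).fun_mul (hφ.continuous_pderiv i)))]
        simp only [hpφ]
        exact integral_congr_ae (ae_of_all _ fun z => by simp only; ring)
      have e2 : ∀ i, ∫ z, (moll m (W i) z - moll n (W i) z) * pderiv i φ z =
          (∫ z, moll m (W i) z * pderiv i φ z) - ∫ z, moll n (W i) z * pderiv i φ z := fun i => by
        rw [← integral_sub (integrable_of_continuous ((hWs m i).fun_mul (hφ.continuous_pderiv i)))
          (integrable_of_continuous ((hWs n i).fun_mul (hφ.continuous_pderiv i)))]
        exact integral_congr_ae (ae_of_all _ fun z => by simp only; ring)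
      simp only [e1, e2, Finset.sum_sub_distrib]
      linarith
    have h4 : ∀ i, - ∫ z, (moll m (W i) z - moll n (W i) z) * pderiv i φ z ≤
        (1 / 2) * (∫ z, (moll m (W i) z - moll n (W i) z) ^ 2) +
          (1 / 2) * ∫ z, (pderiv i (moll m f) z - pderiv i (moll n f) z) ^ 2 := fun i => by
      have i1 := hWs m i
      have i2 := hWs n i
      have i3 := hc m i
      have i4 := hc n i
      rw [← integral_const_mul, ← integral_const_mul, ← integral_neg,
        ← integral_add (integrable_of_continuous (by fun_prop))
          (integrable_of_continuous (by fun_prop))]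
      refine integral_mono (integrable_of_continuous (by rw [hpφ]; fun_prop))
        (integrable_of_continuous (by fun_prop)) fun z => ?_
      simp only [hpφ]
      nlinarith [sq_nonneg ((moll m (W i) z - moll n (W i) z) +
        (pderiv i (moll m f) z - pderiv i (moll n f) z))]
    have h5 := Finset.sum_le_sum fun i (_ : i ∈ Finset.univ) => h4 i
    rw [Finset.sum_neg_distrib, ← h3, Finset.sum_add_distrib, ← Finset.mul_sum,
      ← Finset.mul_sum] at h5
    linarith
  have hWc : Tendsto (fun n => ∑ i, ∫ z, (moll n (W i) z - W i z) ^ 2) atTop (𝓝 0) := by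
    have := tendsto_finsetSum Finset.univ fun i (_ : i ∈ Finset.univ) =>
      tendsto_integral_sq_of_tendsto_eLpNorm (fun n => memLp_of_continuous (hWs n i)) (hW i)
        (tendsto_eLpNorm_moll (hW i))
    simpa using this
  have hcau : ∀ i, ∀ ε > 0, ∃ N, ∀ m ≥ N, ∀ n ≥ N,
      ∫ z, (pderiv i (moll m f) z - pderiv i (moll n f) z) ^ 2 < ε := by
    intro i ε hε
    obtain ⟨N, hN⟩ := eventually_atTop.1 (hWc.eventually_lt_const (show 0 < ε / 4 by positivity))
    refine ⟨N, fun m hm n hn => ?_⟩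
    have h1 : ∫ z, (pderiv i (moll m f) z - pderiv i (moll n f) z) ^ 2 ≤
        ∑ i, ∫ z, (pderiv i (moll m f) z - pderiv i (moll n f) z) ^ 2 :=
      Finset.single_le_sum (f := fun i => ∫ z, (pderiv i (moll m f) z - pderiv i (moll n f) z) ^ 2)
        (fun i _ => integral_nonneg fun z => sq_nonneg _) (Finset.mem_univ i)
    have h2 : ∑ i, ∫ z, (moll m (W i) z - moll n (W i) z) ^ 2 ≤
        2 * (∑ i, ∫ z, (moll m (W i) z - W i z) ^ 2) +
          2 * ∑ i, ∫ z, (moll n (W i) z - W i z) ^ 2 := by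
      rw [Finset.mul_sum, Finset.mul_sum, ← Finset.sum_add_distrib]
      refine Finset.sum_le_sum fun i _ => ?_
      have j : ∀ n, MemLp (fun z => moll n (W i) z - W i z) 2 volume := fun n =>
        (memLp_of_continuous (hWs n i)).sub (hW i)
      rw [← integral_const_mul, ← integral_const_mul, ← integral_add
        ((integrable_sq (j m)).const_mul 2) ((integrable_sq (j n)).const_mul 2)]
      refine integral_mono (integrable_of_continuous (((hWs m i).sub (hWs n i)).pow 2))
        (((integrable_sq (j m)).const_mul 2).add ((integrable_sq (j n)).const_mul 2)) fun z => ?_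
      nlinarith [sq_nonneg ((moll m (W i) z - W i z) + (moll n (W i) z - W i z))]
    linarith [henergy m n, hN m hm, hN n hn]
  choose g hg hgl using fun i => exists_tendsto_eLpNorm_of_cauchy
    (fun n => (hs n).memLp_pderiv i) (hcau i)
  exact ⟨g, hf, hg, fun n => moll n f, hs, tendstoUniformly_moll hf, hgl⟩

end H1C

/-! ### Entropy and logarithmic Sobolev inequalities for continuous densities -/

lemma hasDerivAt_integral_of_continuousOn {X : Type*} [TopologicalSpace X] [CompactSpace X]
    [MeasurableSpace X] [OpensMeasurableSpace X] {μ : Measure X} [IsFiniteMeasure μ]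
    {U : Set ℝ} (hU : IsOpen U) {F F' : ℝ → X → ℝ}
    (hF : ContinuousOn (fun q : ℝ × X => F q.1 q.2) (U ×ˢ univ))
    (hF' : ContinuousOn (fun q : ℝ × X => F' q.1 q.2) (U ×ˢ univ))
    (h : ∀ t ∈ U, ∀ x, HasDerivAt (fun s => F s x) (F' t x) t) {t : ℝ} (ht : t ∈ U) :
    HasDerivAt (fun s => ∫ x, F s x ∂μ) (∫ x, F' t x ∂μ) t := by
  have hsl : ∀ {G : ℝ → X → ℝ}, ContinuousOn (fun q : ℝ × X => G q.1 q.2) (U ×ˢ univ) →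
      ∀ s ∈ U, Continuous (G s) := fun {G} hG s hs =>
    hG.comp_continuous (f := fun x : X => (s, x)) (by fun_prop) fun x => ⟨hs, mem_univ _⟩
  obtain ⟨ε, hε, hεU⟩ := Metric.isOpen_iff.1 hU t ht
  have hsub : Metric.closedBall t (ε / 2) ⊆ U :=
    (Metric.closedBall_subset_ball (by linarith)).trans hεU
  obtain ⟨C, hC⟩ := ((isCompact_closedBall t (ε / 2)).prod
    (isCompact_univ (X := X))).exists_bound_of_continuousOn
    (hF'.mono (prod_mono hsub Subset.rfl))
  refine (hasDerivAt_integral_of_dominated_loc_of_deriv_le (μ := μ) (x₀ := t)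
    (s := Metric.closedBall t (ε / 2)) (F := F) (F' := F') (bound := fun _ => C)
    (Metric.closedBall_mem_nhds t (by positivity)) ?_ (integrable_of_continuous (hsl hF t ht))
    (hsl hF' t ht).aestronglyMeasurable (ae_of_all _ fun x s hs => hC (s, x) ⟨hs, mem_univ _⟩)
    (integrable_const _) (ae_of_all _ fun x s hs => h s (hsub hs) x)).2
  filter_upwards [hU.mem_nhds ht] with s hs
  exact (hsl hF s hs).aestronglyMeasurable

section Entropy

variable {ι : Type} [Fintype ι] [DecidableEq ι]

lemma integral_law {q : UnitAddTorus ι → ℝ} (hq : Continuous q) (hq0 : ∀ z, 0 ≤ q z)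
    (f : UnitAddTorus ι → ℝ) : ∫ z, f z ∂(law q) = ∫ z, f z * q z := by
  rw [law, integral_withDensity_eq_integral_toReal_smul hq.measurable.ennreal_ofReal
    (ae_of_all _ fun _ => ENNReal.ofReal_lt_top)]
  refine integral_congr_ae (ae_of_all _ fun z => ?_)
  simp [ENNReal.toReal_ofReal (hq0 z), mul_comm]

lemma isProbabilityMeasure_law {q : UnitAddTorus ι → ℝ} (hq : Continuous q) (hq0 : ∀ z, 0 ≤ q z)
    (hq1 : ∫ z, q z = 1) : IsProbabilityMeasure (law q) := by
  refine ⟨?_⟩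
  rw [law, withDensity_apply _ MeasurableSet.univ, Measure.restrict_univ,
    ← ofReal_integral_eq_lintegral_ofReal (integrable_of_continuous hq) (ae_of_all _ hq0), hq1,
    ENNReal.ofReal_one]

lemma law_mul {f q : UnitAddTorus ι → ℝ} (hf : Continuous f) (hf0 : ∀ z, 0 ≤ f z)
    (hq : Continuous q) :
    law (fun z => f z * q z) = (law q).withDensity fun z => ENNReal.ofReal (f z) := by
  unfold law
  rw [← withDensity_mul _ hq.measurable.ennreal_ofReal hf.measurable.ennreal_ofReal]
  congr 1
  ext z
  rw [Pi.mul_apply, ENNReal.ofReal_mul (hf0 z), mul_comm]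

lemma volume_absolutelyContinuous_law {q : UnitAddTorus ι → ℝ} (hq : Continuous q)
    (hq0 : ∀ z, 0 < q z) : (volume : Measure (UnitAddTorus ι)) ≪ law q :=
  withDensity_absolutelyContinuous' hq.measurable.ennreal_ofReal.aemeasurable
    (ae_of_all _ fun z => by simpa using hq0 z)

lemma rnDeriv_law_mul {f q : UnitAddTorus ι → ℝ} (hf : Continuous f) (hf0 : ∀ z, 0 ≤ f z)
    (hq : Continuous q) (hq0 : ∀ z, 0 < q z) (hq1 : ∫ z, q z = 1) :
    (fun z => ((law fun z => f z * q z).rnDeriv (law q) z).toReal) =ᵐ[law q] f := by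
  have := isProbabilityMeasure_law hq (fun z => (hq0 z).le) hq1
  rw [law_mul hf hf0 hq]
  filter_upwards [Measure.rnDeriv_withDensity (law q) hf.measurable.ennreal_ofReal] with z hz
  rw [hz, ENNReal.toReal_ofReal (hf0 z)]

lemma klDiv_law_mul {f q : UnitAddTorus ι → ℝ} (hf : Continuous f) (hf0 : ∀ z, 0 ≤ f z)
    (hq : Continuous q) (hq0 : ∀ z, 0 < q z) (hq1 : ∫ z, q z = 1) (hfq : ∫ z, f z * q z = 1) :
    InformationTheory.klDiv (law fun z => f z * q z) (law q) =
      ENNReal.ofReal (∫ z, f z * Real.log (f z) * q z) := by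
  have hq0' : ∀ z, 0 ≤ q z := fun z => (hq0 z).le
  have h1 := isProbabilityMeasure_law hq hq0' hq1
  have h2 := isProbabilityMeasure_law (hf.mul hq) (fun z => mul_nonneg (hf0 z) (hq0' z)) hfq
  have hac : (law fun z => f z * q z) ≪ law q := by
    rw [law_mul hf hf0 hq]
    exact withDensity_absolutelyContinuous _ _
  have hcont : Continuous fun z => InformationTheory.klFun (f z) :=
    InformationTheory.continuous_klFun.comp hf
  have hlog : Continuous fun z => f z * Real.log (f z) := Real.continuous_mul_log.comp hf
  rw [InformationTheory.klDiv_eq_lintegral_klFun_of_ac hac]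
  have h3 : ∫⁻ z, ENNReal.ofReal (InformationTheory.klFun
      ((law fun z => f z * q z).rnDeriv (law q) z).toReal) ∂(law q) =
      ∫⁻ z, ENNReal.ofReal (InformationTheory.klFun (f z)) ∂(law q) := by
    refine lintegral_congr_ae ?_
    filter_upwards [rnDeriv_law_mul hf hf0 hq hq0 hq1] with z hz
    rw [hz]
  rw [h3, ← ofReal_integral_eq_lintegral_ofReal (integrable_of_continuous hcont)
    (ae_of_all _ fun z => InformationTheory.klFun_nonneg (hf0 z)), integral_law hq hq0']
  congr 1
  have e : ∀ z, InformationTheory.klFun (f z) * q z =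
      f z * Real.log (f z) * q z + (q z - f z * q z) := fun z => by
    rw [InformationTheory.klFun]; ring
  simp only [e]
  rw [integral_add (integrable_of_continuous (hlog.fun_mul hq))
    (integrable_of_continuous (hq.fun_sub (hf.fun_mul hq))),
    integral_sub (integrable_of_continuous hq) (integrable_of_continuous (hf.fun_mul hq)), hq1, hfq]
  ring

/-- An upper bound is all that the log-Sobolev inequality requires, so the infimum is evaluated at
one explicit weak gradient. Since `q > 0`, the density equals `f` almost everywhere also for
Lebesgue measure, which is the one in the definition of the weak gradient. -/
lemma fisherInfo_law_mul_le {f q : UnitAddTorus ι → ℝ} {g : ι → UnitAddTorus ι → ℝ}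
    (hf : HasGrad f g) (hf0 : ∀ z, 0 < f z) (hq : Continuous q) (hq0 : ∀ z, 0 < q z)
    (hq1 : ∫ z, q z = 1) :
    fisherInfo (law fun z => f z * q z) (law q) ≤
      ENNReal.ofReal (∫ z, (∑ i, g i z ^ 2) / f z * q z) := by
  have hf0' : ∀ z, 0 ≤ f z := fun z => (hf0 z).le
  have hq0' : ∀ z, 0 ≤ q z := fun z => (hq0 z).le
  have hrn := rnDeriv_law_mul hf.cont hf0' hq hq0 hq1
  have hrnv : (fun z => ((law fun z => f z * q z).rnDeriv (law q) z).toReal) =ᵐ[volume] f :=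
    (volume_absolutelyContinuous_law hq hq0).ae_le hrn
  have hac : (law fun z => f z * q z) ≪ law q := by
    rw [law_mul hf.cont hf0' hq]
    exact withDensity_absolutelyContinuous _ _
  set h : UnitAddTorus ι → EuclideanSpace ℝ ι := fun z => WithLp.toLp 2 (fun i => g i z) with hh
  have hhc : Continuous h :=
    (PiLp.continuous_toLp 2 _).comp (continuous_pi fun i => hf.cont_grad i)
  have hw : IsWeakGradient
      (fun z => ((law fun z => f z * q z).rnDeriv (law q) z).toReal) h := by
    refine ⟨(integrable_of_continuous hf.cont).congr hrnv.symm, integrable_of_continuous hhc,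
      fun φ hφ i => ?_⟩
    rw [← hf.integral_mul_eq (hφ.hasGrad (by simp)) i]
    refine integral_congr_ae ?_
    filter_upwards [hrnv] with z hz
    rw [hz]
  refine (iInf₂_le h hw).trans ?_
  have hgc : Continuous fun z => ∑ i, (g i z / f z) ^ 2 :=
    continuous_finsetSum _ fun i _ => ((hf.cont_grad i).div hf.cont fun z => (hf0 z).ne').pow 2
  have h1 : ∫⁻ z, ENNReal.ofReal (‖(((law fun z => f z * q z).rnDeriv (law q) z).toReal)⁻¹ • h z‖ ^ 2)
      ∂(law fun z => f z * q z) =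
      ∫⁻ z, ENNReal.ofReal (∑ i, (g i z / f z) ^ 2) ∂(law fun z => f z * q z) := by
    refine lintegral_congr_ae ?_
    filter_upwards [hac.ae_le hrn] with z hz
    rw [hz, EuclideanSpace.norm_sq_eq]
    congr 1
    refine Finset.sum_congr rfl fun i _ => ?_
    rw [Real.norm_eq_abs, sq_abs, div_eq_inv_mul]
    rfl
  have hfin : IsFiniteMeasure (law fun z => f z * q z) := by
    unfold law
    exact isFiniteMeasure_withDensity_ofReal (integrable_of_continuous (hf.cont.fun_mul hq)).2
  rw [h1, ← ofReal_integral_eq_lintegral_ofReal (integrable_of_continuous hgc)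
    (ae_of_all _ fun z => Finset.sum_nonneg fun i _ => sq_nonneg _),
    integral_law (hf.cont.fun_mul hq) fun z => mul_nonneg (hf0' z) (hq0' z)]
  refine le_of_eq (congrArg _ (integral_congr_ae (ae_of_all _ fun z => ?_)))
  have := (hf0 z).ne'
  simp only [div_pow, ← Finset.sum_div]
  field_simp

/-- The log-Sobolev inequality, for `C¹` functions. -/
lemma SatisfiesLSI.hasGrad {f q : UnitAddTorus ι → ℝ} {g : ι → UnitAddTorus ι → ℝ} {r : ℝ}
    (hL : SatisfiesLSI q r) (hr : 0 < r)
    (hf : HasGrad f g) (hf0 : ∀ z, 0 < f z) (hq : Continuous q) (hq0 : ∀ z, 0 < q z)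
    (hq1 : ∫ z, q z = 1) :
    (∫ z, f z * Real.log (f z) * q z) -
        (∫ z, f z * q z) * Real.log (∫ z, f z * q z) ≤
      1 / (2 * r) * ∫ z, (∑ i, g i z ^ 2) / f z * q z := by
  have hfq : Continuous fun z => f z * q z := hf.cont.mul hq
  have hlog : Continuous fun z => f z * Real.log (f z) * q z :=
    (Real.continuous_mul_log.comp hf.cont).mul hq
  set N := ∫ z, f z * q z with hN
  have hN0 : 0 < N := by
    refine (integral_pos_iff_support_of_nonneg (fun z => (mul_pos (hf0 z) (hq0 z)).le)
      (integrable_of_continuous hfq)).2 ?_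
    exact hfq.isOpen_support.measure_pos _ ⟨0, (mul_pos (hf0 0) (hq0 0)).ne'⟩
  -- Normalization to a probability density; both sides of the inequality are homogeneous of degree
  -- one in `f`.
  have hf' : HasGrad (fun z => N⁻¹ * f z) (fun i z => N⁻¹ * g i z) := hf.const_mul _
  have hf0' : ∀ z, 0 < N⁻¹ * f z := fun z => mul_pos (inv_pos.2 hN0) (hf0 z)
  have hmass : ∫ z, N⁻¹ * f z * q z = 1 := by
    simp only [mul_assoc]
    rw [integral_const_mul, ← hN, inv_mul_cancel₀ hN0.ne']
  have hP := isProbabilityMeasure_law (hf'.cont.fun_mul hq)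
    (fun z => (mul_pos (hf0' z) (hq0 z)).le) hmass
  have hac : (law fun z => N⁻¹ * f z * q z) ≪ law q := by
    rw [law_mul hf'.cont (fun z => (hf0' z).le) hq]
    exact withDensity_absolutelyContinuous _ _
  have h1 := (hL _ hP hac).trans (mul_le_mul_right (fisherInfo_law_mul_le hf' hf0' hq hq0 hq1) _)
  rw [klDiv_law_mul hf'.cont (fun z => (hf0' z).le) hq hq0 hq1 hmass,
    ← ENNReal.ofReal_mul (by positivity)] at h1
  have hI0 : 0 ≤ ∫ z, (∑ i, (N⁻¹ * g i z) ^ 2) / (N⁻¹ * f z) * q z :=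
    integral_nonneg fun z => mul_nonneg (div_nonneg (Finset.sum_nonneg fun i _ => sq_nonneg _)
      (hf0' z).le) (hq0 z).le
  rw [ENNReal.ofReal_le_ofReal_iff (mul_nonneg (by positivity) hI0)] at h1
  have e1 : ∫ z, N⁻¹ * f z * Real.log (N⁻¹ * f z) * q z =
      N⁻¹ * ((∫ z, f z * Real.log (f z) * q z) - N * Real.log N) := by
    have e : ∀ z, N⁻¹ * f z * Real.log (N⁻¹ * f z) * q z =
        N⁻¹ * (f z * Real.log (f z) * q z - Real.log N * (f z * q z)) := fun z => by
      rw [Real.log_mul (inv_pos.2 hN0).ne' (hf0 z).ne', Real.log_inv]; ring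
    simp only [e]
    rw [integral_const_mul, integral_sub (integrable_of_continuous hlog)
      ((integrable_of_continuous hfq).const_mul _), integral_const_mul, ← hN, mul_comm N]
  have e2 : ∫ z, (∑ i, (N⁻¹ * g i z) ^ 2) / (N⁻¹ * f z) * q z =
      N⁻¹ * ∫ z, (∑ i, g i z ^ 2) / f z * q z := by
    rw [← integral_const_mul]
    refine integral_congr_ae (ae_of_all _ fun z => ?_)
    have := (hf0 z).ne'
    simp only [mul_pow, ← Finset.mul_sum]
    field_simp
  rw [e1, e2, ← mul_assoc, mul_comm (1 / (2 * r)), mul_assoc] at h1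
  exact le_of_mul_le_mul_left h1 (inv_pos.2 hN0)

/-- Each term is the integral of a product of two functions converging in `L²`, namely `φ⁻¹ q ∂_i φ`
and `∂_i φ`. The partial sum over `s` serves to isolate the directions of `y`. -/
lemma H1C.tendsto_fisher {φ : ℕ → UnitAddTorus ι → ℝ} {f q : UnitAddTorus ι → ℝ}
    {g : ι → UnitAddTorus ι → ℝ} (hf : H1C f g) (hf0 : ∀ z, 0 < f z)
    (hφ : ∀ n, TorusContDiff ∞ (φ n)) (hφ0 : ∀ n z, 0 < φ n z)
    (hφg : ∀ i, Tendsto (fun n => eLpNorm (pderiv i (φ n) - g i) 2 volume) atTop (𝓝 0))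
    (hΘ : ∀ {Θ : ℝ → ℝ}, ContinuousOn Θ (Ioi 0) →
        TendstoUniformly (fun n z => Θ (φ n z)) (fun z => Θ (f z)) atTop)
    (hq : Continuous q) (s : Finset ι) :
    Tendsto (fun n => ∫ z, (∑ i ∈ s, pderiv i (φ n) z ^ 2) / φ n z * q z) atTop
      (𝓝 (∫ z, (∑ i ∈ s, g i z ^ 2) / f z * q z)) := by
  have hinv : ContinuousOn (fun x : ℝ => x⁻¹) (Ioi 0) :=
    continuousOn_inv₀.mono fun x hx => (ne_of_gt hx)
  have hc : ∀ n, Continuous fun z => (φ n z)⁻¹ * q z := fun n =>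
    ((hφ n).continuous.inv₀ fun z => (hφ0 n z).ne').mul hq
  have hc' : Continuous fun z => (f z)⁻¹ * q z := (hf.cont.inv₀ fun z => (hf0 z).ne').mul hq
  have hu : TendstoUniformly (fun n z => (φ n z)⁻¹ * q z) (fun z => (f z)⁻¹ * q z) atTop :=
    TendstoUniformly.mul_of_continuous (hf.cont.inv₀ fun z => (hf0 z).ne') hq (hΘ hinv)
      (tendstoUniformly_iff_tendstoUniformlyOnFilter.2 (by
        intro u hu; exact Eventually.of_forall fun _ => refl_mem_uniformity hu))
  have h1 : ∀ i, Tendsto (fun n => ∫ z, ((φ n z)⁻¹ * q z * pderiv i (φ n) z) * pderiv i (φ n) z)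
      atTop (𝓝 (∫ z, ((f z)⁻¹ * q z * g i z) * g i z)) := fun i =>
    tendsto_integral_mul_of_tendsto_eLpNorm
      (fun n => memLp_continuous_mul (hc n) ((hφ n).memLp_pderiv i))
      (memLp_continuous_mul hc' (hf.memLp i))
      (tendsto_eLpNorm_mul_of_tendstoUniformly hc hc' hu (fun n => (hφ n).memLp_pderiv i)
        (hf.memLp i) (hφg i))
      (fun n => (hφ n).memLp_pderiv i) (hf.memLp i) (hφg i)
  have h2 := tendsto_finsetSum s fun i _ => h1 i
  have e : ∀ (u : UnitAddTorus ι → ℝ) (v : ι → UnitAddTorus ι → ℝ)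
      (_ : Continuous fun z => (u z)⁻¹ * q z) (_ : ∀ i, MemLp (v i) 2 volume),
      ∑ i ∈ s, ∫ z, ((u z)⁻¹ * q z * v i z) * v i z = ∫ z, (∑ i ∈ s, v i z ^ 2) / u z * q z := by
    intro u v hu hv
    rw [← integral_finsetSum _ fun i _ =>
      integrable_mul_of_memLp (memLp_continuous_mul hu (hv i)) (hv i)]
    refine integral_congr_ae (ae_of_all _ fun z => ?_)
    simp only [div_eq_mul_inv, Finset.sum_mul]
    exact Finset.sum_congr rfl fun i _ => by ring
  rw [← e f g hc' hf.memLp]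
  refine h2.congr fun n => e _ (fun i => pderiv i (φ n)) (hc n) fun i => (hφ n).memLp_pderiv i

/-- The log-Sobolev inequality, for continuous functions of class `H¹`. -/
lemma SatisfiesLSI.h1C {f q : UnitAddTorus ι → ℝ} {g : ι → UnitAddTorus ι → ℝ} {r : ℝ}
    (hL : SatisfiesLSI q r) (hr : 0 < r)
    (hf : H1C f g) (hf0 : ∀ z, 0 < f z) (hq : Continuous q) (hq0 : ∀ z, 0 < q z)
    (hq1 : ∫ z, q z = 1) :
    (∫ z, f z * Real.log (f z) * q z) -
        (∫ z, f z * q z) * Real.log (∫ z, f z * q z) ≤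
      1 / (2 * r) * ∫ z, (∑ i, g i z ^ 2) / f z * q z := by
  obtain ⟨φ, hφ, hφ0, hφg, hΘ⟩ := hf.exists_approx_gt hf0
  have hqq : TendstoUniformly (fun (_ : ℕ) => q) q atTop := fun u hu =>
    Eventually.of_forall fun _ _ => refl_mem_uniformity hu
  have h1 : Tendsto (fun n => ∫ z, φ n z * q z) atTop (𝓝 (∫ z, f z * q z)) :=
    tendsto_integral_of_tendstoUniformly (fun n => (hφ n).continuous.mul hq) (hf.cont.mul hq)
      (TendstoUniformly.mul_of_continuous hf.cont hq (hΘ (Θ := fun x => x) continuousOn_id) hqq)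
  have hl : Continuous fun z => f z * Real.log (f z) := Real.continuous_mul_log.comp hf.cont
  have h2 : Tendsto (fun n => ∫ z, φ n z * Real.log (φ n z) * q z) atTop
      (𝓝 (∫ z, f z * Real.log (f z) * q z)) :=
    tendsto_integral_of_tendstoUniformly
      (fun n => (Real.continuous_mul_log.comp (hφ n).continuous).mul hq) (hl.mul hq)
      (TendstoUniformly.mul_of_continuous hl hq
        (hΘ (Θ := fun x => x * Real.log x) Real.continuous_mul_log.continuousOn) hqq)
  have h3 := hf.tendsto_fisher hf0 hφ hφ0 hφg hΘ hq Finset.univ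
  have h4 := (Real.continuous_mul_log.tendsto _).comp h1
  exact le_of_tendsto_of_tendsto' (h2.sub h4) (h3.const_mul _) fun n =>
    hL.hasGrad hr ((hφ n).hasGrad (by simp)) (hφ0 n) hq hq0 hq1

end Entropy

/-! ### Herbst's argument and the transport inequality -/

section Herbst

variable {ι : Type} [Fintype ι] [DecidableEq ι]

lemma integral_mul_pos {f q : UnitAddTorus ι → ℝ} (hf : Continuous f) (hf0 : ∀ z, 0 < f z)
    (hq : Continuous q) (hq0 : ∀ z, 0 < q z) : 0 < ∫ z, f z * q z := by
  have hfq : Continuous fun z => f z * q z := hf.mul hq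
  refine (integral_pos_iff_support_of_nonneg (fun z => (mul_pos (hf0 z) (hq0 z)).le)
    (integrable_of_continuous hfq)).2 ?_
  exact hfq.isOpen_support.measure_pos _ ⟨0, (mul_pos (hf0 0) (hq0 0)).ne'⟩

/-- Herbst's argument: the Laplace transform of a Lipschitz function under a log-Sobolev
inequality. -/
lemma SatisfiesLSI.log_integral_exp_le {ψ q : UnitAddTorus ι → ℝ} {dψ : ι → UnitAddTorus ι → ℝ}
    {r M : ℝ} (hL : SatisfiesLSI q r) (hr : 0 < r) (hψ : HasGrad ψ dψ)
    (hM : ∀ z, ∑ i, dψ i z ^ 2 ≤ M ^ 2) (hq : Continuous q) (hq0 : ∀ z, 0 < q z)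
    (hq1 : ∫ z, q z = 1) {l : ℝ} (hl : 0 < l) :
    Real.log (∫ z, Real.exp (l * ψ z) * q z) ≤
      l * (∫ z, ψ z * q z) + M ^ 2 / (2 * r) * l ^ 2 := by
  set Z : ℝ → ℝ := fun l => ∫ z, Real.exp (l * ψ z) * q z with hZ
  set Z' : ℝ → ℝ := fun l => ∫ z, ψ z * Real.exp (l * ψ z) * q z with hZ'
  set c := M ^ 2 / (2 * r) with hc
  have hψc := hψ.cont
  have hZ0 : ∀ l, 0 < Z l := fun l =>
    integral_mul_pos (by fun_prop) (fun z => Real.exp_pos _) hq hq0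
  have hZd : ∀ l, HasDerivAt Z (Z' l) l := fun l => by
    refine hasDerivAt_integral_of_continuousOn (F := fun l z => Real.exp (l * ψ z) * q z)
      (F' := fun l z => ψ z * Real.exp (l * ψ z) * q z) isOpen_univ (Continuous.continuousOn (by fun_prop))
      (Continuous.continuousOn (by fun_prop)) (fun t _ z => ?_) (mem_univ l)
    have h1 : HasDerivAt (fun s : ℝ => s * ψ z) (ψ z) t := by
      simpa using (hasDerivAt_id t).mul_const (ψ z)
    simpa [mul_comm] using (h1.exp).mul_const (q z)
  have hLd : ∀ l, HasDerivAt (fun l => Real.log (Z l)) (Z' l / Z l) l := fun l =>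
    (hZd l).log (hZ0 l).ne'
  -- The log-Sobolev inequality for `exp (l ψ)`, divided by `Z l`.
  have hlsi : ∀ l, l * (Z' l / Z l) - Real.log (Z l) ≤ c * l ^ 2 := by
    intro l
    have hg : HasGrad (fun z => Real.exp (l * ψ z))
        (fun i z => Real.exp (l * ψ z) * (l * dψ i z)) :=
      (hψ.const_mul l).comp (Ψ := Real.exp) (Ψ' := Real.exp) (fun z => Real.hasDerivAt_exp _)
        (by fun_prop)
    have h1 := hL.hasGrad hr hg (fun z => Real.exp_pos _) hq hq0 hq1
    have h2 : ∫ z, Real.exp (l * ψ z) * Real.log (Real.exp (l * ψ z)) * q z = l * Z' l := by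
      rw [hZ', ← integral_const_mul]
      refine integral_congr_ae (ae_of_all _ fun z => ?_)
      simp only [Real.log_exp]; ring
    have h3 : ∫ z, (∑ i, (Real.exp (l * ψ z) * (l * dψ i z)) ^ 2) / Real.exp (l * ψ z) * q z ≤
        l ^ 2 * M ^ 2 * Z l := by
      rw [hZ, ← integral_const_mul]
      have hi := hψ.cont_grad
      refine integral_mono (integrable_of_continuous ?_) (integrable_of_continuous (by fun_prop))
        fun z => ?_
      · exact (Continuous.div (by fun_prop) (by fun_prop) fun z => (Real.exp_pos _).ne').mul hq
      · have e : (∑ i, (Real.exp (l * ψ z) * (l * dψ i z)) ^ 2) / Real.exp (l * ψ z) =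
            Real.exp (l * ψ z) * l ^ 2 * ∑ i, dψ i z ^ 2 := by
          simp only [mul_pow, ← Finset.mul_sum]
          have := (Real.exp_pos (l * ψ z)).ne'
          field_simp
        simp only [e]
        have h4 := mul_le_mul_of_nonneg_left (hM z)
          (show 0 ≤ Real.exp (l * ψ z) * l ^ 2 * q z from
            mul_nonneg (mul_nonneg (Real.exp_pos _).le (sq_nonneg _)) (hq0 z).le)
        nlinarith
    rw [h2] at h1
    have h4 : l * Z' l - Z l * Real.log (Z l) ≤ c * l ^ 2 * Z l := by
      refine h1.trans ((mul_le_mul_of_nonneg_left h3 (by positivity)).trans_eq ?_)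
      rw [hc]; field_simp
    have h5 := (hZ0 l)
    have h6 : l * (Z' l / Z l) - Real.log (Z l) = (l * Z' l - Z l * Real.log (Z l)) / Z l := by
      field_simp
    rw [h6, div_le_iff₀ h5]
    exact h4
  -- The derivative of `log Z / l` is `(l Z' / Z - log Z) / l²`, at most `c` by the previous bound;
  -- so `k` decreases.
  set k : ℝ → ℝ := fun l => Real.log (Z l) / l - c * l with hk
  have hkd : ∀ l, 0 < l → HasDerivAt k ((Z' l / Z l * l - Real.log (Z l) * 1) / l ^ 2 - c * 1) l :=
    fun l hl => ((hLd l).div (hasDerivAt_id l) hl.ne').sub ((hasDerivAt_id l).const_mul c)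
  have hanti : AntitoneOn k (Ioi 0) := by
    refine antitoneOn_of_deriv_nonpos (convex_Ioi 0)
      (fun l hl => (hkd l hl).continuousAt.continuousWithinAt) (fun l hl => ?_) fun l hl => ?_
    · rw [interior_Ioi] at hl
      exact (hkd l hl).differentiableAt.differentiableWithinAt
    · rw [interior_Ioi] at hl
      rw [(hkd l hl).deriv]
      have h1 := hlsi l
      have h2 : (Z' l / Z l * l - Real.log (Z l) * 1) / l ^ 2 ≤ c := by
        rw [div_le_iff₀ (pow_pos hl 2)]
        linarith
      linarith
  -- As `Z 0 = 1`, the quotient `log Z / l` tends to the derivative of `log Z` at `0`, which is the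
  -- mean of `ψ`.
  have hlim : Tendsto k (𝓝[>] 0) (𝓝 (∫ z, ψ z * q z)) := by
    have h1 : HasDerivAt (fun l => Real.log (Z l)) (∫ z, ψ z * q z) 0 := by
      have h2 := hLd 0
      have h3 : Z 0 = 1 := by simp [hZ, hq1]
      have h4 : Z' 0 = ∫ z, ψ z * q z := by simp [hZ']
      rwa [h3, h4, div_one] at h2
    have h2 := h1.tendsto_slope_zero_right
    have h3 : Tendsto (fun l : ℝ => c * l) (𝓝[>] 0) (𝓝 0) := by
      have : Tendsto (fun l : ℝ => c * l) (𝓝 0) (𝓝 (c * 0)) := (continuous_const.mul continuous_id).tendsto 0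
      rw [mul_zero] at this
      exact this.mono_left nhdsWithin_le_nhds
    have h4 := h2.sub h3
    rw [sub_zero] at h4
    refine h4.congr fun l => ?_
    have h3 : Z 0 = 1 := by simp [hZ, hq1]
    simp [hk, h3, div_eq_inv_mul]
  have hfin : k l ≤ ∫ z, ψ z * q z := by
    refine ge_of_tendsto hlim ?_
    filter_upwards [Ioc_mem_nhdsGT hl] with s hs
    exact hanti hs.1 hl hs.2
  have : Real.log (Z l) = l * (k l + c * l) := by
    simp only [hk]; field_simp; ring
  rw [this]
  nlinarith

/-- Gibbs' variational inequality. -/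
lemma gibbs_le {ψ f q : UnitAddTorus ι → ℝ} (hψ : Continuous ψ) (hf : Continuous f)
    (hf0 : ∀ z, 0 < f z) (hq : Continuous q) (hq0 : ∀ z, 0 < q z) :
    ∫ z, ψ z * f z * q z ≤ (∫ z, f z * Real.log (f z) * q z) -
        (∫ z, f z * q z) * Real.log (∫ z, f z * q z) +
      (∫ z, f z * q z) * Real.log (∫ z, Real.exp (ψ z) * q z) := by
  set N := ∫ z, f z * q z with hN
  set Z := ∫ z, Real.exp (ψ z) * q z with hZ
  have hN0 : 0 < N := integral_mul_pos hf hf0 hq hq0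
  have hZ0 : 0 < Z := integral_mul_pos (by fun_prop) (fun z => Real.exp_pos _) hq hq0
  have hlog : Continuous fun z => f z * Real.log (f z) := Real.continuous_mul_log.comp hf
  -- From `s + 1 ≤ e^s` with `s = ψ - log Z + log N - log f`; equality holds where `f / N = e^ψ /
  -- Z`.
  have hpt : ∀ z, ψ z * f z * q z ≤ f z * Real.log (f z) * q z +
      (Real.log Z - Real.log N - 1) * (f z * q z) + N / Z * (Real.exp (ψ z) * q z) := fun z => by
    have h1 := Real.add_one_le_exp (ψ z - Real.log Z + Real.log N - Real.log (f z))
    have h2 : Real.exp (ψ z - Real.log Z + Real.log N - Real.log (f z)) =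
        Real.exp (ψ z) / Z * N / f z := by
      rw [Real.exp_sub, Real.exp_add, Real.exp_sub, Real.exp_log hZ0, Real.exp_log hN0,
        Real.exp_log (hf0 z)]
    rw [h2, le_div_iff₀ (hf0 z)] at h1
    have h3 := mul_le_mul_of_nonneg_right h1 (hq0 z).le
    have h4 : N / Z * (Real.exp (ψ z) * q z) = Real.exp (ψ z) / Z * N * q z := by ring
    rw [h4]
    linarith
  have h1 := integral_mono (μ := volume) (integrable_of_continuous (by fun_prop))
    (integrable_of_continuous (by fun_prop)) hpt
  rw [integral_add (integrable_of_continuous (by fun_prop))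
    (integrable_of_continuous (by fun_prop)), integral_add (integrable_of_continuous (by fun_prop))
    (integrable_of_continuous (by fun_prop)), integral_const_mul, integral_const_mul, ← hN, ← hZ,
    div_mul_cancel₀ _ hZ0.ne'] at h1
  linarith

/-- Under a log-Sobolev inequality, the means of a Lipschitz function under two laws are compared
by the relative Fisher information. -/
lemma SatisfiesLSI.sq_integral_sub_le {ψ f q : UnitAddTorus ι → ℝ}
    {dψ g : ι → UnitAddTorus ι → ℝ} {r M : ℝ} (hL : SatisfiesLSI q r) (hr : 0 < r)
    (hψ : HasGrad ψ dψ) (hM : ∀ z, ∑ i, dψ i z ^ 2 ≤ M ^ 2)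
    (hf : HasGrad f g) (hf0 : ∀ z, 0 < f z)
    (hq : Continuous q) (hq0 : ∀ z, 0 < q z) (hq1 : ∫ z, q z = 1) :
    ((∫ z, ψ z * f z * q z) - (∫ z, f z * q z) * ∫ z, ψ z * q z) ^ 2 ≤
      (∫ z, f z * q z) * (M ^ 2 / r ^ 2) * ∫ z, (∑ i, g i z ^ 2) / f z * q z := by
  set N := ∫ z, f z * q z with hN
  set I := ∫ z, (∑ i, g i z ^ 2) / f z * q z with hI
  have hN0 : 0 < N := integral_mul_pos hf.cont hf0 hq hq0
  have hI0 : 0 ≤ I := integral_nonneg fun z => mul_nonneg (div_nonneg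
    (Finset.sum_nonneg fun i _ => sq_nonneg _) (hf0 z).le) (hq0 z).le
  -- Gibbs for `l ψ`, with Herbst bounding the Laplace transform and the log-Sobolev inequality
  -- bounding the entropy of `f`. It is stated for all `ψ` because it will be used for `-ψ` too.
  have key : ∀ {ψ : UnitAddTorus ι → ℝ} {dψ : ι → UnitAddTorus ι → ℝ}, HasGrad ψ dψ →
      (∀ z, ∑ i, dψ i z ^ 2 ≤ M ^ 2) → ∀ l : ℝ, 0 < l →
      l * ((∫ z, ψ z * f z * q z) - N * ∫ z, ψ z * q z) ≤
        N * (M ^ 2 / (2 * r)) * l ^ 2 + 1 / (2 * r) * I := by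
    intro ψ dψ hψ hM l hl
    have h1 := hL.hasGrad hr hf hf0 hq hq0 hq1
    have h2 := hL.log_integral_exp_le hr hψ hM hq hq0 hq1 hl
    have h3 := gibbs_le (ψ := fun z => l * ψ z) (continuous_const.mul hψ.cont) hf.cont hf0 hq hq0
    have h4 : ∫ z, l * ψ z * f z * q z = l * ∫ z, ψ z * f z * q z := by
      rw [← integral_const_mul]; congr 1; ext z; ring
    have h5 := mul_le_mul_of_nonneg_left h2 hN0.le
    rw [h4] at h3
    linarith
  set Δ := (∫ z, ψ z * f z * q z) - N * ∫ z, ψ z * q z with hΔ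
  -- Negative `l` is handled by `-ψ`. A quadratic polynomial that is nonnegative on the whole line
  -- has nonpositive discriminant, and this is the claim.
  have hall : ∀ l : ℝ, 0 ≤ N * (M ^ 2 / (2 * r)) * (l * l) + (-Δ) * l + 1 / (2 * r) * I := by
    intro l
    rcases lt_trichotomy l 0 with hl | rfl | hl
    · have h1 := key (ψ := fun z => -1 * ψ z) (hψ.const_mul (-1)) (fun z => by simpa using hM z)
        (-l) (by linarith)
      have h2 : (∫ z, -1 * ψ z * f z * q z) = - ∫ z, ψ z * f z * q z := by
        rw [← integral_neg]; congr 1; ext z; ring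
      have h3 : (∫ z, -1 * ψ z * q z) = - ∫ z, ψ z * q z := by
        rw [← integral_neg]; congr 1; ext z; ring
      rw [h2, h3] at h1
      have h4 : -l * (-(∫ z, ψ z * f z * q z) - N * -∫ z, ψ z * q z) = l * Δ := by rw [hΔ]; ring
      rw [h4] at h1
      linarith
    · have : 0 ≤ 1 / (2 * r) * I := mul_nonneg (by positivity) hI0
      simpa using this
    · have h1 := key hψ hM l hl
      linarith
  have hd := discrim_le_zero hall
  rw [discrim] at hd
  have e : 4 * (N * (M ^ 2 / (2 * r))) * (1 / (2 * r) * I) = N * (M ^ 2 / r ^ 2) * I := by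
    field_simp; ring
  nlinarith

end Herbst

/-! ### Poincaré and Nash inequalities -/

section Fourier

open UnitAddTorus

variable {ι : Type} [Fintype ι] [DecidableEq ι]

lemma volume_torus_eq_pi_haar :
    (volume : Measure (UnitAddTorus ι)) = Measure.pi fun _ => AddCircle.haarAddCircle := by
  have h : (volume : Measure UnitAddCircle) = AddCircle.haarAddCircle := by
    rw [AddCircle.volume_eq_smul_haarAddCircle]; simp
  rw [volume_pi, h]

lemma hasSum_sq_integral_mFourier {f : UnitAddTorus ι → ℂ} (hf : Continuous f) :
    HasSum (fun n : ι → ℤ => ‖∫ t, mFourier (-n) t * f t‖ ^ 2) (∫ t, ‖f t‖ ^ 2) := by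
  rw [volume_torus_eq_pi_haar]
  have hm : MemLp f 2 (Measure.pi fun _ : ι => (AddCircle.haarAddCircle : Measure UnitAddCircle)) := by
    obtain ⟨C, hC⟩ := isCompact_univ.exists_bound_of_continuousOn hf.continuousOn
    exact MemLp.of_bound hf.aestronglyMeasurable C (ae_of_all _ fun x => hC x (mem_univ _))
  have h := hasSum_sq_mFourierCoeff (d := ι) (hm.toLp f)
  have e1 : ∀ n, mFourierCoeff (hm.toLp f) n = ∫ t, mFourier (-n) t * f t
      ∂(Measure.pi fun _ : ι => (AddCircle.haarAddCircle : Measure UnitAddCircle)) := fun n => by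
    refine integral_congr_ae ?_
    filter_upwards [hm.coeFn_toLp] with t ht
    rw [ht, smul_eq_mul]
  have e2 := integral_congr_ae (μ := Measure.pi fun _ : ι =>
      (AddCircle.haarAddCircle : Measure UnitAddCircle))
    (f := fun t => ‖hm.toLp f t‖ ^ 2) (g := fun t => ‖f t‖ ^ 2) (by
      filter_upwards [hm.coeFn_toLp] with t ht
      rw [ht])
  simp only [e1] at h
  exact e2 ▸ h

lemma mFourier_apply_add (n : ι → ℤ) (x y : UnitAddTorus ι) :
    mFourier n (x + y) = mFourier n x * mFourier n y := by
  simp only [mFourier, ContinuousMap.coe_mk, Pi.add_apply, fourier_apply, smul_add,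
    AddCircle.toCircle_add, Circle.coe_mul, Finset.prod_mul_distrib]

lemma mFourier_proj_single (n : ι → ℤ) (i : ι) (s : ℝ) :
    mFourier n (proj (Pi.single i s)) = Complex.exp (2 * Real.pi * Complex.I * n i * s) := by
  have h : ∀ j, j ≠ i → fourier (n j) (proj (Pi.single i s) j) = 1 := fun j hj => by
    simp [proj, hj]
  simp only [mFourier, ContinuousMap.coe_mk]
  rw [Finset.prod_eq_single i (fun j _ hj => h j hj) (by simp)]
  simp [proj]

lemma hasDerivAt_mFourier (n : ι → ℤ) (i : ι) (z : UnitAddTorus ι) :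
    HasDerivAt (fun s : ℝ => mFourier n (z + proj (Pi.single i s)))
      (mFourier n z * (2 * Real.pi * Complex.I * n i)) 0 := by
  simp only [mFourier_apply_add, mFourier_proj_single]
  have h1 : HasDerivAt (fun s : ℝ => 2 * Real.pi * Complex.I * n i * (s : ℂ))
      (2 * Real.pi * Complex.I * n i) 0 := by
    simpa using (Complex.ofRealCLM.hasDerivAt (x := (0 : ℝ))).const_mul (2 * Real.pi * Complex.I * n i)
  simpa using (h1.cexp).const_mul (mFourier n z)

lemma hasGrad_mFourier_re (n : ι → ℤ) :
    HasGrad (fun z => (mFourier n z).re) (fun i z => -(2 * Real.pi * n i) * (mFourier n z).im) := by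
  refine ⟨by fun_prop, fun i => by fun_prop, fun i z => ?_⟩
  have h := (hasDerivAt_mFourier n i z)
  have h2 := Complex.reCLM.hasFDerivAt.comp_hasDerivAt (0 : ℝ) h
  refine (h2.congr_deriv ?_)
  simp [Complex.mul_re, Complex.mul_im]
  ring

lemma hasGrad_mFourier_im (n : ι → ℤ) :
    HasGrad (fun z => (mFourier n z).im) (fun i z => (2 * Real.pi * n i) * (mFourier n z).re) := by
  refine ⟨by fun_prop, fun i => by fun_prop, fun i z => ?_⟩
  have h := (hasDerivAt_mFourier n i z)
  have h2 := Complex.imCLM.hasFDerivAt.comp_hasDerivAt (0 : ℝ) h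
  refine (h2.congr_deriv ?_)
  simp [Complex.mul_re, Complex.mul_im]
  ring

/-- The squared modulus of a Fourier coefficient of a real function. -/
def sqCoeff (w : UnitAddTorus ι → ℝ) (n : ι → ℤ) : ℝ :=
  (∫ t, (mFourier (-n) t).re * w t) ^ 2 + (∫ t, (mFourier (-n) t).im * w t) ^ 2

lemma hasSum_sqCoeff {w : UnitAddTorus ι → ℝ} (hw : Continuous w) :
    HasSum (sqCoeff w) (∫ t, w t ^ 2) := by
  have h := hasSum_sq_integral_mFourier (f := fun t => (w t : ℂ)) (by fun_prop)
  have e : ∀ n : ι → ℤ, ‖∫ t, mFourier (-n) t * (w t : ℂ)‖ ^ 2 = sqCoeff w n := fun n => by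
    have hi : Integrable fun t => mFourier (-n) t * (w t : ℂ) :=
      integrable_of_continuous (by fun_prop)
    have hre := integral_re hi
    have him := integral_im hi
    rw [← Complex.normSq_eq_norm_sq, Complex.normSq_apply, sqCoeff, sq, sq]
    simp only [Complex.mul_re, Complex.mul_im, RCLike.re_to_complex, RCLike.im_to_complex,
      Complex.ofReal_re, Complex.ofReal_im, mul_zero, sub_zero, zero_add] at hre him
    rw [← hre, ← him]
  simp only [e] at h
  simpa using h

/-- Integration by parts exchanges the real and imaginary parts of the character, up to a sign that
the squares remove. -/
lemma HasGrad.sqCoeff_grad {w : UnitAddTorus ι → ℝ} {g : ι → UnitAddTorus ι → ℝ}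
    (h : HasGrad w g) (i : ι) (n : ι → ℤ) :
    sqCoeff (g i) n = (2 * Real.pi * n i) ^ 2 * sqCoeff w n := by
  unfold sqCoeff
  rw [(hasGrad_mFourier_re (-n)).integral_mul_eq h i,
    (hasGrad_mFourier_im (-n)).integral_mul_eq h i]
  simp only [mul_assoc, integral_const_mul, Pi.neg_apply, Int.cast_neg]
  ring

lemma sqCoeff_nonneg (w : UnitAddTorus ι → ℝ) (n : ι → ℤ) : 0 ≤ sqCoeff w n := by
  unfold sqCoeff; positivity

/-- Parseval, split by frequency. The box contains `(2N + 1)^d` frequencies, each contributing at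
most `A`; outside it some `|n_i| ≥ N + 1`, so the coefficient is dominated by those of the gradient.
`N = 0` gives Poincaré, and a bound `A` by the `L¹` norm gives Nash. -/
lemma integral_sq_le_of_sqCoeff_le {w : UnitAddTorus ι → ℝ} {g : ι → UnitAddTorus ι → ℝ}
    (h : HasGrad w g) (N : ℕ) {A : ℝ}
    (hA : ∀ n ∈ Fintype.piFinset fun _ : ι => Finset.Icc (-N : ℤ) N, sqCoeff w n ≤ A) :
    ∫ z, w z ^ 2 ≤ (2 * N + 1) ^ Fintype.card ι * A +
      1 / (4 * Real.pi ^ 2 * (N + 1) ^ 2) * ∫ z, ∑ i, g i z ^ 2 := by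
  classical
  set S := Fintype.piFinset fun _ : ι => Finset.Icc (-N : ℤ) N with hS
  set c := 1 / (4 * Real.pi ^ 2 * ((N : ℝ) + 1) ^ 2) with hc
  have hc0 : 0 < c := by rw [hc]; positivity
  have h1 := hasSum_sqCoeff h.cont
  have h2 : HasSum (fun n => ∑ i, sqCoeff (g i) n) (∑ i, ∫ z, g i z ^ 2) :=
    hasSum_sum fun i _ => hasSum_sqCoeff (h.cont_grad i)
  have h3 : HasSum (fun n => if n ∈ S then A else 0) (∑ n ∈ S, A) := by
    have := hasSum_sum_of_ne_finset_zero (L := .unconditional _) (s := S) (f := fun n : ι → ℤ => if n ∈ S then A else 0)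
      (fun n hn => by simp [hn])
    rwa [Finset.sum_congr rfl fun n hn => if_pos hn] at this
  have hcard : ∑ n ∈ S, A = (2 * N + 1) ^ Fintype.card ι * A := by
    rw [Finset.sum_const, hS, Fintype.card_piFinset]
    simp only [Int.card_Icc, Finset.prod_const, Finset.card_univ, nsmul_eq_mul]
    congr 1
    rw [show ((N : ℤ) + 1 - -N).toNat = 2 * N + 1 by omega]
    push_cast
    rfl
  rw [integral_finsetSum _ fun i _ => integrable_of_continuous ((h.cont_grad i).fun_pow 2), ← hcard]
  refine hasSum_le (fun n => ?_) h1 (h3.add (h2.mul_left c))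
  have hg0 : 0 ≤ c * ∑ i, sqCoeff (g i) n :=
    mul_nonneg hc0.le (Finset.sum_nonneg fun i _ => sqCoeff_nonneg _ _)
  by_cases hn : n ∈ S
  · simp only [hn, if_true]
    linarith [hA n hn]
  · simp only [hn, if_false, zero_add]
    obtain ⟨i, hi⟩ : ∃ i, n i ∉ Finset.Icc (-N : ℤ) N := by
      by_contra! hcon
      exact hn (Fintype.mem_piFinset.2 hcon)
    have hni : ((N : ℝ) + 1) ^ 2 ≤ (n i : ℝ) ^ 2 := by
      rw [Finset.mem_Icc, not_and_or, not_le, not_le] at hi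
      have h5 : (N + 1 : ℤ) ^ 2 ≤ n i ^ 2 := by
        rcases hi with hi | hi
        · nlinarith
        · nlinarith
      exact_mod_cast h5
    have h6 : sqCoeff (g i) n ≤ ∑ i, sqCoeff (g i) n :=
      Finset.single_le_sum (f := fun i => sqCoeff (g i) n) (fun i _ => sqCoeff_nonneg _ _)
        (Finset.mem_univ i)
    refine le_trans ?_ (mul_le_mul_of_nonneg_left h6 hc0.le)
    rw [h.sqCoeff_grad, ← mul_assoc]
    refine le_mul_of_one_le_left (sqCoeff_nonneg _ _) ?_
    rw [hc, one_div, ← div_eq_inv_mul, le_div_iff₀ (by positivity)]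
    nlinarith [Real.pi_pos, mul_le_mul_of_nonneg_left hni (sq_nonneg Real.pi)]

/-- Poincaré inequality. -/
lemma HasGrad.poincare {w : UnitAddTorus ι → ℝ} {g : ι → UnitAddTorus ι → ℝ} (h : HasGrad w g) :
    ∫ z, w z ^ 2 ≤ (∫ z, w z) ^ 2 + 1 / (4 * Real.pi ^ 2) * ∫ z, ∑ i, g i z ^ 2 := by
  have := integral_sq_le_of_sqCoeff_le h 0 (A := (∫ z, w z) ^ 2) (fun n hn => by
    have : n = 0 := by
      ext i
      have := Fintype.mem_piFinset.1 hn i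
      simpa using this
    subst this
    simp [sqCoeff, mFourier_zero])
  simpa using this

/-- Nash inequality, with a frequency cut-off. -/
lemma HasGrad.nash_cutoff {w : UnitAddTorus ι → ℝ} {g : ι → UnitAddTorus ι → ℝ}
    (h : HasGrad w g) (N : ℕ) :
    ∫ z, w z ^ 2 ≤ (2 * N + 1) ^ Fintype.card ι * (∫ z, |w z|) ^ 2 +
      1 / (4 * Real.pi ^ 2 * (N + 1) ^ 2) * ∫ z, ∑ i, g i z ^ 2 := by
  refine integral_sq_le_of_sqCoeff_le h N fun n _ => ?_
  have hw := h.cont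
  have hi : Integrable fun t => mFourier (-n) t * (w t : ℂ) :=
    integrable_of_continuous (by fun_prop)
  have hre := integral_re hi
  have him := integral_im hi
  simp only [Complex.mul_re, Complex.mul_im, RCLike.re_to_complex, RCLike.im_to_complex,
    Complex.ofReal_re, Complex.ofReal_im, mul_zero, sub_zero, zero_add] at hre him
  have h1 : sqCoeff w n = ‖∫ t, mFourier (-n) t * (w t : ℂ)‖ ^ 2 := by
    rw [← Complex.normSq_eq_norm_sq, Complex.normSq_apply, sqCoeff, sq, sq, ← hre, ← him]
  rw [h1]
  refine pow_le_pow_left₀ (norm_nonneg _) ?_ 2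
  refine (norm_integral_le_integral_norm _).trans (integral_mono hi.norm
    (integrable_of_continuous hw.abs) fun t => ?_)
  simp only [norm_mul, Complex.norm_real, Real.norm_eq_abs]
  refine mul_le_of_le_one_left (abs_nonneg _) ?_
  exact ((mFourier (-n)).norm_coe_le_norm t).trans_eq mFourier_norm

/-- Nash inequality: `y = ∫ w²` is controlled by `A ≥ ∫ |w|` and the energy. -/
lemma HasGrad.nash [Nonempty ι] {w : UnitAddTorus ι → ℝ} {g : ι → UnitAddTorus ι → ℝ}
    (h : HasGrad w g) {A : ℝ} (hA : 0 < A) (hwA : ∫ z, |w z| ≤ A)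
    (hy : 2 * A ^ 2 ≤ ∫ z, w z ^ 2) :
    (∫ z, w z ^ 2) * ((∫ z, w z ^ 2) / (2 * A ^ 2)) ^ (2 / (Fintype.card ι : ℝ)) ≤
      ∫ z, ∑ i, g i z ^ 2 := by
  set y := ∫ z, w z ^ 2 with hyd
  set d := Fintype.card ι with hd
  have hd0 : (0 : ℝ) < d := by exact_mod_cast Fintype.card_pos
  set θ := (y / (2 * A ^ 2)) ^ (1 / (d : ℝ)) with hθ
  have hY1 : 1 ≤ y / (2 * A ^ 2) := by rwa [one_le_div (by positivity)]
  have hθ1 : 1 ≤ θ := Real.one_le_rpow hY1 (by positivity)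
  have hθd : θ ^ d = y / (2 * A ^ 2) := by
    rw [hθ, ← Real.rpow_natCast, ← Real.rpow_mul (by linarith), one_div,
      inv_mul_cancel₀ hd0.ne', Real.rpow_one]
  have hθ2 : (y / (2 * A ^ 2)) ^ (2 / (d : ℝ)) = θ ^ 2 := by
    rw [hθ, ← Real.rpow_natCast (_ ^ (1 / (d : ℝ))), ← Real.rpow_mul (by linarith)]
    congr 1
    push_cast
    ring
  rw [hθ2]
  -- The largest cut-off with `2N + 1 ≤ θ`: low frequencies then account for at most half of `y`,
  -- while `N + 1 ≥ θ / 4` still makes the high-frequency bound effective.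
  set N := ⌊(θ - 1) / 2⌋₊ with hN
  have hN1 : (N : ℝ) ≤ (θ - 1) / 2 := Nat.floor_le (by linarith)
  have hN2 : (θ - 1) / 2 < N + 1 := Nat.lt_floor_add_one _
  have hN0 : (0 : ℝ) ≤ N := Nat.cast_nonneg _
  have hN4 : θ / 4 ≤ N + 1 := by linarith
  have h1 := h.nash_cutoff N
  set X := ∫ z, ∑ i, g i z ^ 2 with hX
  have h2 : (2 * (N : ℝ) + 1) ^ d * (∫ z, |w z|) ^ 2 ≤ y / 2 := by
    have h3 : (2 * (N : ℝ) + 1) ^ d ≤ y / (2 * A ^ 2) := by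
      rw [← hθd]; exact pow_le_pow_left₀ (by positivity) (by linarith) d
    have h4 : (∫ z, |w z|) ^ 2 ≤ A ^ 2 :=
      pow_le_pow_left₀ (integral_nonneg fun z => abs_nonneg _) hwA 2
    calc _ ≤ y / (2 * A ^ 2) * A ^ 2 := mul_le_mul h3 h4 (sq_nonneg _) (by linarith)
      _ = y / 2 := by field_simp
  have h5 : y / 2 ≤ 1 / (4 * Real.pi ^ 2 * (N + 1) ^ 2) * X := by linarith
  rw [one_div, ← div_eq_inv_mul, le_div_iff₀ (by positivity)] at h5
  have hy0 : 0 < y := lt_of_lt_of_le (by positivity) hy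
  have h6 : (θ / 4) ^ 2 ≤ ((N : ℝ) + 1) ^ 2 := pow_le_pow_left₀ (by positivity) hN4 2
  -- The energy is at least `2 π² y (N + 1)² ≥ 2 · 9 · y θ² / 16`, and `18 / 16 ≥ 1`.
  have h7 : (9 : ℝ) ≤ Real.pi ^ 2 := by nlinarith [Real.pi_gt_three]
  have h8 : 9 * (θ / 4) ^ 2 ≤ Real.pi ^ 2 * ((N : ℝ) + 1) ^ 2 :=
    mul_le_mul h7 h6 (sq_nonneg _) (sq_nonneg _)
  have h9 := mul_le_mul_of_nonneg_left h8 hy0.le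
  have h10 : 0 ≤ y * θ ^ 2 := by positivity
  nlinarith

/-- A continuous function of class `H¹` whose gradient vanishes is constant. -/
lemma H1C.eq_integral_of_integral_sq_eq_zero {f : UnitAddTorus ι → ℝ}
    {g : ι → UnitAddTorus ι → ℝ} (h : H1C f g) (hg : ∀ i, ∫ z, g i z ^ 2 = 0)
    (z : UnitAddTorus ι) : f z = ∫ w, f w := by
  obtain ⟨φ, hφ, hφf, hφg⟩ := h.approx
  have hcont := h.cont
  have h1 : ∀ n, ∫ z, φ n z ^ 2 ≤ (∫ z, φ n z) ^ 2 +
      1 / (4 * Real.pi ^ 2) * ∑ i, ∫ z, pderiv i (φ n) z * pderiv i (φ n) z := fun n => by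
    refine ((hφ n).hasGrad (by simp)).poincare.trans_eq ?_
    rw [integral_finsetSum _ fun i _ => integrable_of_continuous (((hφ n).continuous_pderiv i).fun_pow 2)]
    simp only [sq]
  have h2 : Tendsto (fun n => ∫ z, φ n z) atTop (𝓝 (∫ z, f z)) :=
    tendsto_integral_of_tendstoUniformly (fun n => (hφ n).continuous) h.cont hφf
  have h3 : Tendsto (fun n => ∫ z, φ n z * φ n z) atTop (𝓝 (∫ z, f z * f z)) :=
    tendsto_integral_of_tendstoUniformly (fun n => (hφ n).continuous.mul (hφ n).continuous)
      (h.cont.mul h.cont) (TendstoUniformly.mul_of_continuous h.cont h.cont hφf hφf)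
  have h4 : Tendsto (fun n => ∑ i, ∫ z, pderiv i (φ n) z * pderiv i (φ n) z) atTop
      (𝓝 (∑ i, ∫ z, g i z * g i z)) := tendsto_finsetSum _ fun i _ =>
    tendsto_integral_mul_of_tendsto_eLpNorm (fun n => (hφ n).memLp_pderiv i) (h.memLp i) (hφg i)
      (fun n => (hφ n).memLp_pderiv i) (h.memLp i) (hφg i)
  -- The Poincaré inequality passes to the limit along the approximants; the gradient term
  -- disappears, so `f` has zero variance.
  have h5 : ∫ z, f z * f z ≤ (∫ z, f z) ^ 2 := by
    have h6 := le_of_tendsto_of_tendsto' h3 ((h2.pow 2).add (h4.const_mul (1 / (4 * Real.pi ^ 2))))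
      (fun n => by simpa only [sq] using h1 n)
    have h7 : ∑ i, ∫ z, g i z * g i z = 0 :=
      Finset.sum_eq_zero fun i _ => by simpa only [sq] using hg i
    rw [h7] at h6
    linarith
  set m := ∫ z, f z with hm
  have h8 : ∫ z, (f z - m) ^ 2 = 0 := by
    have e : ∀ z, (f z - m) ^ 2 = f z * f z - 2 * m * f z + m ^ 2 := fun z => by ring
    have h9 : ∫ z, (f z - m) ^ 2 = (∫ z, f z * f z) - 2 * m * m + m ^ 2 := by
      simp only [e]
      rw [integral_add (integrable_of_continuous (by fun_prop)) (integrable_const _),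
        integral_sub (integrable_of_continuous (by fun_prop)) (integrable_of_continuous (by fun_prop)),
        integral_const_mul]
      simp [hm]
    have h10 : 0 ≤ ∫ z, (f z - m) ^ 2 := integral_nonneg fun z => sq_nonneg _
    nlinarith
  have h11 : (fun z => (f z - m) ^ 2) = 0 := by
    refine (Continuous.ae_eq_iff_eq volume ((hcont.fun_sub continuous_const).fun_pow 2) continuous_zero).1 ?_
    exact (integral_eq_zero_iff_of_nonneg (f := fun z => (f z - m) ^ 2) (fun z => sq_nonneg _)
      (integrable_of_continuous (by fun_prop))).1 h8
  have := congrFun h11 z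
  simp only [Pi.zero_apply, sq_eq_zero_iff] at this
  linarith

end Fourier

/-! ### The Helmholtz projection -/

section Helmholtz

variable {ι : Type} [Fintype ι] [DecidableEq ι]

lemma isH1MeanZero_of_torusContDiff {φ : UnitAddTorus ι → ℝ} (hφ : TorusContDiff ∞ φ) :
    IsH1MeanZero (fun z => φ z - ∫ w, φ w) (fun z => WithLp.toLp 2 fun i => pderiv i φ z) := by
  have hg : HasGrad (fun z => φ z - ∫ w, φ w) (fun i z => pderiv i φ z - 0) :=
    (hφ.hasGrad (by simp)).sub (HasGrad.const _)
  simp only [sub_zero] at hg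
  refine ⟨memLp_of_continuous hg.cont, memLp_piLp_iff.2 fun i => hφ.memLp_pderiv i,
    ⟨integrable_of_continuous hg.cont,
      integrable_piLp_iff.2 fun i => integrable_of_continuous (hφ.continuous_pderiv i),
      fun ψ hψ i => ?_⟩, ?_⟩
  · exact hg.integral_mul_eq (hψ.hasGrad (by simp)) i
  · rw [integral_sub (integrable_of_continuous hφ.continuous) (integrable_const _)]
    simp

lemma IsH1MeanZero.add_smul {g₁ g₂ : UnitAddTorus ι → ℝ}
    {h₁ h₂ : UnitAddTorus ι → EuclideanSpace ℝ ι} (H₁ : IsH1MeanZero g₁ h₁)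
    (H₂ : IsH1MeanZero g₂ h₂) (s : ℝ) :
    IsH1MeanZero (fun z => g₁ z + s * g₂ z) (fun z => h₁ z + s • h₂ z) := by
  have i1 := H₁.weakGradient.integrable
  have i2 := H₂.weakGradient.integrable
  have j1 := H₁.weakGradient.integrable_grad
  have j2 := H₂.weakGradient.integrable_grad
  refine ⟨H₁.memLp.add (H₂.memLp.const_mul s), H₁.memLp_grad.add (H₂.memLp_grad.const_smul s),
    ⟨i1.add (i2.const_mul s), j1.add (j2.smul s), fun φ hφ i => ?_⟩, ?_⟩
  · have hb : ∀ {u ψ : UnitAddTorus ι → ℝ}, Integrable u → Continuous ψ →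
        Integrable fun z => u z * ψ z := fun {u ψ} hu hψ => by
      obtain ⟨C, -, hC⟩ := exists_bound hψ
      exact hu.mul_bdd hψ.aestronglyMeasurable (ae_of_all _ hC)
    have k1 := j1.eval_piLp i
    have k2 := j2.eval_piLp i
    have hc := hφ.continuous_pderiv i
    have e1 : ∫ z, (g₁ z + s * g₂ z) * pderiv i φ z =
        (∫ z, g₁ z * pderiv i φ z) + s * ∫ z, g₂ z * pderiv i φ z := by
      rw [← integral_const_mul, ← integral_add (hb i1 hc) ((hb i2 hc).const_mul s)]
      congr 1; ext z; ring
    have e2 : ∫ z, (h₁ z + s • h₂ z) i * φ z =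
        (∫ z, h₁ z i * φ z) + s * ∫ z, h₂ z i * φ z := by
      rw [← integral_const_mul, ← integral_add (hb k1 hφ.continuous)
        ((hb k2 hφ.continuous).const_mul s)]
      congr 1; ext z
      simp only [PiLp.add_apply, PiLp.smul_apply, smul_eq_mul]
      ring
    rw [e1, e2, H₁.weakGradient.integral_eq φ hφ i, H₂.weakGradient.integral_eq φ hφ i]
    ring
  · rw [integral_add i1 (i2.const_mul s), integral_const_mul, H₁.mean_zero, H₂.mean_zero]
    simp

/-- The residual `G - B` of the Helmholtz projection is orthogonal to gradients. -/
lemma IsHelmholtzProjection.orthogonal {G B : UnitAddTorus ι → EuclideanSpace ℝ ι}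
    (hB : IsHelmholtzProjection G B) (hG : ∀ i, MemLp (fun x => G x i) 2 volume)
    {g : UnitAddTorus ι → ℝ} {h : UnitAddTorus ι → EuclideanSpace ℝ ι} (hgh : IsH1MeanZero g h) :
    ∫ x, ∑ i, (G x i - B x i) * h x i = 0 := by
  obtain ⟨H, hH, hmin⟩ := hB
  have hBi : ∀ i, MemLp (fun x => B x i) 2 volume := hH.memLp_grad.eval_piLp
  have hhi : ∀ i, MemLp (fun x => h x i) 2 volume := hgh.memLp_grad.eval_piLp
  have hD : ∀ i, MemLp (fun x => G x i - B x i) 2 volume := fun i => (hG i).sub (hBi i)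
  set b := ∫ x, ∑ i, (G x i - B x i) * h x i with hb
  set c := ∫ x, ∑ i, h x i ^ 2 with hc
  have I1 : Integrable fun x => ∑ i, (G x i - B x i) ^ 2 :=
    integrable_finsetSum _ fun i _ => integrable_sq (hD i)
  have I2 : Integrable fun x => ∑ i, (G x i - B x i) * h x i :=
    integrable_finsetSum _ fun i _ => integrable_mul_of_memLp (hD i) (hhi i)
  have I3 : Integrable fun x => ∑ i, h x i ^ 2 :=
    integrable_finsetSum _ fun i _ => integrable_sq (hhi i)
  -- Minimality along the line `B + s h`. As `c s² - 2 b s` is nonnegative for all `s`, its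
  -- discriminant forces `b = 0`.
  have key : ∀ s : ℝ, 0 ≤ c * (s * s) + (-2 * b) * s + 0 := by
    intro s
    have I12 : Integrable fun x => (∑ i, (G x i - B x i) ^ 2) -
        2 * s * ∑ i, (G x i - B x i) * h x i := I1.sub (I2.const_mul _)
    have h1 := hmin _ _ (hH.add_smul hgh s)
    have e1 : ∫ x, ‖G x - B x‖ ^ 2 = ∫ x, ∑ i, (G x i - B x i) ^ 2 := by
      congr 1; ext x; rw [EuclideanSpace.real_norm_sq_eq]; rfl
    have e2 : ∫ x, ‖G x - (B x + s • h x)‖ ^ 2 =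
        (∫ x, ∑ i, (G x i - B x i) ^ 2) - 2 * s * b + s * s * c := by
      rw [hb, hc, ← integral_const_mul, ← integral_const_mul, ← integral_sub I1 (I2.const_mul _),
        ← integral_add I12 (I3.const_mul _)]
      congr 1; ext x
      simp only [EuclideanSpace.real_norm_sq_eq, PiLp.sub_apply, PiLp.add_apply, PiLp.smul_apply,
        smul_eq_mul, Finset.mul_sum]
      rw [← Finset.sum_sub_distrib, ← Finset.sum_add_distrib]
      exact Finset.sum_congr rfl fun i _ => by ring
    rw [e1, e2] at h1
    linarith
  have hd := discrim_le_zero key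
  rw [discrim] at hd
  nlinarith [sq_nonneg b]

end Helmholtz

/-! ### Product structure of the state space -/

section Product

variable {m k : ℕ}

/-- The component in `𝕋^m` of a state. -/
abbrev xpart (z : State m k) : UnitAddTorus (Fin m) := fun l => z (Sum.inl l)

lemma xpart_elim (x : UnitAddTorus (Fin m)) (y : UnitAddTorus (Fin k)) :
    xpart (Sum.elim x y : State m k) = x := rfl

lemma continuous_elim :
    Continuous fun p : UnitAddTorus (Fin m) × UnitAddTorus (Fin k) =>
      (Sum.elim p.1 p.2 : State m k) := by
  refine continuous_pi fun i => ?_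
  rcases i with i | i
  · exact (continuous_apply i).comp continuous_fst
  · exact (continuous_apply i).comp continuous_snd

lemma continuous_elim_right (x : UnitAddTorus (Fin m)) :
    Continuous fun y : UnitAddTorus (Fin k) => (Sum.elim x y : State m k) :=
  continuous_elim.comp (by fun_prop : Continuous fun y => (x, y))

lemma continuous_xpart : Continuous (xpart : State m k → UnitAddTorus (Fin m)) :=
  continuous_pi fun _ => continuous_apply _

lemma measurePreserving_elim :
    MeasurePreserving (fun p : UnitAddTorus (Fin m) × UnitAddTorus (Fin k) =>
      (Sum.elim p.1 p.2 : State m k)) volume volume := by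
  have h := (volume_measurePreserving_sumPiEquivProdPi
    (fun _ : Fin m ⊕ Fin k => UnitAddCircle)).symm
  convert h using 1
  ext p i
  rcases i with i | i <;> rfl

lemma measurableEmbedding_elim :
    MeasurableEmbedding (fun p : UnitAddTorus (Fin m) × UnitAddTorus (Fin k) =>
      (Sum.elim p.1 p.2 : State m k)) := by
  have h := (MeasurableEquiv.sumPiEquivProdPi
    (fun _ : Fin m ⊕ Fin k => UnitAddCircle)).symm.measurableEmbedding
  convert h using 1
  ext p i
  rcases i with i | i <;> rfl

lemma measurePreserving_xpart :
    MeasurePreserving (xpart : State m k → UnitAddTorus (Fin m)) volume volume := by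
  have h := (volume_measurePreserving_sumPiEquivProdPi
    (fun _ : Fin m ⊕ Fin k => UnitAddCircle))
  exact measurePreserving_fst.comp h

lemma integral_state {f : State m k → ℝ} (hf : Integrable f) :
    ∫ z, f z = ∫ x, ∫ y, f (Sum.elim x y) := by
  rw [← measurePreserving_elim.integral_comp measurableEmbedding_elim]
  exact integral_prod _ (measurePreserving_elim.integrable_comp_of_integrable hf)

/-- Joint continuity is continuity of the curried map for the sup norm over the compact `Y`, and
integration is `1`-Lipschitz for that norm. -/
lemma continuous_integral_right {X Y : Type*} [TopologicalSpace X] [TopologicalSpace Y]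
    [CompactSpace Y] [MeasurableSpace Y] [OpensMeasurableSpace Y] {μ : Measure Y}
    [IsProbabilityMeasure μ] {f : X → Y → ℝ} (hf : Continuous fun p : X × Y => f p.1 p.2) :
    Continuous fun x => ∫ y, f x y ∂μ := by
  let G : C(X, C(Y, ℝ)) := ContinuousMap.curry ⟨fun p : X × Y => f p.1 p.2, hf⟩
  have hL : LipschitzWith 1 fun g : C(Y, ℝ) => ∫ y, g y ∂μ := by
    refine LipschitzWith.of_dist_le_mul fun g h => ?_
    rw [dist_eq_norm, ← integral_sub (integrable_of_continuous g.continuous)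
      (integrable_of_continuous h.continuous)]
    have := norm_integral_le_of_norm_le_const (μ := μ) (f := fun y => g y - h y) (C := dist g h)
      (ae_of_all _ fun y => by rw [← dist_eq_norm]; exact ContinuousMap.dist_apply_le_dist y)
    simpa using this
  exact hL.continuous.comp G.continuous

lemma continuousOn_integral_right {X Y : Type*} [TopologicalSpace X] [TopologicalSpace Y]
    [CompactSpace Y] [MeasurableSpace Y] [OpensMeasurableSpace Y] {μ : Measure Y}
    [IsProbabilityMeasure μ] {f : X → Y → ℝ} {S : Set X}
    (hf : ContinuousOn (fun p : X × Y => f p.1 p.2) (S ×ˢ univ)) :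
    ContinuousOn (fun x => ∫ y, f x y ∂μ) S := by
  rw [continuousOn_iff_continuous_domRestrict]
  refine continuous_integral_right (f := fun (x : S) y => f x y) ?_
  exact hf.comp_continuous (f := fun p : S × Y => ((p.1 : X), p.2)) (by fun_prop)
    fun p => ⟨p.1.2, mem_univ _⟩

lemma continuous_marginal {p : State m k → ℝ} (hp : Continuous p) : Continuous (marginal p) :=
  continuous_integral_right (f := fun x y => p (Sum.elim x y)) (hp.comp continuous_elim)

lemma integral_xpart_mul {p : State m k → ℝ} (hp : Continuous p) {ψ : UnitAddTorus (Fin m) → ℝ}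
    (hψ : Integrable ψ) : ∫ z : State m k, ψ (xpart z) * p z = ∫ x, ψ x * marginal p x := by
  obtain ⟨C, -, hC⟩ := exists_bound hp
  have hi : Integrable fun z : State m k => ψ (xpart z) * p z :=
    (measurePreserving_xpart.integrable_comp_of_integrable hψ).mul_bdd
      hp.aestronglyMeasurable (ae_of_all _ hC)
  rw [integral_state hi]
  refine integral_congr_ae (ae_of_all _ fun x => ?_)
  simp only [marginal, xpart_elim]
  exact integral_const_mul _ _

lemma integral_marginal {p : State m k → ℝ} (hp : Continuous p) :
    ∫ x, marginal p x = ∫ z, p z :=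
  (integral_state (integrable_of_continuous hp)).symm

lemma elim_add_proj_inr (x : UnitAddTorus (Fin m)) (y : UnitAddTorus (Fin k)) (i : Fin k) (s : ℝ) :
    (Sum.elim x y : State m k) + proj (Pi.single (Sum.inr i) s) =
      Sum.elim x (y + proj (Pi.single i s)) := by
  ext j
  rcases j with j | j
  · simp [proj]
  · by_cases h : j = i
    · subst h; simp [proj]
    · simp [proj, h]

lemma elim_add_proj_inl (x : UnitAddTorus (Fin m)) (y : UnitAddTorus (Fin k)) (i : Fin m) (s : ℝ) :
    (Sum.elim x y : State m k) + proj (Pi.single (Sum.inl i) s) =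
      Sum.elim (x + proj (Pi.single i s)) y := by
  ext j
  rcases j with j | j
  · by_cases h : j = i
    · subst h; simp [proj]
    · simp [proj, h]
  · simp [proj]

lemma HasGrad.slice {f : State m k → ℝ} {g : Fin m ⊕ Fin k → State m k → ℝ} (h : HasGrad f g)
    (x : UnitAddTorus (Fin m)) :
    HasGrad (fun y => f (Sum.elim x y)) (fun i y => g (Sum.inr i) (Sum.elim x y)) :=
  ⟨h.cont.comp (continuous_elim_right x), fun i => (h.cont_grad _).comp (continuous_elim_right x),
    fun i y => by simpa only [elim_add_proj_inr] using h.hasDerivAt_zero (Sum.inr i) (Sum.elim x y)⟩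

lemma HasGrad.marginal {f : State m k → ℝ} {g : Fin m ⊕ Fin k → State m k → ℝ}
    (h : HasGrad f g) : HasGrad (marginal f) (fun j => ABF.marginal (g (Sum.inl j))) := by
  refine ⟨continuous_marginal h.cont, fun j => continuous_marginal (h.cont_grad _), fun j x => ?_⟩
  have hshift : Continuous fun q : ℝ × UnitAddTorus (Fin k) =>
      (Sum.elim (x + proj (Pi.single j q.1)) q.2 : State m k) := by
    refine continuous_elim.comp (Continuous.prodMk (continuous_const.add (continuous_proj.comp ?_))
      continuous_snd)
    exact (continuous_single j).comp continuous_fst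
  have h1 := hasDerivAt_integral_of_continuousOn (X := UnitAddTorus (Fin k)) (μ := volume)
    (F := fun s y => f (Sum.elim (x + proj (Pi.single j s)) y))
    (F' := fun s y => g (Sum.inl j) (Sum.elim (x + proj (Pi.single j s)) y)) isOpen_univ
    (h.cont.comp hshift).continuousOn ((h.cont_grad _).comp hshift).continuousOn
    (fun t _ y => by
      simpa only [elim_add_proj_inl] using h.hasDerivAt (Sum.inl j) (Sum.elim x y) t)
    (mem_univ 0)
  simpa [ABF.marginal] using h1

lemma HasGrad.comp_xpart {f : UnitAddTorus (Fin m) → ℝ} {g : Fin m → UnitAddTorus (Fin m) → ℝ}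
    (h : HasGrad f g) :
    HasGrad (fun z : State m k => f (xpart z))
      (fun i z => Sum.elim (fun j => g j (xpart z)) (fun _ => 0) i) := by
  refine ⟨h.cont.comp continuous_xpart, fun i => ?_, fun i z => ?_⟩
  · rcases i with i | i
    · exact (h.cont_grad i).comp continuous_xpart
    · exact continuous_const
  · rcases i with i | i
    · have h1 := h.hasDerivAt_zero i (xpart z)
      have e : ∀ s : ℝ, xpart (z + proj (Pi.single (Sum.inl i) s)) =
          xpart z + proj (Pi.single i s) := fun s => by
        ext j
        by_cases hj : j = i
        · subst hj; simp [proj]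
        · simp [proj, hj]
      simpa only [e, Sum.elim_inl] using h1
    · have e : ∀ s : ℝ, xpart (z + proj (Pi.single (Sum.inr i) s)) = xpart z := fun s => by
        ext j; simp [proj]
      simp only [e, Sum.elim_inr]
      exact hasDerivAt_const _ _

lemma TorusContDiff.comp_xpart {r : WithTop ℕ∞} {φ : UnitAddTorus (Fin m) → ℝ}
    (h : TorusContDiff r φ) :
    TorusContDiff r (fun z : State m k => φ (xpart z)) := by
  have h1 : ContDiff ℝ r (fun u : Fin m ⊕ Fin k → ℝ => fun l : Fin m => u (Sum.inl l)) :=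
    contDiff_pi.2 fun l => contDiff_apply ℝ ℝ _
  exact ContDiff.comp (g := fun u => φ (proj u)) h h1

lemma pderiv_comp_xpart {φ : UnitAddTorus (Fin m) → ℝ} (h : TorusContDiff ∞ φ)
    (i : Fin m ⊕ Fin k) (z : State m k) :
    pderiv i (fun z : State m k => φ (xpart z)) z =
      Sum.elim (fun j => pderiv j φ (xpart z)) (fun _ => 0) i := by
  rw [((h.hasGrad (by simp)).comp_xpart (k := k)).pderiv_eq]

lemma laplacian_comp_xpart {φ : UnitAddTorus (Fin m) → ℝ} (h : TorusContDiff ∞ φ)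
    (z : State m k) :
    laplacian (fun z : State m k => φ (xpart z)) z = laplacian φ (xpart z) := by
  unfold laplacian
  rw [Fintype.sum_sum_type]
  have e1 : ∀ j : Fin m, pderiv (Sum.inl j) (fun z : State m k => φ (xpart z)) =
      fun z => pderiv j φ (xpart z) := fun j => funext fun z => by
    rw [pderiv_comp_xpart h]; rfl
  have e2 : ∀ j : Fin k, pderiv (Sum.inr j) (fun z : State m k => φ (xpart z)) =
      fun z => 0 := fun j => funext fun z => by
    rw [pderiv_comp_xpart h]; rfl
  simp only [e1, e2, pderiv_comp_xpart (h.pderiv _), Sum.elim_inl]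
  simp [pderiv]

end Product

/-! ### Mean force, bias and marginal equation -/

section Bias

variable {m k : ℕ} {alg : Algorithm} {β : ℝ} {F : Force m k}

lemma TorusContDiff.continuous_apply (hF : TorusContDiff 1 F) (i : Fin m ⊕ Fin k) :
    Continuous fun z => F z i :=
  (EuclideanSpace.proj (𝕜 := ℝ) i).continuous.comp hF.continuous

lemma marginal_nonneg {p : State m k → ℝ} (hp0 : ∀ z, 0 ≤ p z) (x : UnitAddTorus (Fin m)) :
    0 ≤ marginal p x := integral_nonneg fun _ => hp0 _

lemma meanForce_apply (hF : TorusContDiff 1 F) {p : State m k → ℝ} (hp : Continuous p)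
    (x : UnitAddTorus (Fin m)) (j : Fin m) :
    meanForce F p x j = - marginal (fun z => F z (Sum.inl j) * p z) x / marginal p x := by
  have hc : ∀ i : Fin m, Continuous fun y : UnitAddTorus (Fin k) =>
      (conditional p x y • (-force₁ F (Sum.elim x y))) i := fun i => by
    have h1 : Continuous fun y => p (Sum.elim x y) / marginal p x :=
      (hp.comp (continuous_elim_right x)).div_const _
    exact h1.mul ((hF.continuous_apply (Sum.inl i)).comp (continuous_elim_right x)).neg
  rw [meanForce, eval_integral_piLp fun i => integrable_of_continuous (hc i)]
  rw [marginal, neg_div, ← integral_div, ← integral_neg]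
  refine integral_congr_ae (ae_of_all _ fun y => ?_)
  simp only [conditional, force₁, PiLp.smul_apply, PiLp.neg_apply, smul_eq_mul]
  ring

lemma abs_marginal_mul_le {f p : State m k → ℝ} (hf : Continuous f) (hp : Continuous p)
    (hp0 : ∀ z, 0 ≤ p z) {C : ℝ} (hC : ∀ z, |f z| ≤ C) (x : UnitAddTorus (Fin m)) :
    |marginal (fun z => f z * p z) x| ≤ C * marginal p x := by
  rw [marginal, marginal, ← integral_const_mul]
  have hpx := hp.comp (continuous_elim_right x)
  have hfx := hf.comp (continuous_elim_right x)
  refine (abs_integral_le_integral_abs).trans (integral_mono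
    (integrable_of_continuous (hfx.mul hpx).abs)
    (integrable_of_continuous (continuous_const.mul hpx)) fun y => ?_)
  simp only [abs_mul, abs_of_nonneg (hp0 _)]
  exact mul_le_mul_of_nonneg_right (hC _) (hp0 _)

/-- The identity persists where the marginal vanishes: `F` is bounded, so the numerator is at most a
multiple of the marginal and vanishes as well. -/
lemma marginal_mul_meanForce (hF : TorusContDiff 1 F) {p : State m k → ℝ} (hp : Continuous p)
    (hp0 : ∀ z, 0 ≤ p z) (x : UnitAddTorus (Fin m)) (j : Fin m) :
    marginal p x * meanForce F p x j = - marginal (fun z => F z (Sum.inl j) * p z) x := by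
  rw [meanForce_apply hF hp]
  by_cases h : marginal p x = 0
  · obtain ⟨C, -, hC⟩ := exists_bound (hF.continuous_apply (Sum.inl j))
    have h1 := abs_marginal_mul_le (hF.continuous_apply (Sum.inl j)) hp hp0 hC x
    rw [h, mul_zero] at h1
    rw [h, zero_mul, abs_nonpos_iff.1 h1, neg_zero]
  · field_simp

lemma memLp_meanForce (hF : TorusContDiff 1 F) {p : State m k → ℝ} (hp : Continuous p)
    (hp0 : ∀ z, 0 ≤ p z) (j : Fin m) : MemLp (fun x => meanForce F p x j) 2 volume := by
  obtain ⟨C, hC0, hC⟩ := exists_bound (hF.continuous_apply (Sum.inl j))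
  simp only [meanForce_apply hF hp]
  have h1 := continuous_marginal ((hF.continuous_apply (Sum.inl j)).fun_mul hp)
  refine MemLp.of_bound (h1.measurable.neg.div
    (continuous_marginal hp).measurable).aestronglyMeasurable C (ae_of_all _ fun x => ?_)
  rw [Real.norm_eq_abs, abs_div, abs_neg, abs_of_nonneg (marginal_nonneg hp0 x)]
  exact div_le_of_le_mul₀ (marginal_nonneg hp0 x) hC0
    (abs_marginal_mul_le (hF.continuous_apply (Sum.inl j)) hp hp0 hC x)

lemma IsBias.memLp (hF : TorusContDiff 1 F) {p : State m k → ℝ} (hp : Continuous p)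
    (hp0 : ∀ z, 0 ≤ p z) {B : Bias m} (hB : IsBias alg F p B) (j : Fin m) :
    MemLp (fun x => B x j) 2 volume := by
  cases alg with
  | abf =>
    obtain rfl : B = meanForce F p := hB
    exact memLp_meanForce hF hp hp0 j
  | pabf =>
    obtain ⟨H, hH, -⟩ : IsHelmholtzProjection (meanForce F p) B := hB
    exact hH.memLp_grad.eval_piLp j

/-- The residual `G - B` is weakly divergence free. Together with square integrability and
nonexpansiveness this is all that is used about the bias, which is why both algorithms are treated
at once. -/
lemma IsBias.orthogonal (hF : TorusContDiff 1 F) {p : State m k → ℝ} (hp : Continuous p)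
    (hp0 : ∀ z, 0 ≤ p z) {B : Bias m} (hB : IsBias alg F p B) {φ : UnitAddTorus (Fin m) → ℝ}
    (hφ : TorusContDiff ∞ φ) :
    ∫ x, ∑ j, (meanForce F p x j - B x j) * pderiv j φ x = 0 := by
  cases alg with
  | abf =>
    obtain rfl : B = meanForce F p := hB
    simp
  | pabf =>
    exact IsHelmholtzProjection.orthogonal hB (memLp_meanForce hF hp hp0)
      (isH1MeanZero_of_torusContDiff hφ)

/-- The bias depends on the mean force in a nonexpansive way. -/
lemma IsBias.integral_sq_sub_le (hF : TorusContDiff 1 F) {p q : State m k → ℝ} (hp : Continuous p)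
    (hp0 : ∀ z, 0 ≤ p z) (hq : Continuous q) (hq0 : ∀ z, 0 ≤ q z) {B B' : Bias m}
    (hB : IsBias alg F p B) (hB' : IsBias alg F q B') :
    ∫ x, ∑ j, (B x j - B' x j) ^ 2 ≤ ∫ x, ∑ j, (meanForce F p x j - meanForce F q x j) ^ 2 := by
  cases alg with
  | abf =>
    obtain rfl : B = meanForce F p := hB
    obtain rfl : B' = meanForce F q := hB'
    exact le_rfl
  | pabf =>
    have hG := memLp_meanForce hF hp hp0
    have hG' := memLp_meanForce hF hq hq0
    have hBm := fun j => IsBias.memLp hF hp hp0 hB j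
    have hBm' := fun j => IsBias.memLp hF hq hq0 hB' j
    replace hB : IsHelmholtzProjection (meanForce F p) B := hB
    replace hB' : IsHelmholtzProjection (meanForce F q) B' := hB'
    obtain ⟨H, hH, -⟩ := id hB
    obtain ⟨H', hH', -⟩ := id hB'
    -- `B - B'` is itself a gradient, hence orthogonal to both residuals. Subtracting the two
    -- relations gives `∫ |B - B'|² = ∫ (G - G') · (B - B')`, and Young's inequality concludes.
    have hsub := hH.add_smul hH' (-1)
    have o1 := hB.orthogonal hG hsub
    have o2 := hB'.orthogonal hG' hsub
    simp only [PiLp.add_apply, PiLp.smul_apply, smul_eq_mul, neg_one_mul, ← sub_eq_add_neg] at o1 o2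
    have hD : ∀ j, MemLp (fun x => meanForce F p x j - meanForce F q x j) 2 volume :=
      fun j => (hG j).sub (hG' j)
    have hE : ∀ j, MemLp (fun x => B x j - B' x j) 2 volume := fun j => (hBm j).sub (hBm' j)
    have I1 : Integrable fun x => ∑ j, (meanForce F p x j - B x j) * (B x j - B' x j) :=
      integrable_finsetSum _ fun j _ => integrable_mul_of_memLp ((hG j).sub (hBm j)) (hE j)
    have I2 : Integrable fun x => ∑ j, (meanForce F q x j - B' x j) * (B x j - B' x j) :=
      integrable_finsetSum _ fun j _ => integrable_mul_of_memLp ((hG' j).sub (hBm' j)) (hE j)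
    have I3 : Integrable fun x => ∑ j, (meanForce F p x j - meanForce F q x j) ^ 2 :=
      integrable_finsetSum _ fun j _ => integrable_sq (hD j)
    have I4 : Integrable fun x => ∑ j, (B x j - B' x j) ^ 2 :=
      integrable_finsetSum _ fun j _ => integrable_sq (hE j)
    have hmono : ∫ x, ((∑ j, (meanForce F p x j - B x j) * (B x j - B' x j)) -
        ∑ j, (meanForce F q x j - B' x j) * (B x j - B' x j)) ≤
        ∫ x, ((1 / 2) * (∑ j, (meanForce F p x j - meanForce F q x j) ^ 2) -
          (1 / 2) * ∑ j, (B x j - B' x j) ^ 2) := by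
      refine integral_mono (I1.sub I2) ((I3.const_mul _).sub (I4.const_mul _)) fun x => ?_
      simp only [Finset.mul_sum, ← Finset.sum_sub_distrib]
      refine Finset.sum_le_sum fun j _ => ?_
      nlinarith [sq_nonneg ((meanForce F p x j - meanForce F q x j) - (B x j - B' x j))]
    rw [integral_sub I1 I2, integral_sub (I3.const_mul _) (I4.const_mul _), integral_const_mul,
      integral_const_mul, o1, o2] at hmono
    linarith

/-- The drift `𝓕 + (B, 0)`. -/
def drift (F : Force m k) (B : Bias m) (i : Fin m ⊕ Fin k) (z : State m k) : ℝ :=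
  F z i + Sum.elim (fun j => B (xpart z) j) (fun _ => 0) i

lemma generator_eq (B : Bias m) (φ : State m k → ℝ) (z : State m k) :
    generator β F B φ z = β⁻¹ * laplacian φ z + ∑ i, drift F B i z * pderiv i φ z := by
  simp only [generator, drift, add_mul, Finset.sum_add_distrib, Fintype.sum_sum_type,
    Sum.elim_inl, Sum.elim_inr, zero_mul, Finset.sum_const_zero, add_zero]
  ring

lemma memLp_drift (hF : TorusContDiff 1 F) {B : Bias m}
    (hB : ∀ j, MemLp (fun x => B x j) 2 volume) (i : Fin m ⊕ Fin k) :
    MemLp (drift F B i) 2 volume := by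
  refine (memLp_of_continuous (hF.continuous_apply i)).add ?_
  rcases i with j | j
  · exact (hB j).comp_measurePreserving measurePreserving_xpart
  · exact memLp_const 0

/-- The weak form of the equation, in terms of the drift. -/
lemma integral_generator (hF : TorusContDiff 1 F) {a φ : State m k → ℝ} {B : Bias m}
    (ha : Continuous a) (hB : ∀ j, MemLp (fun x => B x j) 2 volume) (hφ : TorusContDiff ∞ φ) :
    ∫ z, generator β F B φ z * a z =
      β⁻¹ * (∫ z, a z * laplacian φ z) + ∫ z, ∑ i, a z * drift F B i z * pderiv i φ z := by
  have hl : Continuous (laplacian φ) :=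
    continuous_finsetSum _ fun i _ => (hφ.pderiv i).continuous_pderiv i
  have hd := memLp_drift hF hB
  rw [← integral_const_mul, ← integral_add ((integrable_of_continuous (ha.fun_mul hl)).const_mul _)
    (integrable_finsetSum _ fun i _ => integrable_mul_of_memLp
      (memLp_continuous_mul ha (hd i)) (hφ.memLp_pderiv i))]
  refine integral_congr_ae (ae_of_all _ fun z => ?_)
  simp only [generator_eq, add_mul, Finset.sum_mul]
  congr 1
  · ring
  · exact Finset.sum_congr rfl fun i _ => by ring

/-- The flux form: once `a` is of class `H¹`, the flux is in `L²` and `H1C.integral_test` allows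
test functions that are only of class `H1C`. -/
lemma H1C.integral_generator (hF : TorusContDiff 1 F) {a φ : State m k → ℝ} {B : Bias m}
    {g : Fin m ⊕ Fin k → State m k → ℝ}
    (ha : H1C a g) (hB : ∀ j, MemLp (fun x => B x j) 2 volume) (hφ : TorusContDiff ∞ φ) :
    ∫ z, generator β F B φ z * a z =
      ∫ z, ∑ i, (a z * drift F B i z - β⁻¹ * g i z) * pderiv i φ z := by
  have hd := memLp_drift hF hB
  rw [ABF.integral_generator hF ha.cont hB hφ, ha.integral_laplacian hφ, mul_neg,
    ← integral_const_mul, ← integral_neg, ← integral_add]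
  · refine integral_congr_ae (ae_of_all _ fun z => ?_)
    simp only [Finset.mul_sum, ← Finset.sum_neg_distrib, ← Finset.sum_add_distrib]
    exact Finset.sum_congr rfl fun i _ => by ring
  · exact ((integrable_finsetSum _ fun i _ => integrable_mul_of_memLp (ha.memLp i)
      (hφ.memLp_pderiv i)).const_mul _).neg
  · exact integrable_finsetSum _ fun i _ => integrable_mul_of_memLp
      (memLp_continuous_mul ha.cont (hd i)) (hφ.memLp_pderiv i)

/-- The equation satisfied by the marginal density. -/
lemma marginal_equation (hF : TorusContDiff 1 F) {a r : State m k → ℝ} {B : Bias m}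
    (ha : Continuous a) (ha0 : ∀ z, 0 ≤ a z) (hB : ∀ j, MemLp (fun x => B x j) 2 volume)
    (hr : Continuous r)
    (hw : ∀ φ : State m k → ℝ, TorusContDiff ∞ φ →
      ∫ z, generator β F B φ z * a z = ∫ z, r z * φ z)
    {φ : UnitAddTorus (Fin m) → ℝ} (hφ : TorusContDiff ∞ φ) :
    β⁻¹ * (∫ x, marginal a x * laplacian φ x) +
      ∫ x, ∑ j, marginal a x * (B x j - meanForce F a x j) * pderiv j φ x =
      ∫ x, marginal r x * φ x := by
  have hl : Continuous (laplacian φ) :=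
    continuous_finsetSum _ fun i _ => (hφ.pderiv i).continuous_pderiv i
  have hu := continuous_marginal ha
  have h1 := hw _ (hφ.comp_xpart (k := k))
  rw [ABF.integral_generator hF ha hB hφ.comp_xpart] at h1
  have e0 : ∫ z, r z * φ (xpart z) = ∫ x, marginal r x * φ x := by
    simp only [mul_comm _ (φ _)]
    exact integral_xpart_mul hr (integrable_of_continuous hφ.continuous)
  have e1 : ∫ z, a z * laplacian (fun z : State m k => φ (xpart z)) z =
      ∫ x, marginal a x * laplacian φ x := by
    simp only [laplacian_comp_xpart hφ, mul_comm _ (laplacian φ _)]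
    exact integral_xpart_mul ha (integrable_of_continuous hl)
  have hG := memLp_meanForce hF ha ha0
  have hFa : ∀ j : Fin m, Continuous fun z => F z (Sum.inl j) * a z :=
    fun j => (hF.continuous_apply _).mul ha
  have i1 : ∀ j, Integrable fun z => pderiv j φ (xpart z) * (F z (Sum.inl j) * a z) := fun j =>
    integrable_of_continuous (((hφ.continuous_pderiv j).comp continuous_xpart).mul (hFa j))
  have i2 : ∀ j, Integrable fun x => B x j * pderiv j φ x := fun j =>
    integrable_mul_of_memLp (hB j) (hφ.memLp_pderiv j)
  have i3 : ∀ j, Integrable fun z : State m k => (B (xpart z) j * pderiv j φ (xpart z)) * a z :=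
    fun j => by
      obtain ⟨C, -, hC⟩ := exists_bound ha
      exact (measurePreserving_xpart.integrable_comp_of_integrable (i2 j)).mul_bdd
        ha.aestronglyMeasurable (ae_of_all _ hC)
  have i4 : ∀ j, Integrable fun x => marginal a x * meanForce F a x j * pderiv j φ x := fun j =>
    integrable_mul_of_memLp (memLp_continuous_mul hu (hG j)) (hφ.memLp_pderiv j)
  have i5 : ∀ j, Integrable fun x => marginal a x * B x j * pderiv j φ x := fun j =>
    integrable_mul_of_memLp (memLp_continuous_mul hu (hB j)) (hφ.memLp_pderiv j)
  -- For a test function of `x` alone, integration in `y` turns `F₁ a` into `-marginal a *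
  -- meanForce` and `B a` into `marginal a * B`, because `B` depends only on `x`.
  have e2 : ∫ z, ∑ i, a z * drift F B i z * pderiv i (fun z : State m k => φ (xpart z)) z =
      ∫ x, ∑ j, marginal a x * (B x j - meanForce F a x j) * pderiv j φ x := by
    have e3 : ∀ z : State m k, ∑ i, a z * drift F B i z *
        pderiv i (fun z : State m k => φ (xpart z)) z =
        ∑ j, (pderiv j φ (xpart z) * (F z (Sum.inl j) * a z) +
          (B (xpart z) j * pderiv j φ (xpart z)) * a z) := fun z => by
      rw [Fintype.sum_sum_type]
      simp only [pderiv_comp_xpart hφ, Sum.elim_inl, Sum.elim_inr, mul_zero, Finset.sum_const_zero,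
        add_zero, drift]
      exact Finset.sum_congr rfl fun j _ => by ring
    simp only [e3]
    rw [integral_finsetSum _ fun j _ => by exact (i1 j).add (i3 j)]
    have e4 : ∀ x, ∑ j, marginal a x * (B x j - meanForce F a x j) * pderiv j φ x =
        ∑ j, (marginal a x * B x j * pderiv j φ x -
          marginal a x * meanForce F a x j * pderiv j φ x) := fun x =>
      Finset.sum_congr rfl fun j _ => by ring
    simp only [e4]
    rw [integral_finsetSum _ fun j _ => by exact (i5 j).sub (i4 j)]
    refine Finset.sum_congr rfl fun j _ => ?_
    rw [integral_add (i1 j) (i3 j), integral_sub (i5 j) (i4 j),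
      integral_xpart_mul (hFa j) (integrable_of_continuous (hφ.continuous_pderiv j)),
      integral_xpart_mul (ψ := fun x => B x j * pderiv j φ x) ha (i2 j), add_comm]
    rw [sub_eq_add_neg, ← integral_neg]
    congr 1
    · congr 1; ext x; ring
    · congr 1; ext x
      rw [marginal_mul_meanForce hF ha ha0]; ring
  rw [e0, e1, e2] at h1
  exact h1

end Bias

/-! ### Regularity of stationary states -/

section Stationary

variable {m k : ℕ} {alg : Algorithm} {β : ℝ} {F : Force m k} {p : State m k → ℝ} {B : Bias m}

/-- A continuous `p` times an `L²` drift is in `L²`, so the equation reads `Δ p = ∇ · W` with `W` in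
`L²`, and elliptic regularity applies. -/
lemma IsStationaryState.exists_h1C (hβ : 0 < β) (hF : TorusContDiff 1 F)
    (hp : IsStationaryState alg β F p B) : ∃ g, H1C p g := by
  have hB := hp.bias.memLp hF hp.continuous hp.nonneg
  have hd := memLp_drift hF hB
  refine exists_h1C_of_laplacian hp.continuous
    (W := fun i z => -β * (p z * drift F B i z))
    (fun i => (memLp_continuous_mul hp.continuous (hd i)).const_mul _) fun φ hφ => ?_
  have h1 := hp.equation φ hφ
  rw [integral_generator hF hp.continuous hB hφ] at h1
  have e : ∫ z, ∑ i, -β * (p z * drift F B i z) * pderiv i φ z =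
      -β * ∫ z, ∑ i, p z * drift F B i z * pderiv i φ z := by
    rw [← integral_const_mul]
    congr 1; ext z
    rw [Finset.mul_sum]
    exact Finset.sum_congr rfl fun i _ => by ring
  rw [e]
  have : β * (β⁻¹ * ∫ z, p z * laplacian φ z) = ∫ z, p z * laplacian φ z := by
    rw [← mul_assoc, mul_inv_cancel₀ hβ.ne', one_mul]
  nlinarith

/-- The marginal `u` satisfies `Δ u = β ∇ · (u (B - G))`. Tested with `u`, the right-hand side
involves `u ∇u = ∇(u²) / 2`, to which `B - G` is orthogonal. So `∇u = 0`, and the total mass fixes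
the constant. -/
lemma IsStationaryState.marginal_eq_one (hβ : 0 < β) (hF : TorusContDiff 1 F)
    (hp : IsStationaryState alg β F p B) (x : UnitAddTorus (Fin m)) : marginal p x = 1 := by
  have hB := hp.bias.memLp hF hp.continuous hp.nonneg
  have hG := memLp_meanForce hF hp.continuous hp.nonneg
  have hu := continuous_marginal hp.continuous
  have hBG : ∀ j, MemLp (fun x => B x j - meanForce F p x j) 2 volume :=
    fun j => (hB j).sub (hG j)
  have heq : ∀ φ : UnitAddTorus (Fin m) → ℝ, TorusContDiff ∞ φ →
      ∫ x, marginal p x * laplacian φ x =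
        -β * ∫ x, ∑ j, marginal p x * (B x j - meanForce F p x j) * pderiv j φ x := by
    intro φ hφ
    have h1 := marginal_equation hF hp.continuous hp.nonneg hB (r := fun _ => 0) continuous_const
      (fun φ hφ => by simpa using hp.equation φ hφ) hφ
    have h2 : ∫ x, marginal (fun _ : State m k => (0 : ℝ)) x * φ x = 0 := by simp [marginal]
    rw [h2] at h1
    have : β * (β⁻¹ * ∫ x, marginal p x * laplacian φ x) = ∫ x, marginal p x * laplacian φ x := by
      rw [← mul_assoc, mul_inv_cancel₀ hβ.ne', one_mul]
    nlinarith
  have e : ∀ φ : UnitAddTorus (Fin m) → ℝ,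
      ∫ x, ∑ j, -β * (marginal p x * (B x j - meanForce F p x j)) * pderiv j φ x =
      -β * ∫ x, ∑ j, marginal p x * (B x j - meanForce F p x j) * pderiv j φ x := fun φ => by
    rw [← integral_const_mul]
    congr 1; ext z
    rw [Finset.mul_sum]
    exact Finset.sum_congr rfl fun i _ => by ring
  have hW : ∀ j, MemLp (fun x => -β * (marginal p x * (B x j - meanForce F p x j))) 2 volume :=
    fun j => (memLp_continuous_mul hu (hBG j)).const_mul _
  obtain ⟨g, hg⟩ := exists_h1C_of_laplacian hu
    (W := fun j x => -β * (marginal p x * (B x j - meanForce F p x j))) hW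
    fun φ hφ => by rw [heq φ hφ, e]
  have h1 := hg.integral_test
    (W := fun j x => g j x + -β * (marginal p x * (B x j - meanForce F p x j)))
    (r := fun _ => 0) (fun j => (hg.memLp j).add (hW j)) (memLp_const 0) (fun φ hφ => by
      have h2 := hg.integral_laplacian hφ
      rw [heq φ hφ, ← e] at h2
      simp only [add_mul, Finset.sum_add_distrib, zero_mul, integral_zero]
      rw [integral_add (integrable_finsetSum _ fun j _ =>
          integrable_mul_of_memLp (hg.memLp j) (hφ.memLp_pderiv j))
        (integrable_finsetSum _ fun j _ =>
          integrable_mul_of_memLp (hW j) (hφ.memLp_pderiv j)), h2]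
      ring)
  -- Orthogonality extends from smooth test functions to `u²`, which is only of class `H1C`.
  have h2 := (hg.mul hg).integral_test (W := fun j x => meanForce F p x j - B x j)
    (r := fun _ => 0) (fun j => (hG j).sub (hB j)) (memLp_const 0)
    (fun φ hφ => by simpa using hp.bias.orthogonal hF hp.continuous hp.nonneg hφ)
  simp only [zero_mul, integral_zero] at h1 h2
  have h3 : ∫ x, ∑ j, g j x ^ 2 = 0 := by
    have e3 : ∀ x, ∑ j, g j x ^ 2 =
        (∑ j, (g j x + -β * (marginal p x * (B x j - meanForce F p x j))) * g j x) -
        β / 2 * ∑ j, (meanForce F p x j - B x j) * (g j x * marginal p x + marginal p x * g j x) :=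
      fun x => by
        rw [Finset.mul_sum, ← Finset.sum_sub_distrib]
        exact Finset.sum_congr rfl fun j _ => by ring
    simp only [e3]
    rw [integral_sub (by exact integrable_finsetSum _ fun j _ =>
          integrable_mul_of_memLp ((hg.memLp j).add (hW j)) (hg.memLp j))
        (by exact (integrable_finsetSum _ fun j _ => integrable_mul_of_memLp ((hG j).sub (hB j))
          ((hg.mul hg).memLp j)).const_mul _), integral_const_mul, h1, h2]
    simp
  rw [integral_finsetSum _ fun j _ => integrable_sq (hg.memLp j)] at h3
  have h4 := (Finset.sum_eq_zero_iff_of_nonneg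
    (fun j _ => integral_nonneg fun x => sq_nonneg (g j x))).1 h3
  rw [hg.eq_integral_of_integral_sq_eq_zero (fun j => h4 j (Finset.mem_univ j)) x,
    integral_marginal hp.continuous, hp.mass]

end Stationary

/-! ### Mean forces and Fisher information -/

section MeanForce

variable {m k : ℕ} {F : Force m k} {M : ℝ≥0}

/-- A linear combination of the components of `𝓕₁(x, ·)`. -/
def forceSlice (F : Force m k) (e : Fin m → ℝ) (x : UnitAddTorus (Fin m))
    (y : UnitAddTorus (Fin k)) : ℝ := ∑ j, e j * F (Sum.elim x y) (Sum.inl j)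

lemma elim_proj (u : Fin m → ℝ) (v : Fin k → ℝ) :
    (Sum.elim (proj u) (proj v) : State m k) = proj (Sum.elim u v) := by
  ext i; rcases i with i | i <;> rfl

lemma torusContDiff_forceSlice (hF : TorusContDiff 1 F) (e : Fin m → ℝ)
    (x : UnitAddTorus (Fin m)) : TorusContDiff 1 (forceSlice F e x) := by
  obtain ⟨u, rfl⟩ := isOpenQuotientMap_proj.surjective x
  have h1 : ContDiff ℝ 1 fun v : Fin k → ℝ => (Sum.elim u v : Fin m ⊕ Fin k → ℝ) := by
    refine contDiff_pi.2 fun i => ?_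
    rcases i with i | i
    · exact contDiff_const
    · exact contDiff_apply ℝ ℝ i
  have h2 : ContDiff ℝ 1 fun v : Fin k → ℝ => F (proj (Sum.elim u v)) :=
    ContDiff.comp (g := fun w => F (proj w)) hF h1
  unfold TorusContDiff forceSlice
  simp only [elim_proj]
  exact ContDiff.sum fun j _ => contDiff_const.mul ((contDiff_euclidean.1 h2) (Sum.inl j))

/-- By Cauchy–Schwarz, `e · F₁(x, ·)` is `M |e|`-Lipschitz. Its derivative along its own gradient
`v` is `|v|²`, at most `M |e| |v|`. -/
lemma sum_sq_pderiv_forceSlice_le (hF : TorusContDiff 1 F) (hM : IsLipschitzInY F M)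
    (e : Fin m → ℝ) (x : UnitAddTorus (Fin m)) (y : UnitAddTorus (Fin k)) :
    ∑ i, pderiv i (forceSlice F e x) y ^ 2 ≤ (M * Real.sqrt (∑ j, e j ^ 2)) ^ 2 := by
  have hψ := torusContDiff_forceSlice hF e x
  obtain ⟨u, rfl⟩ := isOpenQuotientMap_proj.surjective y
  set ψ := forceSlice F e x with hψd
  set v : Fin k → ℝ := fun i => pderiv i ψ (proj u) with hv
  set E := Real.sqrt (∑ j, e j ^ 2) with hE
  set V := Real.sqrt (∑ i, v i ^ 2) with hV
  have hV2 : V ^ 2 = ∑ i, v i ^ 2 := Real.sq_sqrt (Finset.sum_nonneg fun i _ => sq_nonneg _)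
  have hV0 : 0 ≤ V := Real.sqrt_nonneg _
  have hE0 : 0 ≤ E := Real.sqrt_nonneg _
  have hL : HasFDerivAt (fun w => ψ (proj w)) (fderiv ℝ (fun w => ψ (proj w)) u) u :=
    (ContDiff.differentiable hψ one_ne_zero u).hasFDerivAt
  have hd : HasDerivAt (fun s : ℝ => ψ (proj (u + s • v))) (∑ i, v i ^ 2) 0 := by
    have h1 : HasDerivAt (fun s : ℝ => u + s • v) v 0 := by
      simpa using ((hasDerivAt_id (0 : ℝ)).smul_const v).const_add u
    have h2 := HasFDerivAt.comp_hasDerivAt (0 : ℝ) (l := fun w => ψ (proj w))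
      (f := fun s : ℝ => u + s • v) (by simpa using hL) h1
    refine h2.congr_deriv ?_
    have h3 : v = ∑ i, v i • (Pi.single i (1 : ℝ) : Fin k → ℝ) := by
      ext i; simp [Finset.sum_apply, Pi.single_apply]
    conv_lhs => rw [h3]
    rw [map_sum]
    refine Finset.sum_congr rfl fun i _ => ?_
    rw [map_smul, smul_eq_mul, sq]
    congr 1
    exact (congrFun (hψ.pderiv_comp_proj one_ne_zero i) u).symm
  have hlip : LipschitzWith (M * E * V).toNNReal (fun s : ℝ => ψ (proj (u + s • v))) := by
    refine LipschitzWith.of_dist_le_mul fun s s' => ?_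
    rw [Real.coe_toNNReal _ (by positivity)]
    have h1 := (hM x).dist_le_mul (WithLp.toLp 2 (u + s • v)) (WithLp.toLp 2 (u + s' • v))
    have h2 : dist (WithLp.toLp 2 (u + s • v)) (WithLp.toLp 2 (u + s' • v)) = |s - s'| * V := by
      rw [dist_eq_norm, ← WithLp.toLp_sub]
      have : u + s • v - (u + s' • v) = (s - s') • v := by rw [sub_smul]; abel
      rw [this, WithLp.toLp_smul, norm_smul, Real.norm_eq_abs, EuclideanSpace.norm_eq]
      simp [hV]
    rw [h2] at h1
    set A := force₁ F (Sum.elim x (proj (u + s • v))) with hA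
    set A' := force₁ F (Sum.elim x (proj (u + s' • v))) with hA'
    have h3 : dist (ψ (proj (u + s • v))) (ψ (proj (u + s' • v))) ≤ E * dist A A' := by
      have e1 : ψ (proj (u + s • v)) - ψ (proj (u + s' • v)) = inner ℝ (WithLp.toLp 2 e) (A - A') := by
        simp only [hψd, forceSlice, hA, hA', force₁]
        rw [← Finset.sum_sub_distrib, PiLp.inner_apply]
        refine Finset.sum_congr rfl fun j _ => ?_
        simp
        ring
      rw [dist_eq_norm, e1, dist_eq_norm]
      refine (norm_inner_le_norm _ _).trans_eq ?_
      rw [EuclideanSpace.norm_eq]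
      simp [hE]
    have h1' : dist A A' ≤ M * (|s - s'| * V) := h1
    calc _ ≤ E * dist A A' := h3
      _ ≤ E * (M * (|s - s'| * V)) := mul_le_mul_of_nonneg_left h1' hE0
      _ = M * E * V * dist s s' := by rw [Real.dist_eq]; ring
  have h1 := norm_deriv_le_of_lipschitz (x₀ := (0 : ℝ)) hlip
  rw [hd.deriv, Real.coe_toNNReal _ (by positivity), ← hV2, Real.norm_of_nonneg (sq_nonneg _)] at h1
  change ∑ i, v i ^ 2 ≤ _
  rw [← hV2]
  refine pow_le_pow_left₀ hV0 ?_ 2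
  rcases hV0.eq_or_lt with h | h
  · rw [← h]; positivity
  · have : V * V ≤ (M * E) * V := by nlinarith
    exact le_of_mul_le_mul_right this h

lemma tendstoUniformly_marginal {α : ℕ → State m k → ℝ} {a : State m k → ℝ}
    (hα : ∀ n, Continuous (α n)) (ha : Continuous a) (h : TendstoUniformly α a atTop) :
    TendstoUniformly (fun n => marginal (α n)) (marginal a) atTop := by
  rw [Metric.tendstoUniformly_iff] at *
  intro ε hε
  filter_upwards [h (ε / 2) (by positivity)] with n hn x
  have i1 : Integrable fun y : UnitAddTorus (Fin k) => a (Sum.elim x y) :=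
    integrable_of_continuous (ha.comp (continuous_elim_right x))
  have i2 : Integrable fun y : UnitAddTorus (Fin k) => α n (Sum.elim x y) :=
    integrable_of_continuous ((hα n).comp (continuous_elim_right x))
  rw [dist_eq_norm, marginal, marginal, ← integral_sub i1 i2]
  have := norm_integral_le_of_norm_le_const (μ := (volume : Measure (UnitAddTorus (Fin k))))
    (f := fun y => a (Sum.elim x y) - α n (Sum.elim x y)) (C := ε / 2)
    (ae_of_all _ fun y => by rw [← dist_eq_norm]; exact (hn _).le)
  simp only [probReal_univ, mul_one] at this
  linarith

/-- The excess `∫ 𝓕₁ f p dy - (∫ f p dy) (∫ 𝓕₁ p dy)`. -/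
def forceExcess (F : Force m k) (p f : State m k → ℝ) (j : Fin m) (x : UnitAddTorus (Fin m)) : ℝ :=
  marginal (fun z => F z (Sum.inl j) * (f z * p z)) x -
    marginal (fun z => f z * p z) x * marginal (fun z => F z (Sum.inl j) * p z) x

lemma continuous_forceExcess (hF : TorusContDiff 1 F) {p f : State m k → ℝ} (hp : Continuous p)
    (hf : Continuous f) (j : Fin m) : Continuous (forceExcess F p f j) := by
  have h1 := hF.continuous_apply (Sum.inl j)
  exact (continuous_marginal (h1.fun_mul (hf.fun_mul hp))).sub
    ((continuous_marginal (hf.fun_mul hp)).mul (continuous_marginal (h1.fun_mul hp)))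

variable {p : State m k → ℝ} {ρ : ℝ}

/-- The scalar comparison of means is used for the combination of the components of `F₁` whose
coefficients are the excess `S` itself. The left side becomes `|S|⁴` and the Lipschitz constant `M
|S|`; dividing by `|S|²` gives the vector inequality without a dimensional factor. Since the
marginal of `p` is `1`, the conditional density is the slice of `p`. -/
lemma sum_sq_forceExcess_le (hF : TorusContDiff 1 F) (hM : IsLipschitzInY F M)
    (hp : Continuous p) (hp0 : ∀ z, 0 < p z) (hp1 : ∀ x, marginal p x = 1) (hρ : 0 < ρ)
    (hL : ∀ x, SatisfiesLSI (conditional p x) ρ)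
    {f : State m k → ℝ} {g : Fin m ⊕ Fin k → State m k → ℝ} (hf : HasGrad f g)
    (hf0 : ∀ z, 0 < f z) (x : UnitAddTorus (Fin m)) :
    ∑ j, forceExcess F p f j x ^ 2 ≤ marginal (fun z => f z * p z) x * (M ^ 2 / ρ ^ 2) *
      marginal (fun z => (∑ i, g (Sum.inr i) z ^ 2) / f z * p z) x := by
  set S : Fin m → ℝ := fun j => forceExcess F p f j x with hS
  have hcond : conditional p x = fun y => p (Sum.elim x y) := by
    ext y; rw [conditional, hp1, div_one]
  have hLx := hL x
  rw [hcond] at hLx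
  have hpx : Continuous fun y => p (Sum.elim x y) := hp.comp (continuous_elim_right x)
  have hfx : Continuous fun y => f (Sum.elim x y) := hf.cont.comp (continuous_elim_right x)
  have hFx : ∀ j, Continuous fun y => F (Sum.elim x y) (Sum.inl j) := fun j =>
    (hF.continuous_apply (Sum.inl j)).comp (continuous_elim_right x)
  have h1 := hLx.sq_integral_sub_le hρ ((torusContDiff_forceSlice hF S x).hasGrad one_ne_zero)
    (sum_sq_pderiv_forceSlice_le hF hM S x) (hf.slice x) (fun y => hf0 _) hpx (fun y => hp0 _)
    (hp1 x)
  have e1 : ∫ y, forceSlice F S x y * f (Sum.elim x y) * p (Sum.elim x y) =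
      ∑ j, S j * marginal (fun z => F z (Sum.inl j) * (f z * p z)) x := by
    simp only [forceSlice, marginal, Finset.sum_mul, ← integral_const_mul]
    rw [← integral_finsetSum _ fun j _ => integrable_of_continuous
      (continuous_const.fun_mul ((hFx j).fun_mul (hfx.fun_mul hpx)))]
    congr 1; ext y
    exact Finset.sum_congr rfl fun j _ => by ring
  have e2 : ∫ y, forceSlice F S x y * p (Sum.elim x y) =
      ∑ j, S j * marginal (fun z => F z (Sum.inl j) * p z) x := by
    simp only [forceSlice, marginal, Finset.sum_mul, ← integral_const_mul]
    rw [← integral_finsetSum _ fun j _ => integrable_of_continuous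
      (continuous_const.fun_mul ((hFx j).fun_mul hpx))]
    congr 1; ext y
    exact Finset.sum_congr rfl fun j _ => by ring
  have e3 : (∑ j, S j * marginal (fun z => F z (Sum.inl j) * (f z * p z)) x) -
      (∫ y, f (Sum.elim x y) * p (Sum.elim x y)) *
        ∑ j, S j * marginal (fun z => F z (Sum.inl j) * p z) x = ∑ j, S j ^ 2 := by
    rw [Finset.mul_sum, ← Finset.sum_sub_distrib]
    refine Finset.sum_congr rfl fun j _ => ?_
    have hSj : S j = marginal (fun z => F z (Sum.inl j) * (f z * p z)) x -
      (∫ y, f (Sum.elim x y) * p (Sum.elim x y)) * marginal (fun z => F z (Sum.inl j) * p z) x :=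
      rfl
    linear_combination (-S j) * hSj
  rw [e1, e2, e3] at h1
  have hs0 : 0 ≤ ∑ j, S j ^ 2 := Finset.sum_nonneg fun j _ => sq_nonneg _
  rw [mul_pow, Real.sq_sqrt hs0] at h1
  set N := ∫ y, f (Sum.elim x y) * p (Sum.elim x y) with hN
  set I := ∫ y, (∑ i, g (Sum.inr i) (Sum.elim x y) ^ 2) / f (Sum.elim x y) * p (Sum.elim x y)
    with hI
  have hN0 : 0 < N := integral_mul_pos hfx (fun y => hf0 _) hpx fun y => hp0 _
  have hI0 : 0 ≤ I := integral_nonneg fun y => mul_nonneg (div_nonneg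
    (Finset.sum_nonneg fun i _ => sq_nonneg _) (hf0 _).le) (hp0 _).le
  change ∑ j, S j ^ 2 ≤ N * (M ^ 2 / ρ ^ 2) * I
  rcases hs0.eq_or_lt with h | h
  · rw [← h]; positivity
  · refine le_of_mul_le_mul_right ?_ h
    calc (∑ j, S j ^ 2) * ∑ j, S j ^ 2 = (∑ j, S j ^ 2) ^ 2 := by ring
      _ ≤ _ := h1
      _ = _ := by ring

/-- The excess of the mean force is controlled by the Fisher information in the direction of
`y`. -/
lemma integral_sum_sq_forceExcess_le (hF : TorusContDiff 1 F) (hM : IsLipschitzInY F M)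
    (hp : Continuous p) (hp0 : ∀ z, 0 < p z) (hp1 : ∀ x, marginal p x = 1) (hρ : 0 < ρ)
    (hL : ∀ x, SatisfiesLSI (conditional p x) ρ)
    {f : State m k → ℝ} {g : Fin m ⊕ Fin k → State m k → ℝ} (hf : H1C f g)
    (hf0 : ∀ z, 0 < f z) {C : ℝ} (hC : ∀ x, marginal (fun z => f z * p z) x ≤ C) :
    ∫ x, ∑ j, forceExcess F p f j x ^ 2 ≤ C * (M ^ 2 / ρ ^ 2) *
      ∫ z, (∑ i, g (Sum.inr i) z ^ 2) / f z * p z := by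
  obtain ⟨φ, hφ, hφ0, hφg, hΘ⟩ := hf.exists_approx_gt hf0
  have hcst : ∀ q : State m k → ℝ, TendstoUniformly (fun _ : ℕ => q) q atTop := fun q u hu =>
    Eventually.of_forall fun _ _ => refl_mem_uniformity hu
  have hφf : TendstoUniformly φ f atTop := hΘ (Θ := fun x => x) continuousOn_id
  have hfp : TendstoUniformly (fun n z => φ n z * p z) (fun z => f z * p z) atTop :=
    TendstoUniformly.mul_of_continuous hf.cont hp hφf (hcst p)
  have hfpc : ∀ n, Continuous fun z => φ n z * p z := fun n => (hφ n).continuous.mul hp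
  have hfc : Continuous fun z => f z * p z := hf.cont.mul hp
  have hNu := tendstoUniformly_marginal hfpc hfc hfp
  have hFc : ∀ j : Fin m, Continuous fun z => F z (Sum.inl j) := fun j => hF.continuous_apply _
  have hSu : ∀ j, TendstoUniformly (fun n => forceExcess F p (φ n) j) (forceExcess F p f j)
      atTop := fun j =>
    (tendstoUniformly_marginal (fun n => (hFc j).fun_mul (hfpc n)) ((hFc j).fun_mul hfc)
      (TendstoUniformly.mul_of_continuous (hFc j) hfc (hcst _) hfp)).sub
    (TendstoUniformly.mul_of_continuous (continuous_marginal hfc)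
      (continuous_marginal ((hFc j).fun_mul hp)) hNu
      (fun u hu => Eventually.of_forall fun _ _ => refl_mem_uniformity hu))
  have hSc : ∀ n j, Continuous (forceExcess F p (φ n) j) := fun n j =>
    continuous_forceExcess hF hp (hφ n).continuous j
  have hSc' : ∀ j, Continuous (forceExcess F p f j) := fun j =>
    continuous_forceExcess hF hp hf.cont j
  have hlimS : Tendsto (fun n => ∫ x, ∑ j, forceExcess F p (φ n) j x ^ 2) atTop
      (𝓝 (∫ x, ∑ j, forceExcess F p f j x ^ 2)) := by
    have h1 := tendsto_finsetSum Finset.univ fun j (_ : j ∈ Finset.univ) =>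
      tendsto_integral_of_tendstoUniformly (μ := (volume : Measure (UnitAddTorus (Fin m))))
        (fun n => (hSc n j).mul (hSc n j)) ((hSc' j).mul (hSc' j))
        (TendstoUniformly.mul_of_continuous (hSc' j) (hSc' j) (hSu j) (hSu j))
    have e : ∀ s : Fin m → UnitAddTorus (Fin m) → ℝ, (∀ j, Continuous (s j)) →
        ∑ j, ∫ x, s j x * s j x = ∫ x, ∑ j, s j x ^ 2 := fun s hs => by
      rw [integral_finsetSum _ fun j _ => integrable_of_continuous ((hs j).fun_pow 2)]
      simp only [sq]
    simp only [Pi.mul_apply] at h1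
    rw [e _ hSc'] at h1
    exact h1.congr fun n => e _ (hSc n)
  have hlimI := hf.tendsto_fisher hf0 hφ hφ0 hφg hΘ hp
    (Finset.univ.map (Function.Embedding.inr : Fin k ↪ Fin m ⊕ Fin k))
  simp only [Finset.sum_map, Function.Embedding.inr_apply] at hlimI
  have hI0 : ∀ n, 0 ≤ ∫ z, (∑ i : Fin k, pderiv (Sum.inr i) (φ n) z ^ 2) / φ n z * p z := fun n =>
    integral_nonneg fun z => mul_nonneg (div_nonneg
      (Finset.sum_nonneg fun i _ => sq_nonneg _) (hφ0 n z).le) (hp0 z).le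
  -- The bound slice by slice needs `C¹` functions, hence the smooth approximants. Their marginals
  -- are eventually below `C + δ` only; `δ` tends to `0` afterwards.
  have key : ∀ δ : ℝ, 0 < δ → ∫ x, ∑ j, forceExcess F p f j x ^ 2 ≤ (C + δ) * (M ^ 2 / ρ ^ 2) *
      ∫ z, (∑ i, g (Sum.inr i) z ^ 2) / f z * p z := by
    intro δ hδ
    refine le_of_tendsto_of_tendsto hlimS (hlimI.const_mul _) ?_
    filter_upwards [Metric.tendstoUniformly_iff.1 hNu δ hδ] with n hn
    have hgn := (hφ n).hasGrad (r := ∞) (by simp)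
    have hIc : Continuous fun z =>
        (∑ i : Fin k, pderiv (Sum.inr i) (φ n) z ^ 2) / φ n z * p z :=
      (Continuous.div (continuous_finsetSum _ fun i _ => (hgn.cont_grad _).pow 2)
        (hφ n).continuous fun z => (hφ0 n z).ne').mul hp
    rw [← integral_marginal hIc, ← integral_const_mul]
    refine integral_mono
      (integrable_of_continuous (continuous_finsetSum _ fun j _ => (hSc n j).fun_pow 2))
      (integrable_of_continuous (continuous_const.fun_mul (continuous_marginal hIc))) fun x => ?_
    refine (sum_sq_forceExcess_le hF hM hp hp0 hp1 hρ hL hgn (hφ0 n) x).trans ?_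
    refine mul_le_mul_of_nonneg_right (mul_le_mul_of_nonneg_right ?_ (by positivity))
      (marginal_nonneg (fun z => mul_nonneg (div_nonneg
      (Finset.sum_nonneg fun i _ => sq_nonneg _) (hφ0 n z).le) (hp0 z).le) x)
    have h1 := hn x
    rw [Real.dist_eq, abs_lt] at h1
    linarith [hC x]
  have hlim : Tendsto (fun δ : ℝ => (C + δ) * (M ^ 2 / ρ ^ 2) *
      ∫ z, (∑ i, g (Sum.inr i) z ^ 2) / f z * p z) (𝓝[>] 0) (𝓝 ((C + 0) * (M ^ 2 / ρ ^ 2) *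
      ∫ z, (∑ i, g (Sum.inr i) z ^ 2) / f z * p z)) :=
    (Continuous.tendsto (by fun_prop) 0).mono_left nhdsWithin_le_nhds
  rw [add_zero] at hlim
  exact ge_of_tendsto hlim (by filter_upwards [self_mem_nhdsWithin] with δ hδ using key δ hδ)

end MeanForce

/-! ### Entropy dissipation -/

section Dissipation

variable {m k : ℕ} {alg : Algorithm} {β : ℝ} {F : Force m k} {M : ℝ≥0}

/-- The shifted relative density. -/
lemma H1C.div_add {ι : Type} [Fintype ι] [DecidableEq ι] {a p : UnitAddTorus ι → ℝ}
    {ga gp : ι → UnitAddTorus ι → ℝ} (ha : H1C a ga) (ha0 : ∀ z, 0 ≤ a z)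
    (hp : H1C p gp) (hp0 : ∀ z, 0 < p z) (ε : ℝ) :
    H1C (fun z => a z / p z + ε) (fun i z => (ga i z - a z / p z * gp i z) / p z) := by
  have h1 := hp.comp hp0 (Ψ := fun x => x⁻¹) (Ψ' := fun x => -(x ^ 2)⁻¹)
    (fun x hx => contDiffAt_inv ℝ hx.ne') (fun x hx => hasDerivAt_inv hx.ne')
  have h2 := ha.mul h1
  -- A negative `c` is chosen because `a / p` may vanish; the affine map is smooth everywhere.
  have h3 := h2.comp (c := -1) (Ψ := fun x => x + ε) (Ψ' := fun _ => 1)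
    (fun z => lt_of_lt_of_le neg_one_lt_zero (mul_nonneg (ha0 z) (inv_nonneg.2 (hp0 z).le)))
    (fun x _ => contDiffAt_id.add contDiffAt_const) (fun x _ => (hasDerivAt_id x).add_const ε)
  refine h3.congr ?_ ?_
  · intro z; simp [div_eq_mul_inv]
  · intro i z
    have := (hp0 z).ne'
    field_simp
    ring

variable {p a r : State m k → ℝ} {ρ : ℝ} {B Bp : Bias m}

lemma marginal_div_add_mul (hp : Continuous p) (hp0 : ∀ z, 0 < p z) (hp1 : ∀ x, marginal p x = 1)
    (ha : Continuous a) (ε : ℝ) (x : UnitAddTorus (Fin m)) :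
    marginal (fun z => (a z / p z + ε) * p z) x = marginal a x + ε := by
  have hax := ha.comp (continuous_elim_right x)
  have hpx := hp.comp (continuous_elim_right x)
  have : ∀ z, (a z / p z + ε) * p z = a z + ε * p z := fun z => by
    rw [add_mul, div_mul_cancel₀ _ (hp0 z).ne']
  simp only [this]
  have h1 := hp1 x
  unfold marginal at *
  rw [integral_add (by exact integrable_of_continuous hax)
    (by exact integrable_of_continuous (continuous_const.fun_mul hpx)), integral_const_mul, h1,
    mul_one]

/-- The shift by `ε` adds the same quantity to both terms of the excess, as the marginal of `p` is
`1`. What remains is, up to sign, the difference of mean forces weighted by the marginal of `a`. -/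
lemma forceExcess_eq (hF : TorusContDiff 1 F) (hp : Continuous p) (hp0 : ∀ z, 0 < p z)
    (hp1 : ∀ x, marginal p x = 1) (ha : Continuous a) (ha0 : ∀ z, 0 ≤ a z) (ε : ℝ)
    (j : Fin m) (x : UnitAddTorus (Fin m)) :
    forceExcess F p (fun z => a z / p z + ε) j x =
      -(marginal a x * (meanForce F a x j - meanForce F p x j)) := by
  have hFj := (hF.continuous_apply (Sum.inl j)).comp (continuous_elim_right x)
  have hax := ha.comp (continuous_elim_right x)
  have hpx := hp.comp (continuous_elim_right x)
  have e1 := marginal_div_add_mul hp hp0 hp1 ha ε x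
  have e2 : marginal (fun z => F z (Sum.inl j) * ((a z / p z + ε) * p z)) x =
      marginal (fun z => F z (Sum.inl j) * a z) x +
        ε * marginal (fun z => F z (Sum.inl j) * p z) x := by
    have : ∀ z, F z (Sum.inl j) * ((a z / p z + ε) * p z) =
        F z (Sum.inl j) * a z + ε * (F z (Sum.inl j) * p z) := fun z => by
      rw [add_mul, div_mul_cancel₀ _ (hp0 z).ne']; ring
    simp only [this]
    unfold marginal
    rw [integral_add (by exact integrable_of_continuous (hFj.fun_mul hax))
      (by exact integrable_of_continuous (continuous_const.fun_mul (hFj.fun_mul hpx))),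
      integral_const_mul]
  have h1 := marginal_mul_meanForce hF ha ha0 x j
  have h2 := marginal_mul_meanForce hF hp (fun z => (hp0 z).le) x j
  rw [hp1, one_mul] at h2
  rw [forceExcess, e1, e2, mul_sub, h1, h2]
  ring

/-- Control of the variation of the bias by the Fisher information in the direction of `y`. -/
lemma integral_bias_sub_le (hF : TorusContDiff 1 F) (hM : IsLipschitzInY F M)
    (hp : Continuous p) (hp0 : ∀ z, 0 < p z) (hp1 : ∀ x, marginal p x = 1) (hρ : 0 < ρ)
    (hL : ∀ x, SatisfiesLSI (conditional p x) ρ) (ha : Continuous a) (ha0 : ∀ z, 0 ≤ a z)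
    (hBp : IsBias alg F p Bp) (hB : IsBias alg F a B) {ε c C : ℝ} (hε : 0 < ε) (hc : 0 < c)
    (hca : ∀ x, c ≤ marginal a x) (hCa : ∀ x, marginal a x ≤ C)
    {g : Fin m ⊕ Fin k → State m k → ℝ} (hf : H1C (fun z => a z / p z + ε) g) :
    c ^ 2 * ∫ x, ∑ j, (B x j - Bp x j) ^ 2 ≤ (C + ε) * (M ^ 2 / ρ ^ 2) *
      ∫ z, (∑ i, g (Sum.inr i) z ^ 2) / (a z / p z + ε) * p z := by
  have hf0 : ∀ z, 0 < a z / p z + ε := fun z =>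
    add_pos_of_nonneg_of_pos (div_nonneg (ha0 z) (hp0 z).le) hε
  have h1 := integral_sum_sq_forceExcess_le hF hM hp hp0 hp1 hρ hL hf hf0 (C := C + ε)
    (fun x => by
      rw [marginal_div_add_mul hp hp0 hp1 ha]
      linarith [hCa x])
  have h2 := IsBias.integral_sq_sub_le hF ha ha0 hp (fun z => (hp0 z).le) hB hBp
  -- The biases are compared in Lebesgue measure, whereas the excess carries the factor `marginal
  -- a`; the lower bound `c` converts one into the other.
  refine (mul_le_mul_of_nonneg_left h2 (sq_nonneg c)).trans (le_trans ?_ h1)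
  simp only [forceExcess_eq hF hp hp0 hp1 ha ha0]
  rw [← integral_const_mul]
  have hG := fun j => memLp_meanForce hF ha ha0 j
  have hG' := fun j => memLp_meanForce hF hp (fun z => (hp0 z).le) j
  have hD : ∀ j, MemLp (fun x => meanForce F a x j - meanForce F p x j) 2 volume :=
    fun j => (hG j).sub (hG' j)
  refine integral_mono ((integrable_finsetSum _ fun j _ => integrable_sq (hD j)).const_mul _)
    (integrable_finsetSum _ fun j _ =>
      integrable_sq ((memLp_continuous_mul (continuous_marginal ha) (hD j)).neg)) fun x => ?_
  simp only [Finset.mul_sum]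
  refine Finset.sum_le_sum fun j _ => ?_
  rw [neg_sq, mul_pow]
  exact mul_le_mul_of_nonneg_right (pow_le_pow_left₀ hc.le (hca x) 2) (sq_nonneg _)

/-- The entropy dissipation inequality. -/
lemma integral_mul_log_le (hF : TorusContDiff 1 F) (hM : IsLipschitzInY F M)
    (hp : IsStationaryState alg β F p Bp) (hp0 : ∀ z, 0 < p z) (hp1 : ∀ x, marginal p x = 1)
    (hρ : 0 < ρ) (hL : ∀ x, SatisfiesLSI (conditional p x) ρ)
    {ga gp : Fin m ⊕ Fin k → State m k → ℝ} (hpg : H1C p gp) (ha : H1C a ga)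
    (ha0 : ∀ z, 0 ≤ a z) (hB : IsBias alg F a B) (hr : Continuous r)
    (hw : ∀ φ : State m k → ℝ, TorusContDiff ∞ φ →
      ∫ z, generator β F B φ z * a z = ∫ z, r z * φ z)
    {ε c C κ : ℝ} (hε : 0 < ε) (hc : 0 < c)
    (hca : ∀ x, c ≤ marginal a x) (hCa : ∀ x, marginal a x ≤ C) (hκ : 0 < κ)
    (hκM : (C + ε) * M ≤ κ * c * ρ) {g : Fin m ⊕ Fin k → State m k → ℝ}
    (hg : g = fun i z => (ga i z - a z / p z * gp i z) / p z) :
    ∫ z, r z * Real.log (a z / p z + ε) ≤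
      -(β⁻¹ - κ / 2) * ∫ z, (∑ i, g i z ^ 2) / (a z / p z + ε) * p z := by
  set f : State m k → ℝ := fun z => a z / p z + ε with hfd
  have hf : H1C f g := hg ▸ ha.div_add ha0 hpg hp0 ε
  have hf0 : ∀ z, 0 < f z := fun z =>
    add_pos_of_nonneg_of_pos (div_nonneg (ha0 z) (hp0 z).le) hε
  have hpn : ∀ z, 0 ≤ p z := fun z => (hp0 z).le
  have hBm := hB.memLp hF ha.cont ha0
  have hBpm := hp.bias.memLp hF hp.continuous hpn
  have hd := memLp_drift hF hBm
  have hdp := memLp_drift hF hBpm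
  have hlog := hf.comp hf0 (Ψ := Real.log) (Ψ' := fun x => x⁻¹)
    (fun x hx => Real.contDiffAt_log.2 hx.ne') (fun x hx => Real.hasDerivAt_log hx.ne')
  -- The equation of `a` is tested with `log f`, that of `p` with `f - ε log f`. The choice is
  -- dictated by `a = p (f - ε)`: then `p (1 - ε / f) ∇f = a ∇f / f`, so the two drift terms can be
  -- compared.
  have hlog' := hf.comp hf0 (Ψ := fun x => x - ε * Real.log x) (Ψ' := fun x => 1 - ε * x⁻¹)
    (fun x hx => contDiffAt_id.sub (contDiffAt_const.mul (Real.contDiffAt_log.2 hx.ne')))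
    (fun x hx => (hasDerivAt_id x).sub ((Real.hasDerivAt_log hx.ne').const_mul ε))
  have hW : ∀ i, MemLp (fun z => a z * drift F B i z - β⁻¹ * ga i z) 2 volume := fun i =>
    (memLp_continuous_mul ha.cont (hd i)).sub ((ha.memLp i).const_mul _)
  have hJ : ∀ i, MemLp (fun z => p z * drift F Bp i z - β⁻¹ * gp i z) 2 volume := fun i =>
    (memLp_continuous_mul hp.continuous (hdp i)).sub ((hpg.memLp i).const_mul _)
  have t1 := hlog.integral_test hW (memLp_of_continuous hr) fun φ hφ => by
    rw [← ha.integral_generator hF hBm hφ]; exact hw φ hφ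
  have t2 := hlog'.integral_test hJ (memLp_const (0 : ℝ)) fun φ hφ => by
    rw [← hpg.integral_generator hF hBpm hφ]; simpa using hp.equation φ hφ
  simp only [zero_mul, integral_zero] at t2
  have hE : ∀ j, MemLp (fun x => B x j - Bp x j) 2 volume := fun j => (hBm j).sub (hBpm j)
  have hEx : ∀ j, MemLp (fun z : State m k => B (xpart z) j - Bp (xpart z) j) 2 volume :=
    fun j => (hE j).comp_measurePreserving measurePreserving_xpart
  have hgf : ∀ i, MemLp (fun z => (f z)⁻¹ * g i z) 2 volume := hlog.memLp
  set X := ∫ z, ∑ j, (a z * (B (xpart z) j - Bp (xpart z) j)) *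
    ((f z)⁻¹ * g (Sum.inl j) z) with hX
  have iX : Integrable fun z => ∑ j, (a z * (B (xpart z) j - Bp (xpart z) j)) *
      ((f z)⁻¹ * g (Sum.inl j) z) := integrable_finsetSum _ fun j _ =>
    integrable_mul_of_memLp (memLp_continuous_mul ha.cont (hEx j)) (hgf _)
  have iI1 : ∀ i, Integrable fun z => g i z ^ 2 / f z * p z := fun i => by
    have := integrable_mul_of_memLp (memLp_continuous_mul hp.continuous (hgf i)) (hf.memLp i)
    refine this.congr (ae_of_all _ fun z => ?_)
    simp only [div_eq_mul_inv]; ring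
  have iI : Integrable fun z => (∑ i, g i z ^ 2) / f z * p z := by
    simp only [Finset.sum_div, Finset.sum_mul]
    exact integrable_finsetSum _ fun i _ => iI1 i
  have iJ : Integrable fun z => ∑ i, (p z * drift F Bp i z - β⁻¹ * gp i z) *
      ((1 - ε * (f z)⁻¹) * g i z) := integrable_finsetSum _ fun i _ =>
    integrable_mul_of_memLp (hJ i) (hlog'.memLp i)
  -- After substituting `∇a = p ∇f + (f - ε) ∇p`, the stationary flux cancels `F` and `∇p` entirely.
  -- Only the difference of biases and the Fisher information survive; no gradient structure of `F`
  -- is used.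
  have key : ∫ z, ∑ i, (a z * drift F B i z - β⁻¹ * ga i z) * ((f z)⁻¹ * g i z) =
      X + 0 - β⁻¹ * ∫ z, (∑ i, g i z ^ 2) / f z * p z := by
    rw [← t2, hX, ← integral_const_mul, ← integral_add iX iJ,
      ← integral_sub (by exact iX.add iJ) (iI.const_mul _)]
    refine integral_congr_ae (ae_of_all _ fun z => ?_)
    have hfz : f z = a z / p z + ε := rfl
    have hpz := (hp0 z).ne'
    have hfz0 := (hf0 z).ne'
    have haz : a z = p z * (f z - ε) := by rw [hfz]; field_simp; ring
    have hgz : ∀ i, ga i z = p z * g i z + (f z - ε) * gp i z := fun i => by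
      rw [hg, hfz]; field_simp; ring
    have e1 : ∑ j, (a z * (B (xpart z) j - Bp (xpart z) j)) * ((f z)⁻¹ * g (Sum.inl j) z) =
        ∑ i, a z * (drift F B i z - drift F Bp i z) * ((f z)⁻¹ * g i z) := by
      rw [Fintype.sum_sum_type]
      simp [drift]
    simp only [e1, Finset.sum_div, Finset.sum_mul, Finset.mul_sum, ← Finset.sum_add_distrib,
      ← Finset.sum_sub_distrib]
    refine Finset.sum_congr rfl fun i _ => ?_
    rw [hgz, haz]
    field_simp
    ring
  have hIsplit : ∫ z, (∑ i, g i z ^ 2) / f z * p z =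
      (∫ z, (∑ j, g (Sum.inl j) z ^ 2) / f z * p z) +
        ∫ z, (∑ i, g (Sum.inr i) z ^ 2) / f z * p z := by
    rw [← integral_add]
    · congr 1; ext z; rw [Fintype.sum_sum_type]; ring
    · simp only [Finset.sum_div, Finset.sum_mul]
      exact integrable_finsetSum _ fun i _ => iI1 _
    · simp only [Finset.sum_div, Finset.sum_mul]
      exact integrable_finsetSum _ fun i _ => iI1 _
  set Ix := ∫ z, (∑ j, g (Sum.inl j) z ^ 2) / f z * p z with hIx
  set Iy := ∫ z, (∑ i, g (Sum.inr i) z ^ 2) / f z * p z with hIy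
  have hIy0 : 0 ≤ Iy := integral_nonneg fun z => mul_nonneg (div_nonneg
    (Finset.sum_nonneg fun i _ => sq_nonneg _) (hf0 z).le) (hpn z)
  have hu := continuous_marginal ha.cont
  have iE : Integrable fun x => ∑ j, (B x j - Bp x j) ^ 2 :=
    integrable_finsetSum _ fun j _ => integrable_sq (hE j)
  have iEx : Integrable fun z : State m k => (∑ j, (B (xpart z) j - Bp (xpart z) j) ^ 2) * a z := by
    obtain ⟨K, -, hK⟩ := exists_bound ha.cont
    exact (measurePreserving_xpart.integrable_comp_of_integrable iE).mul_bdd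
      ha.cont.aestronglyMeasurable (ae_of_all _ hK)
  -- Young's inequality with weight `κ`, together with `a ≤ p f`.
  have hXle : X ≤ (1 / (2 * κ)) * (∫ z : State m k, (∑ j, (B (xpart z) j - Bp (xpart z) j) ^ 2) * a z) +
      κ / 2 * Ix := by
    rw [hX, hIx, ← integral_const_mul, ← integral_const_mul, ← integral_add (iEx.const_mul _)]
    · refine integral_mono iX ((iEx.const_mul _).add (Integrable.const_mul ?_ _)) fun z => ?_
      · simp only [Finset.sum_div, Finset.sum_mul]
        exact integrable_finsetSum _ fun i _ => iI1 _
      · simp only [Finset.sum_div, Finset.sum_mul, Finset.mul_sum,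
          ← Finset.sum_add_distrib]
        refine Finset.sum_le_sum fun j _ => ?_
        have hfz0 := hf0 z
        have haf : a z ≤ p z * f z := by
          have : p z * f z = a z + p z * ε := by
            rw [hfd]; have := (hp0 z).ne'; field_simp
          rw [this]; linarith [mul_pos (hp0 z) hε]
        set e := B (xpart z) j - Bp (xpart z) j
        set γ := (f z)⁻¹ * g (Sum.inl j) z with hγ
        have hgγ : g (Sum.inl j) z = f z * γ := by rw [hγ]; field_simp
        have h1 : a z * e * γ ≤ 1 / (2 * κ) * (e ^ 2 * a z) + κ / 2 * (a z * γ ^ 2) := by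
          have h2 : 0 ≤ (e - κ * γ) ^ 2 / (2 * κ) * a z := by
            have := ha0 z
            positivity
          have h3 : (e - κ * γ) ^ 2 / (2 * κ) * a z =
            1 / (2 * κ) * (e ^ 2 * a z) + κ / 2 * (a z * γ ^ 2) - a z * e * γ := by
            field_simp; ring
          linarith
        refine h1.trans (add_le_add le_rfl (mul_le_mul_of_nonneg_left ?_ (by positivity)))
        have h4 : g (Sum.inl j) z ^ 2 / f z * p z = p z * f z * γ ^ 2 := by
          rw [hgγ]; field_simp
        rw [h4]
        exact mul_le_mul_of_nonneg_right haf (sq_nonneg _)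
    · refine Integrable.const_mul ?_ _
      simp only [Finset.sum_div, Finset.sum_mul]
      exact integrable_finsetSum _ fun i _ => iI1 _
  have hEle : ∫ z : State m k, (∑ j, (B (xpart z) j - Bp (xpart z) j) ^ 2) * a z ≤
      C * ∫ x, ∑ j, (B x j - Bp x j) ^ 2 := by
    rw [integral_xpart_mul (ψ := fun x => ∑ j, (B x j - Bp x j) ^ 2) ha.cont iE,
      ← integral_const_mul]
    obtain ⟨K, -, hK⟩ := exists_bound hu
    refine integral_mono (iE.mul_bdd hu.aestronglyMeasurable (ae_of_all _ hK))
      (iE.const_mul _) fun x => ?_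
    rw [mul_comm]
    exact mul_le_mul_of_nonneg_right (hCa x) (Finset.sum_nonneg fun j _ => sq_nonneg _)
  have hbias := integral_bias_sub_le hF hM hp.continuous hp0 hp1 hρ hL ha.cont ha0 hp.bias hB hε hc
    hca hCa hf
  set S := ∫ x, ∑ j, (B x j - Bp x j) ^ 2 with hS
  have hC0 : 0 < C := hc.trans_le ((hca 0).trans (hCa 0))
  -- This is the purpose of `hκM`: the bias term becomes at most `κ² Iy`, so that Young's inequality
  -- yields `κ / 2` in front of `Iy` exactly as in front of `Ix`.
  have hCS : C * S ≤ κ ^ 2 * Iy := by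
    have h1 : c ^ 2 * ρ ^ 2 * (C * S) ≤ c ^ 2 * ρ ^ 2 * (κ ^ 2 * Iy) := by
      have h2 : C * ρ ^ 2 * (c ^ 2 * S) ≤ C * ρ ^ 2 * ((C + ε) * (M ^ 2 / ρ ^ 2) * Iy) :=
        mul_le_mul_of_nonneg_left hbias (by positivity)
      have h3 : C * ρ ^ 2 * ((C + ε) * (M ^ 2 / ρ ^ 2) * Iy) = C * (C + ε) * (M : ℝ) ^ 2 * Iy := by
        field_simp
      have h4 : C * (C + ε) * (M : ℝ) ^ 2 ≤ (κ * c * ρ) ^ 2 := by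
        calc C * (C + ε) * (M : ℝ) ^ 2 ≤ (C + ε) * (C + ε) * (M : ℝ) ^ 2 := by
              gcongr; linarith
          _ = ((C + ε) * M) ^ 2 := by ring
          _ ≤ _ := pow_le_pow_left₀ (by positivity) hκM 2
      have h5 := mul_le_mul_of_nonneg_right h4 hIy0
      nlinarith
    exact le_of_mul_le_mul_left h1 (by positivity)
  have t1' : ∫ z, ∑ i, (a z * drift F B i z - β⁻¹ * ga i z) * ((f z)⁻¹ * g i z) =
      ∫ z, r z * Real.log (f z) := t1
  rw [← t1', key, hIsplit]
  have h6 : 1 / (2 * κ) * (∫ z : State m k, (∑ j, (B (xpart z) j - Bp (xpart z) j) ^ 2) * a z) ≤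
      κ / 2 * Iy := by
    calc _ ≤ 1 / (2 * κ) * (κ ^ 2 * Iy) :=
          mul_le_mul_of_nonneg_left (hEle.trans hCS) (by positivity)
      _ = _ := by field_simp
  linarith

end Dissipation

/-! ### Uniform decay from energy identities (Nash–Moser iteration) -/

section Decay

lemma antitoneOn_of_hasDerivAt_nonpos {D : Set ℝ} (hD : Convex ℝ D) {f f' : ℝ → ℝ}
    (hf : ∀ x ∈ D, HasDerivAt f (f' x) x) (hf' : ∀ x ∈ D, f' x ≤ 0) : AntitoneOn f D :=
  antitoneOn_of_deriv_nonpos hD (fun x hx => (hf x hx).continuousAt.continuousWithinAt)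
    (fun x hx => (hf x (interior_subset hx)).differentiableAt.differentiableWithinAt)
    fun x hx => by rw [(hf x (interior_subset hx)).deriv]; exact hf' x (interior_subset hx)

/-- A solution of `Z' ≤ -b Z^{1 + α}` (as long as `Z ≥ 1`) comes down from infinity. -/
lemma rpow_mul_le_one_of_deriv_le {Z Z' : ℝ → ℝ} {b α τ s : ℝ} (hα : 0 < α)
    (hτ : 0 < τ) (hZ : ∀ t ∈ Icc s (s + τ), HasDerivAt Z (Z' t) t)
    (hZ0 : ∀ t ∈ Icc s (s + τ), Z' t ≤ 0)
    (hZ1 : ∀ t ∈ Icc s (s + τ), 1 ≤ Z t → Z' t ≤ -(b * (Z t * Z t ^ α)))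
    (h1 : 1 ≤ Z (s + τ)) : Z (s + τ) ^ α * (b * α * τ) ≤ 1 := by
  have hanti := antitoneOn_of_hasDerivAt_nonpos (convex_Icc s (s + τ)) hZ hZ0
  have hend : s + τ ∈ Icc s (s + τ) := ⟨by linarith, le_rfl⟩
  have hst : s ∈ Icc s (s + τ) := ⟨le_rfl, by linarith⟩
  have hge : ∀ t ∈ Icc s (s + τ), 1 ≤ Z t := fun t ht => h1.trans (hanti ht hend ht.2)
  -- The inequality says that `Z ^ (-α)` grows at least at rate `b α`, whatever its initial value.
  have hW : ∀ t ∈ Icc s (s + τ), HasDerivAt (fun t => b * α * t - Z t ^ (-α))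
      (b * α - Z' t * (-α) * Z t ^ (-α - 1)) t := fun t ht => by
    have hpos : 0 < Z t := lt_of_lt_of_le one_pos (hge t ht)
    have h2 := (hZ t ht).rpow_const (p := -α) (Or.inl hpos.ne')
    have h3 : HasDerivAt (fun t => b * α * t) (b * α) t := by
      simpa using (hasDerivAt_id t).const_mul (b * α)
    exact h3.sub h2
  have hW0 : ∀ t ∈ Icc s (s + τ), b * α - Z' t * (-α) * Z t ^ (-α - 1) ≤ 0 := fun t ht => by
    have hpos : 0 < Z t := lt_of_lt_of_le one_pos (hge t ht)
    have h2 : Z t * Z t ^ α * Z t ^ (-α - 1) = 1 := by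
      rw [Real.rpow_sub_one hpos.ne', Real.rpow_neg hpos.le]
      have := (Real.rpow_pos_of_pos hpos α).ne'
      field_simp
    have h3 : 0 < Z t ^ (-α - 1) := Real.rpow_pos_of_pos hpos _
    have h4 := mul_le_mul_of_nonneg_right (hZ1 t ht (hge t ht)) (mul_pos hα h3).le
    have h5 : -(b * (Z t * Z t ^ α)) * (α * Z t ^ (-α - 1)) = -(b * α) := by
      linear_combination (-(b * α)) * h2
    linarith
  have h6 := antitoneOn_of_hasDerivAt_nonpos (convex_Icc s (s + τ)) hW hW0 hst hend
    (by linarith)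
  simp only at h6
  have hpos : 0 < Z (s + τ) := lt_of_lt_of_le one_pos h1
  have h7 : 0 < Z s ^ (-α) := Real.rpow_pos_of_pos (lt_of_lt_of_le one_pos (hge s hst)) _
  have h8 : b * α * τ ≤ Z (s + τ) ^ (-α) := by nlinarith
  calc Z (s + τ) ^ α * (b * α * τ) ≤ Z (s + τ) ^ α * Z (s + τ) ^ (-α) :=
        mul_le_mul_of_nonneg_left h8 (Real.rpow_nonneg hpos.le _)
    _ = 1 := by rw [← Real.rpow_add hpos]; simp

variable {ι : Type} [Fintype ι] [DecidableEq ι]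

/-- A continuous function whose moments of order `2 ^ i` are bounded by those of a constant is
bounded by this constant. -/
lemma abs_le_of_integral_pow_le {w : UnitAddTorus ι → ℝ} (hw : Continuous w) {N : ℝ} (hN : 0 ≤ N)
    (h : ∀ i : ℕ, ∫ z, w z ^ 2 ^ (i + 1) ≤ N ^ 2 ^ (i + 1)) (z : UnitAddTorus ι) : |w z| ≤ N := by
  by_contra! hlt
  obtain ⟨N', hNN', hN'⟩ := exists_between hlt
  have hN'0 : 0 < N' := hN.trans_lt hNN'
  set U : Set (UnitAddTorus ι) := {x | N' < |w x|} with hU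
  have hUo : IsOpen U := isOpen_lt continuous_const hw.abs
  have hUpos : 0 < volume.real U :=
    ENNReal.toReal_pos (hUo.measure_pos volume ⟨z, hN'⟩).ne' (measure_ne_top _ _)
  -- Chebyshev's inequality: the set where `|w| > N'` has measure at most a power of `N / N' < 1`
  -- that tends to `0`, yet it is open and nonempty.
  have hle : ∀ i : ℕ, volume.real U ≤ (N / N') ^ 2 ^ (i + 1) := fun i => by
    have hev : Even (2 ^ (i + 1)) := (Nat.even_pow.2 ⟨even_two, by simp⟩)
    have h1 : volume.real U * N' ^ 2 ^ (i + 1) ≤ ∫ x, w x ^ 2 ^ (i + 1) := by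
      rw [← smul_eq_mul, ← integral_indicator_const _ hUo.measurableSet]
      refine integral_mono ((integrable_const _).indicator hUo.measurableSet)
        (integrable_of_continuous (hw.fun_pow _)) fun x => ?_
      by_cases hx : x ∈ U
      · simp only [indicator_of_mem hx]
        rw [← hev.pow_abs (w x)]
        exact pow_le_pow_left₀ hN'0.le (le_of_lt hx) _
      · simp only [indicator_of_notMem hx]
        exact hev.pow_nonneg _
    rw [div_pow, le_div_iff₀ (by positivity)]
    exact h1.trans (h i)
  have hlim : Tendsto (fun i : ℕ => (N / N') ^ 2 ^ (i + 1)) atTop (𝓝 0) :=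
    (tendsto_pow_atTop_nhds_zero_of_lt_one (div_nonneg hN hN'0.le)
      ((div_lt_one hN'0).2 hNN')).comp
      ((tendsto_pow_atTop_atTop_of_one_lt one_lt_two).comp (tendsto_add_atTop_nat 1))
  exact absurd (ge_of_tendsto' hlim hle) (not_le.2 hUpos)

/-- The family `v` of functions with gradients `g` satisfies the energy identities of the heat
equation `∂_t v = b Δ v`. -/
structure HeatEnergy (b : ℝ) (v : ℝ → UnitAddTorus ι → ℝ) (g : ℝ → ι → UnitAddTorus ι → ℝ) :
    Prop where
  hasGrad : ∀ t, 0 < t → HasGrad (v t) (g t)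
  mean_zero : ∀ t, 0 < t → ∫ z, v t z = 0
  hasDerivAt : ∀ n : ℕ, ∀ t, 0 < t → HasDerivAt (fun s => ∫ z, v s z ^ (2 * (n + 1)))
    (-(b * ((2 * n + 2) * (2 * n + 1)) * ∫ z, v t z ^ (2 * n) * ∑ i, g t i z ^ 2)) t

variable {b : ℝ} {v : ℝ → UnitAddTorus ι → ℝ} {g : ℝ → ι → UnitAddTorus ι → ℝ}

lemma HasGrad.pow_succ {w : UnitAddTorus ι → ℝ} {g : ι → UnitAddTorus ι → ℝ} (h : HasGrad w g)
    (n : ℕ) : HasGrad (fun z => w z ^ (n + 1)) (fun i z => ((n + 1 : ℕ) * w z ^ n) * g i z) :=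
  h.comp (Ψ := fun x => x ^ (n + 1)) (Ψ' := fun x => (n + 1 : ℕ) * x ^ n)
    (fun z => by simpa using hasDerivAt_pow (n + 1) (w z)) (continuous_const.mul (h.cont.pow n))

/-- Since `(2n + 2)(2n + 1) ≥ 2 (n + 1)²`, the dissipation dominates `2 b ∫ |∇(w ^ (n + 1))|²`.
Nash's inequality can thus be applied to `w ^ (n + 1)` with constants independent of `n`. -/
lemma neg_integral_pow_mul_le {w : UnitAddTorus ι → ℝ} {g : ι → UnitAddTorus ι → ℝ} (hb : 0 ≤ b)
    (n : ℕ) :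
    -(b * ((2 * n + 2) * (2 * n + 1)) * ∫ z, w z ^ (2 * n) * ∑ i, g i z ^ 2) ≤
      -(2 * b * ∫ z, ∑ i, (((n + 1 : ℕ) * w z ^ n) * g i z) ^ 2) := by
  have e : ∫ z, ∑ i, (((n + 1 : ℕ) * w z ^ n) * g i z) ^ 2 =
      (n + 1) ^ 2 * ∫ z, w z ^ (2 * n) * ∑ i, g i z ^ 2 := by
    rw [← integral_const_mul]
    congr 1; ext z
    rw [Finset.mul_sum, Finset.mul_sum]
    refine Finset.sum_congr rfl fun i _ => ?_
    push_cast
    rw [mul_comm 2 n, pow_mul]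
    ring
  rw [e]
  have hI : 0 ≤ ∫ z, w z ^ (2 * n) * ∑ i, g i z ^ 2 := integral_nonneg fun z =>
    mul_nonneg ((even_two_mul n).pow_nonneg _) (Finset.sum_nonneg fun i _ => sq_nonneg _)
  have h1 : 2 * b * (n + 1 : ℝ) ^ 2 ≤ b * ((2 * n + 2) * (2 * n + 1)) := by
    have : (0 : ℝ) ≤ n := Nat.cast_nonneg n
    nlinarith [mul_nonneg hb this, mul_nonneg (mul_nonneg hb this) this]
  nlinarith [mul_le_mul_of_nonneg_right h1 hI]

/-- Grönwall with the Poincaré inequality for mean-zero functions: the rate is `2 b · 4 π²`. -/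
lemma HeatEnergy.integral_sq_le (h : HeatEnergy b v g) (hb : 0 ≤ b) {s t : ℝ} (hs : 0 < s)
    (hst : s ≤ t) :
    ∫ z, v t z ^ 2 ≤ (∫ z, v s z ^ 2) * Real.exp (-(8 * Real.pi ^ 2 * b) * (t - s)) := by
  set ϑ := 8 * Real.pi ^ 2 * b with hϑ
  have hd : ∀ t ∈ Ioi (0 : ℝ), HasDerivAt (fun t => (∫ z, v t z ^ 2) * Real.exp (ϑ * t))
      (-(2 * b * ∫ z, ∑ i, g t i z ^ 2) * Real.exp (ϑ * t) +
        (∫ z, v t z ^ 2) * (Real.exp (ϑ * t) * ϑ)) t := fun t ht => by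
    have h1 := h.hasDerivAt 0 t ht
    simp only [mul_zero, pow_zero, one_mul, zero_add, mul_one, Nat.cast_zero] at h1
    have h2 : HasDerivAt (fun t => Real.exp (ϑ * t)) (Real.exp (ϑ * t) * ϑ) t := by
      simpa using ((hasDerivAt_id t).const_mul ϑ).exp
    refine (h1.mul h2).congr_deriv ?_
    ring
  have hneg : ∀ t ∈ Ioi (0 : ℝ), -(2 * b * ∫ z, ∑ i, g t i z ^ 2) * Real.exp (ϑ * t) +
        (∫ z, v t z ^ 2) * (Real.exp (ϑ * t) * ϑ) ≤ 0 := fun t ht => by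
    have h1 := (h.hasGrad t ht).poincare
    rw [h.mean_zero t ht] at h1
    have h2 : (∫ z, v t z ^ 2) * ϑ ≤ 2 * b * ∫ z, ∑ i, g t i z ^ 2 := by
      have hϑ0 : 0 ≤ ϑ := by positivity
      refine (mul_le_mul_of_nonneg_right h1 hϑ0).trans_eq ?_
      rw [hϑ]; field_simp; ring
    nlinarith [mul_le_mul_of_nonneg_right h2 (Real.exp_pos (ϑ * t)).le]
  have h1 := antitoneOn_of_hasDerivAt_nonpos (convex_Ioi 0) hd hneg hs
    (show t ∈ Ioi (0 : ℝ) from hs.trans_le hst) hst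
  simp only at h1
  have e : Real.exp (-ϑ * (t - s)) = Real.exp (ϑ * s) * (Real.exp (ϑ * t))⁻¹ := by
    rw [← Real.exp_neg, ← Real.exp_add]; congr 1; ring
  rw [e, ← mul_assoc, ← div_eq_mul_inv, le_div_iff₀ (Real.exp_pos _)]
  exact h1

/-- One step of the iteration. -/
lemma HeatEnergy.integral_pow_le [Nonempty ι] (h : HeatEnergy b v g) (hb : 0 < b) (n : ℕ)
    {A s τ Q : ℝ} (hs : 0 < s) (hτ : 0 < τ) (hA : 0 < A) (hQ : 1 ≤ Q)
    (hQτ : 1 ≤ Q ^ (2 / (Fintype.card ι : ℝ)) * (2 * b * (2 / (Fintype.card ι : ℝ)) * τ))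
    (hvA : ∀ t, s ≤ t → ∫ z, |v t z| ^ (n + 1) ≤ A) :
    ∫ z, v (s + τ) z ^ (2 * (n + 1)) ≤ 2 * A ^ 2 * Q := by
  set α : ℝ := 2 / (Fintype.card ι : ℝ) with hα
  have hα0 : 0 < α := by
    have : (0 : ℝ) < Fintype.card ι := by exact_mod_cast Fintype.card_pos
    positivity
  set Y : ℝ → ℝ := fun t => ∫ z, v t z ^ (2 * (n + 1)) with hY
  have hA2 : 0 < 2 * A ^ 2 := by positivity
  have hYsq : ∀ t, Y t = ∫ z, (v t z ^ (n + 1)) ^ 2 := fun t => by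
    simp only [hY, ← pow_mul, mul_comm]
  suffices hZ : Y (s + τ) / (2 * A ^ 2) ≤ Q by
    rw [div_le_iff₀ hA2] at hZ
    linarith
  by_contra! hlt
  -- In terms of `Z = Y / (2 A²)`, Nash's inequality reads `Z' ≤ -2 b Z ^ (1 + α)` as long as `Z ≥
  -- 1`; `hQτ` says that after time `τ` such a `Z` is at most `Q`.
  have h1 := rpow_mul_le_one_of_deriv_le (Z := fun t => Y t / (2 * A ^ 2)) (b := 2 * b)
    (α := α) (s := s) (τ := τ) hα0 hτ
    (fun t ht => (h.hasDerivAt n t (hs.trans_le ht.1)).div_const _)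
    (fun t ht => by
      refine div_nonpos_of_nonpos_of_nonneg ?_ hA2.le
      refine (neg_integral_pow_mul_le hb.le n).trans (neg_nonpos.2 ?_)
      exact mul_nonneg (by positivity) (integral_nonneg fun z =>
        Finset.sum_nonneg fun i _ => sq_nonneg _))
    (fun t ht hZt => by
      have ht0 := hs.trans_le ht.1
      refine (div_le_div_of_nonneg_right (neg_integral_pow_mul_le hb.le n) hA2.le).trans ?_
      rw [le_div_iff₀ hA2] at hZt
      have h2 := ((h.hasGrad t ht0).pow_succ n).nash hA
        (by simpa only [abs_pow] using hvA t ht.1) (by rw [← hYsq]; linarith)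
      rw [← hYsq] at h2
      rw [neg_div, neg_le_neg_iff, le_div_iff₀ hA2]
      calc 2 * b * (Y t / (2 * A ^ 2) * (Y t / (2 * A ^ 2)) ^ α) * (2 * A ^ 2)
          = 2 * b * (Y t * (Y t / (2 * A ^ 2)) ^ α) := by field_simp
        _ ≤ _ := mul_le_mul_of_nonneg_left h2 (by positivity))
    (hQ.trans hlt.le)
  have h2 : Q ^ α < (Y (s + τ) / (2 * A ^ 2)) ^ α :=
    Real.rpow_lt_rpow (by linarith) hlt hα0
  have h3 : 0 < 2 * b * α * τ := by positivity
  have h4 := mul_lt_mul_of_pos_right h2 h3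
  linarith

/-- The supremum norm at time `t + 1` is controlled by the `L²` norm at time `t`. -/
lemma HeatEnergy.exists_abs_le [Nonempty ι] (h : HeatEnergy b v g) (hb : 0 < b) :
    ∃ P : ℝ, 0 < P ∧ ∀ t η : ℝ, 0 < t → 0 < η → ∫ z, v t z ^ 2 ≤ η ^ 2 →
      ∀ z, |v (t + 1) z| ≤ P * η := by
  set α : ℝ := 2 / (Fintype.card ι : ℝ) with hα
  have hα0 : 0 < α := by
    have : (0 : ℝ) < Fintype.card ι := by exact_mod_cast Fintype.card_pos
    positivity
  -- `2 ≤ P ^ α` compensates the halving of the time step at each stage; the last condition covers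
  -- the remaining constant.
  obtain ⟨P, hP2, hPα, hPb⟩ : ∃ P : ℝ, 2 ≤ P ∧ 2 ≤ P ^ α ∧ 1 ≤ (P / 2) ^ α * (2 * b * α) := by
    have h1 := tendsto_rpow_atTop hα0
    have h2 : Tendsto (fun P : ℝ => (P / 2) ^ α * (2 * b * α)) atTop atTop :=
      (h1.comp (tendsto_id.atTop_div_const two_pos)).atTop_mul_const (by positivity)
    exact ((eventually_ge_atTop 2).and
      ((h1.eventually_ge_atTop 2).and (h2.eventually_ge_atTop 1))).exists
  have hP0 : 0 < P := by linarith
  refine ⟨P ^ 2, by positivity, fun t η ht hη hL2 => ?_⟩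
  -- The times `t + 1 - 2^{-i}` accumulate at `t + 1` while the exponents double. The factor `P ^ (i
  -- + 3)` closes the induction: the step costs `Q = P ^ (i + 2) / 2`, and `(i + 4) + (i + 2) = 2 (i
  -- + 3)`.
  have claim : ∀ i : ℕ, ∀ s, t + 1 - (1 / 2) ^ i ≤ s →
      P ^ (i + 3) * ∫ z, v s z ^ 2 ^ (i + 1) ≤ (P ^ 2 * η) ^ 2 ^ (i + 1) := by
    intro i
    induction i with
    | zero =>
      intro s hs
      have hts : t ≤ s := by simpa using hs
      have h1 := h.integral_sq_le hb.le ht hts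
      have h2 : Real.exp (-(8 * Real.pi ^ 2 * b) * (s - t)) ≤ 1 :=
        Real.exp_le_one_iff.2 (by
          have : 0 ≤ 8 * Real.pi ^ 2 * b * (s - t) := mul_nonneg (by positivity) (by linarith)
          linarith)
      have h3 : 0 ≤ ∫ z, v t z ^ 2 := integral_nonneg fun z => sq_nonneg _
      have h4 : ∫ z, v s z ^ 2 ≤ η ^ 2 := by nlinarith
      simp only [zero_add, pow_one]
      calc P ^ 3 * ∫ z, v s z ^ 2 ≤ P ^ 3 * η ^ 2 :=
            mul_le_mul_of_nonneg_left h4 (by positivity)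
        _ ≤ P ^ 4 * η ^ 2 := by gcongr <;> linarith
        _ = _ := by ring
    | succ i ih =>
      intro s hs
      have hτ : (0 : ℝ) < (1 / 2) ^ (i + 1) := by positivity
      have hpow1 : ((1 : ℝ) / 2) ^ (i + 1) ≤ 1 / 2 := by
        rw [pow_succ]
        have : ((1 : ℝ) / 2) ^ i ≤ 1 := pow_le_one₀ (by norm_num) (by norm_num)
        linarith
      have hdb : ((1 : ℝ) / 2) ^ i = 2 * (1 / 2) ^ (i + 1) := by rw [pow_succ]; ring
      set s' := s - (1 / 2) ^ (i + 1) with hs'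
      have hs'1 : t + 1 - (1 / 2) ^ i ≤ s' := by rw [hs', hdb]; linarith
      have hs'0 : 0 < s' := by rw [hs']; linarith
      set A := (P ^ 2 * η) ^ 2 ^ (i + 1) / P ^ (i + 3) with hA
      have hA0 : 0 < A := by positivity
      obtain ⟨n, hn⟩ : ∃ n, 2 ^ (i + 1) = n + 1 :=
        ⟨2 ^ (i + 1) - 1, (Nat.sub_add_cancel Nat.one_le_two_pow).symm⟩
      have hev : Even (2 ^ (i + 1)) := (Nat.even_pow.2 ⟨even_two, by simp⟩)
      have h1 := h.integral_pow_le hb n (A := A) (s := s') (τ := (1 / 2) ^ (i + 1))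
        (Q := P ^ (i + 2) / 2) hs'0 hτ hA0
        (by
          have : P ≤ P ^ (i + 2) := le_self_pow₀ (by linarith) (by omega)
          linarith)
        (by
          have e : (P ^ (i + 2) / 2) ^ α = (P ^ α) ^ (i + 1) * (P / 2) ^ α := by
            rw [← Real.rpow_natCast (P ^ α), ← Real.rpow_mul hP0.le, mul_comm α,
              Real.rpow_mul hP0.le, Real.rpow_natCast,
              ← Real.mul_rpow (by positivity) (by positivity)]
            congr 1; ring
          rw [e]
          have h2 : (2 : ℝ) ^ (i + 1) ≤ (P ^ α) ^ (i + 1) := pow_le_pow_left₀ (by norm_num) hPα _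
          have h3 : (2 : ℝ) ^ (i + 1) * (1 / 2) ^ (i + 1) = 1 := by rw [← mul_pow]; norm_num
          calc (1 : ℝ) = 2 ^ (i + 1) * (1 / 2) ^ (i + 1) * 1 := by rw [h3, one_mul]
            _ ≤ (P ^ α) ^ (i + 1) * (1 / 2) ^ (i + 1) * ((P / 2) ^ α * (2 * b * α)) := by
              gcongr
            _ = _ := by ring)
        (fun s'' hs'' => by
          have h2 := ih s'' (hs'1.trans hs'')
          rw [hA, le_div_iff₀ (by positivity), mul_comm]
          rw [hn] at h2 hev ⊢
          simpa only [hev.pow_abs] using h2)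
      rw [show s' + (1 / 2) ^ (i + 1) = s by rw [hs']; ring, ← hn] at h1
      have e2 : 2 ^ (i + 1 + 1) = 2 * 2 ^ (i + 1) := by ring
      rw [e2]
      calc P ^ (i + 1 + 3) * ∫ z, v s z ^ (2 * 2 ^ (i + 1))
          ≤ P ^ (i + 1 + 3) * (2 * A ^ 2 * (P ^ (i + 2) / 2)) :=
            mul_le_mul_of_nonneg_left h1 (by positivity)
        _ = (A * P ^ (i + 3)) ^ 2 := by ring
        _ = ((P ^ 2 * η) ^ 2 ^ (i + 1)) ^ 2 := by
            rw [hA, div_mul_cancel₀ _ (by positivity)]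
        _ = _ := by rw [← pow_mul, mul_comm (2 ^ (i + 1)) 2]
  refine abs_le_of_integral_pow_le (h.hasGrad (t + 1) (by linarith)).cont (by positivity)
    fun i => ?_
  have h1 := claim i (t + 1) (by
    have : (0 : ℝ) < (1 / 2) ^ i := by positivity
    linarith)
  refine le_trans ?_ h1
  have hev : Even (2 ^ (i + 1)) := (Nat.even_pow.2 ⟨even_two, by simp⟩)
  exact le_mul_of_one_le_left (integral_nonneg fun z => hev.pow_nonneg _)
    (one_le_pow₀ (by linarith))

/-- Exponential decay in the supremum norm. -/
lemma HeatEnergy.exists_abs_le_exp [Nonempty ι] (h : HeatEnergy b v g) (hb : 0 < b) :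
    ∃ C c : ℝ, 0 < C ∧ 0 < c ∧ ∀ t, 2 ≤ t → ∀ z, |v t z| ≤ C * Real.exp (-c * t) := by
  obtain ⟨P, hP, hPv⟩ := h.exists_abs_le hb
  set y := ∫ z, v 1 z ^ 2 with hy
  have hy0 : 0 ≤ y := integral_nonneg fun z => sq_nonneg _
  set c := 4 * Real.pi ^ 2 * b with hc
  have hc0 : 0 < c := by have := Real.pi_pos; positivity
  refine ⟨P * ((y + 1) * Real.exp (2 * c)), c, by positivity, hc0, fun t ht z => ?_⟩
  -- The energy decays from time `1` to `t - 1`, and the last unit of time serves for smoothing.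
  -- Using `y + 1` rather than the square root of `y` keeps `η` positive even if `y = 0`.
  have h1 := hPv (t - 1) ((y + 1) * Real.exp (-c * (t - 2))) (by linarith) (by positivity) (by
    have h2 := h.integral_sq_le hb.le one_pos (show 1 ≤ t - 1 by linarith)
    refine h2.trans ?_
    rw [mul_pow, ← Real.exp_nat_mul]
    have e : ((2 : ℕ) : ℝ) * (-c * (t - 2)) = -(8 * Real.pi ^ 2 * b) * (t - 1 - 1) := by
      rw [hc]; push_cast; ring
    rw [e]
    refine mul_le_mul_of_nonneg_right ?_ (Real.exp_pos _).le
    change y ≤ _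
    nlinarith) z
  rw [sub_add_cancel] at h1
  refine h1.trans_eq ?_
  have e : Real.exp (-c * (t - 2)) = Real.exp (2 * c) * Real.exp (-c * t) := by
    rw [← Real.exp_add]; congr 1; ring
  rw [e]; ring

end Decay

/-! ### Solutions: regularity in time and decay of the marginal -/

section Solution

variable {m k : ℕ} {alg : Algorithm} {β : ℝ} {F : Force m k}

/-- With `v = u - 1`, the equation of the marginal `u` is tested with `v ^ (2n + 1)`. The transport
term pairs `B - G` with a multiple of `u v ^ (2n) ∇v = (v ^ (2n + 1) + v ^ (2n)) ∇v`, which is a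
gradient, and so vanishes for both algorithms. -/
lemma integral_marginal_mul_pow (hF : TorusContDiff 1 F) {a r : State m k → ℝ} {B : Bias m}
    {ga : Fin m ⊕ Fin k → State m k → ℝ} (ha : HasGrad a ga) (ha0 : ∀ z, 0 ≤ a z)
    (hB : IsBias alg F a B) (hr : Continuous r)
    (hw : ∀ φ : State m k → ℝ, TorusContDiff ∞ φ →
      ∫ z, generator β F B φ z * a z = ∫ z, r z * φ z) (n : ℕ) :
    ∫ x, marginal r x * (marginal a x - 1) ^ (2 * n + 1) =
      -(β⁻¹ * (2 * n + 1) * ∫ x, (marginal a x - 1) ^ (2 * n) *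
        ∑ j, marginal (ga (Sum.inl j)) x ^ 2) := by
  have hBm := hB.memLp hF ha.cont ha0
  have hG := memLp_meanForce hF ha.cont ha0
  have hu := ha.marginal
  have hv : HasGrad (fun x => marginal a x - 1) (fun j => marginal (ga (Sum.inl j))) := by
    simpa using hu.sub (HasGrad.const (ι := Fin m) 1)
  have hW1 : ∀ j, MemLp (fun x => marginal a x * (B x j - meanForce F a x j)) 2 volume :=
    fun j => memLp_continuous_mul hu.cont ((hBm j).sub (hG j))
  have hW : ∀ j, MemLp (fun x => marginal a x * (B x j - meanForce F a x j) -
      β⁻¹ * marginal (ga (Sum.inl j)) x) 2 volume :=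
    fun j => (hW1 j).sub (memLp_of_continuous (continuous_const.mul (hu.cont_grad j)))
  have t1 := (hv.pow_succ (2 * n)).h1C.integral_test hW
    (memLp_of_continuous (continuous_marginal hr)) fun φ hφ => by
      rw [← marginal_equation hF ha.cont ha0 hBm hr hw hφ, hu.integral_laplacian hφ, mul_neg,
        ← integral_const_mul, ← integral_neg, ← integral_add]
      · congr 1; ext x
        rw [Finset.mul_sum, ← Finset.sum_neg_distrib, ← Finset.sum_add_distrib]
        exact Finset.sum_congr rfl fun j _ => by ring
      · exact ((integrable_finsetSum _ fun j _ => integrable_mul_of_memLp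
          (memLp_of_continuous (hu.cont_grad j)) (hφ.memLp_pderiv j)).const_mul _).neg
      · exact integrable_finsetSum _ fun j _ => integrable_mul_of_memLp (hW1 j) (hφ.memLp_pderiv j)
  have hΨ := hv.comp (Ψ := fun y => y ^ (2 * n + 2) / (2 * n + 2 : ℕ) +
      y ^ (2 * n + 1) / (2 * n + 1 : ℕ)) (Ψ' := fun y => y ^ (2 * n + 1) + y ^ (2 * n))
    (fun x => by
      have h1 := (hasDerivAt_pow (2 * n + 2) (marginal a x - 1)).div_const ((2 * n + 2 : ℕ) : ℝ)
      have h2 := (hasDerivAt_pow (2 * n + 1) (marginal a x - 1)).div_const ((2 * n + 1 : ℕ) : ℝ)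
      have h3 : ((2 * n + 2 : ℕ) : ℝ) ≠ 0 := by positivity
      have h4 : ((2 * n + 1 : ℕ) : ℝ) ≠ 0 := by positivity
      rw [mul_div_cancel_left₀ _ h3] at h1
      rw [mul_div_cancel_left₀ _ h4] at h2
      exact h1.add h2)
    ((hv.cont.pow _).add (hv.cont.pow _))
  have t2 := hΨ.h1C.integral_test (W := fun j x => meanForce F a x j - B x j) (r := fun _ => 0)
    (fun j => (hG j).sub (hBm j)) (memLp_const 0)
    (fun φ hφ => by simpa using hB.orthogonal hF ha.cont ha0 hφ)
  simp only [zero_mul, integral_zero] at t2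
  have iS : Integrable fun x => (marginal a x - 1) ^ (2 * n) *
      ∑ j, marginal (ga (Sum.inl j)) x ^ 2 := integrable_of_continuous
    ((hv.cont.pow _).mul (continuous_finsetSum _ fun j _ => (hv.cont_grad j).pow 2))
  have iW := integrable_finsetSum (μ := volume) Finset.univ fun j (_ : j ∈ Finset.univ) =>
    integrable_mul_of_memLp (hW j) ((hv.pow_succ (2 * n)).h1C.memLp j)
  rw [← t1, ← neg_mul, ← integral_const_mul, ← sub_eq_zero, ← integral_sub iW (iS.const_mul _)]
  rw [← neg_eq_zero, ← mul_zero (2 * n + 1 : ℝ), ← t2, ← integral_const_mul, ← integral_neg]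
  congr 1; ext x
  rw [Finset.mul_sum, Finset.mul_sum, Finset.mul_sum, ← Finset.sum_sub_distrib,
    ← Finset.sum_neg_distrib]
  refine Finset.sum_congr rfl fun j _ => ?_
  push_cast
  ring

variable {π : ℝ → State m k → ℝ} {B : ℝ → Bias m}

lemma IsSolution.hasGrad (h : IsSolution alg β F π B) {t : ℝ} (ht : 0 < t) :
    HasGrad (π t) (fun i => pderiv i (π t)) := by
  refine TorusContDiff.hasGrad one_ne_zero ?_
  have h1 : ContDiff ℝ 1 fun u : Fin m ⊕ Fin k → ℝ => (t, u) := by fun_prop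
  have h2 := h.contDiffOn.comp (s := univ) h1.contDiffOn fun u _ => ⟨ht, mem_univ _⟩
  exact contDiffOn_univ.1 h2

/-- The time derivative of a solution. -/
def timeDeriv (π : ℝ → State m k → ℝ) (t : ℝ) (z : State m k) : ℝ := deriv (fun s => π s z) t

lemma IsSolution.differentiableAt (h : IsSolution alg β F π B) {t : ℝ} (ht : 0 < t)
    (u : Fin m ⊕ Fin k → ℝ) :
    DifferentiableAt ℝ (fun q : ℝ × (Fin m ⊕ Fin k → ℝ) => π q.1 (proj q.2)) (t, u) :=
  (h.contDiffOn.differentiableOn one_ne_zero).differentiableAt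
    ((isOpen_Ioi.prod isOpen_univ).mem_nhds ⟨ht, mem_univ _⟩)

lemma IsSolution.hasDerivAt_proj (h : IsSolution alg β F π B) {t : ℝ} (ht : 0 < t)
    (u : Fin m ⊕ Fin k → ℝ) :
    HasDerivAt (fun s => π s (proj u))
      (fderiv ℝ (fun q : ℝ × (Fin m ⊕ Fin k → ℝ) => π q.1 (proj q.2)) (t, u) (1, 0)) t := by
  have h1 : HasDerivAt (fun s : ℝ => (s, u)) ((1 : ℝ), (0 : Fin m ⊕ Fin k → ℝ)) t :=
    (hasDerivAt_id t).prodMk (hasDerivAt_const t u)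
  exact HasFDerivAt.comp_hasDerivAt t (l := fun q : ℝ × (Fin m ⊕ Fin k → ℝ) => π q.1 (proj q.2))
    (h.differentiableAt ht u).hasFDerivAt h1

lemma IsSolution.hasDerivAt (h : IsSolution alg β F π B) {t : ℝ} (ht : 0 < t) (z : State m k) :
    HasDerivAt (fun s => π s z) (timeDeriv π t z) t := by
  obtain ⟨u, rfl⟩ := isOpenQuotientMap_proj.surjective z
  exact (h.hasDerivAt_proj ht u).differentiableAt.hasDerivAt

lemma IsSolution.continuousOn_Ioi (h : IsSolution alg β F π B) :
    ContinuousOn (fun q : ℝ × State m k => π q.1 q.2) (Ioi 0 ×ˢ univ) :=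
  h.continuousOn.mono (prod_mono_left Ioi_subset_Ici_self)

/-- The derivative of the periodic lift is continuous, and continuity descends through the open
quotient map. -/
lemma IsSolution.continuousOn_timeDeriv (h : IsSolution alg β F π B) :
    ContinuousOn (fun q : ℝ × State m k => timeDeriv π q.1 q.2) (Ioi 0 ×ˢ univ) := by
  rintro ⟨t, z⟩ ⟨ht, -⟩
  obtain ⟨u, rfl⟩ := isOpenQuotientMap_proj.surjective z
  refine ContinuousAt.continuousWithinAt ?_
  have hq : IsOpenQuotientMap (Prod.map id proj : ℝ × (Fin m ⊕ Fin k → ℝ) → ℝ × State m k) :=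
    IsOpenQuotientMap.id.prodMap isOpenQuotientMap_proj
  refine (hq.continuousAt_comp_iff (x := (t, u))).1 ?_
  have hU : IsOpen (Ioi (0 : ℝ) ×ˢ (univ : Set (Fin m ⊕ Fin k → ℝ))) :=
    isOpen_Ioi.prod isOpen_univ
  have h1 : ContinuousAt (fun q => fderiv ℝ
      (fun q : ℝ × (Fin m ⊕ Fin k → ℝ) => π q.1 (proj q.2)) q (1, 0)) (t, u) :=
    ((h.contDiffOn.continuousOn_fderiv_of_isOpen hU le_rfl).continuousAt
      (hU.mem_nhds ⟨ht, mem_univ _⟩)).clm_apply continuousAt_const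
  refine h1.congr ?_
  filter_upwards [hU.mem_nhds (show (t, u) ∈ _ from ⟨ht, mem_univ _⟩)] with q hq
  exact (h.hasDerivAt_proj hq.1 q.2).deriv.symm

lemma continuous_of_continuousOn_prod {X : Type*} [TopologicalSpace X] {G : ℝ → X → ℝ}
    {S : Set ℝ} (hG : ContinuousOn (fun q : ℝ × X => G q.1 q.2) (S ×ˢ univ)) {t : ℝ} (ht : t ∈ S) :
    Continuous (G t) :=
  hG.comp_continuous (f := fun x : X => (t, x)) (by fun_prop) fun _ => ⟨ht, mem_univ _⟩

/-- At fixed `t` the equation becomes a stationary one with source `timeDeriv π t`, so solutions and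
stationary states (source zero) share the same lemmas. -/
lemma IsSolution.equation' (h : IsSolution alg β F π B) {t : ℝ} (ht : 0 < t)
    {φ : State m k → ℝ} (hφ : TorusContDiff ∞ φ) :
    ∫ z, generator β F (B t) φ z * π t z = ∫ z, timeDeriv π t z * φ z := by
  have hφc : ContinuousOn (fun q : ℝ × State m k => φ q.2) (Ioi 0 ×ˢ univ) :=
    (hφ.continuous.comp continuous_snd).continuousOn
  have h1 := hasDerivAt_integral_of_continuousOn (μ := (volume : Measure (State m k))) isOpen_Ioi
    (F := fun s z => φ z * π s z)
    (F' := fun s z => φ z * timeDeriv π s z) (hφc.mul h.continuousOn_Ioi)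
    (hφc.mul h.continuousOn_timeDeriv) (fun s hs z => (h.hasDerivAt hs z).const_mul (φ z)) ht
  rw [(h.equation t ht φ hφ).unique h1]
  simp only [mul_comm]

lemma continuousOn_marginal {G : ℝ → State m k → ℝ} {S : Set ℝ}
    (hG : ContinuousOn (fun q : ℝ × State m k => G q.1 q.2) (S ×ˢ univ)) :
    ContinuousOn (fun q : ℝ × UnitAddTorus (Fin m) => marginal (G q.1) q.2) (S ×ˢ univ) := by
  refine continuousOn_integral_right
    (f := fun (q : ℝ × UnitAddTorus (Fin m)) (y : UnitAddTorus (Fin k)) =>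
      G q.1 (Sum.elim q.2 y)) ?_
  refine hG.comp (f := fun w : (ℝ × UnitAddTorus (Fin m)) × UnitAddTorus (Fin k) =>
    (w.1.1, (Sum.elim w.1.2 w.2 : State m k))) ?_ fun w hw => ⟨hw.1.1, mem_univ _⟩
  refine Continuous.continuousOn (Continuous.prodMk (by fun_prop) ?_)
  exact continuous_elim.comp (Continuous.prodMk (by fun_prop) continuous_snd)

lemma IsSolution.hasDerivAt_marginal (h : IsSolution alg β F π B) {t : ℝ} (ht : 0 < t)
    (x : UnitAddTorus (Fin m)) :
    HasDerivAt (fun s => marginal (π s) x) (marginal (timeDeriv π t) x) t := by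
  have hc : Continuous fun q : ℝ × UnitAddTorus (Fin k) => (q.1, (Sum.elim x q.2 : State m k)) :=
    Continuous.prodMk continuous_fst ((continuous_elim_right x).comp continuous_snd)
  exact hasDerivAt_integral_of_continuousOn (μ := (volume : Measure (UnitAddTorus (Fin k))))
    isOpen_Ioi (F := fun s y => π s (Sum.elim x y)) (F' := fun s y => timeDeriv π s (Sum.elim x y))
    (h.continuousOn_Ioi.comp hc.continuousOn fun q hq => ⟨hq.1, mem_univ _⟩)
    (h.continuousOn_timeDeriv.comp hc.continuousOn fun q hq => ⟨hq.1, mem_univ _⟩)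
    (fun s hs y => h.hasDerivAt hs _) ht

/-- The marginal density satisfies the energy identities of the heat equation. -/
lemma IsSolution.heatEnergy (hF : TorusContDiff 1 F) (h : IsSolution alg β F π B) :
    HeatEnergy β⁻¹ (fun t x => marginal (π t) x - 1)
      (fun t j => marginal (pderiv (Sum.inl j) (π t))) := by
  refine ⟨fun t ht => ?_, fun t ht => ?_, fun n t ht => ?_⟩
  · simpa using (h.hasGrad ht).marginal.sub (HasGrad.const (ι := Fin m) 1)
  · have hc := (h.hasGrad ht).cont
    rw [integral_sub (integrable_of_continuous (continuous_marginal hc)) (integrable_const _),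
      integral_marginal hc, h.mass t ht.le]
    simp
  · have hu := continuousOn_marginal h.continuousOn_Ioi
    have hd := continuousOn_marginal h.continuousOn_timeDeriv
    have h1 := hasDerivAt_integral_of_continuousOn
      (μ := (volume : Measure (UnitAddTorus (Fin m)))) isOpen_Ioi
      (F := fun s x => (marginal (π s) x - 1) ^ (2 * (n + 1)))
      (F' := fun s x => ((2 * (n + 1) : ℕ) : ℝ) * (marginal (π s) x - 1) ^ (2 * n + 1) *
        marginal (timeDeriv π s) x)
      ((hu.sub continuousOn_const).pow _)
      ((continuousOn_const.mul ((hu.sub continuousOn_const).pow _)).mul hd)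
      (fun s hs x => ((h.hasDerivAt_marginal hs x).sub_const 1).fun_pow (2 * (n + 1))) ht
    refine h1.congr_deriv ?_
    have h2 := integral_marginal_mul_pow (β := β) hF (h.hasGrad ht) (h.nonneg t ht.le)
      (h.bias t ht.le) (continuous_of_continuousOn_prod h.continuousOn_timeDeriv ht)
      (fun φ hφ => h.equation' ht hφ) n
    have e : ∀ x, ((2 * (n + 1) : ℕ) : ℝ) * (marginal (π t) x - 1) ^ (2 * n + 1) *
        marginal (timeDeriv π t) x = ((2 * (n + 1) : ℕ) : ℝ) *
        (marginal (timeDeriv π t) x * (marginal (π t) x - 1) ^ (2 * n + 1)) := fun x => by ring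
    simp only [e]
    rw [integral_const_mul, h2]
    push_cast
    ring

end Solution

/-! ### Convergence and uniqueness -/

section Main

variable {m k : ℕ} {alg : Algorithm} {β : ℝ} {F : Force m k} {M : ℝ≥0}
  {p : State m k → ℝ} {Bp : Bias m} {R ρ : ℝ}

/-- With `μ = M / ρ` and marginals between `1 - δ` and `1 + δ`, this produces an admissible Young
weight that exceeds `μ` only linearly in `δ + ε`. -/
lemma one_add_mul_le {μ δ ε : ℝ} (hμ : 0 ≤ μ) (hδ : 0 ≤ δ) (hδ' : δ ≤ 1 / 8) (hε : 0 ≤ ε) :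
    (1 + δ + ε) * μ ≤ (μ + (4 * μ + 1) * (δ + ε)) * (1 - δ) := by
  nlinarith [mul_nonneg hμ hδ, mul_nonneg hμ hε, mul_nonneg (mul_nonneg hμ hδ) hε,
    mul_nonneg hδ hε, mul_nonneg hδ (sub_nonneg.2 hδ'), mul_nonneg hε (sub_nonneg.2 hδ'),
    mul_nonneg (mul_nonneg hμ hδ) (sub_nonneg.2 hδ'),
    mul_nonneg (mul_nonneg hμ hε) (sub_nonneg.2 hδ')]

/-- Dissipation when the marginal of `a` is uniformly close to `1`. -/
lemma integral_mul_log_le_of_marginal (hF : TorusContDiff 1 F) (hM : IsLipschitzInY F M)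
    (hp : IsStationaryState alg β F p Bp) (hp0 : ∀ z, 0 < p z) (hp1 : ∀ x, marginal p x = 1)
    (hρ : 0 < ρ) (hL : ∀ x, SatisfiesLSI (conditional p x) ρ)
    {a r : State m k → ℝ} {B : Bias m} {ga gp : Fin m ⊕ Fin k → State m k → ℝ} (hpg : H1C p gp)
    (ha : H1C a ga) (ha0 : ∀ z, 0 ≤ a z) (hB : IsBias alg F a B) (hr : Continuous r)
    (hw : ∀ φ : State m k → ℝ, TorusContDiff ∞ φ →
      ∫ z, generator β F B φ z * a z = ∫ z, r z * φ z)
    {ε δ : ℝ} (hε : 0 < ε) (hδ : 0 ≤ δ) (hδ' : δ ≤ 1 / 8)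
    (hu : ∀ x, |marginal a x - 1| ≤ δ) :
    ∫ z, r z * Real.log (a z / p z + ε) ≤
      -(β⁻¹ - M / ρ / 2 - (4 * (M / ρ) + 1) / 2 * (δ + ε)) *
        ∫ z, (∑ i, ((ga i z - a z / p z * gp i z) / p z) ^ 2) / (a z / p z + ε) * p z := by
  have hμ : 0 ≤ (M : ℝ) / ρ := by positivity
  have h := integral_mul_log_le hF hM hp hp0 hp1 hρ hL hpg ha ha0 hB hr hw hε
    (c := 1 - δ) (C := 1 + δ) (κ := M / ρ + (4 * (M / ρ) + 1) * (δ + ε)) (by linarith)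
    (fun x => by linarith [(abs_le.1 (hu x)).1]) (fun x => by linarith [(abs_le.1 (hu x)).2])
    (by positivity) (by
      have h1 := mul_le_mul_of_nonneg_right (one_add_mul_le hμ hδ hδ' hε.le) hρ.le
      have h2 : (1 + δ + ε) * (M / ρ) * ρ = (1 + δ + ε) * M := by field_simp
      rw [h2] at h1
      exact h1) rfl
  refine h.trans_eq ?_
  ring

lemma fisher_nonneg {ι : Type} [Fintype ι] {f p : UnitAddTorus ι → ℝ}
    {g : ι → UnitAddTorus ι → ℝ} (hf : ∀ z, 0 < f z) (hp : ∀ z, 0 < p z) :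
    0 ≤ ∫ z, (∑ i, g i z ^ 2) / f z * p z :=
  integral_nonneg fun z => mul_nonneg (div_nonneg (Finset.sum_nonneg fun _ _ => sq_nonneg _)
    (hf z).le) (hp z).le

lemma div_add_pos {ι : Type} {a p : UnitAddTorus ι → ℝ} (ha : ∀ z, 0 ≤ a z) (hp : ∀ z, 0 < p z)
    {ε : ℝ} (hε : 0 < ε) (z : UnitAddTorus ι) : 0 < a z / p z + ε :=
  add_pos_of_nonneg_of_pos (div_nonneg (ha z) (hp z).le) hε

lemma integral_div_add_mul {ι : Type} [Fintype ι] {a p : UnitAddTorus ι → ℝ} (ha : Continuous a)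
    (ha1 : ∫ z, a z = 1) (hp : Continuous p) (hp0 : ∀ z, 0 < p z) (hp1 : ∫ z, p z = 1) (ε : ℝ) :
    ∫ z, (a z / p z + ε) * p z = 1 + ε := by
  have : ∀ z, (a z / p z + ε) * p z = a z + ε * p z := fun z => by
    rw [add_mul, div_mul_cancel₀ _ (hp0 z).ne']
  simp only [this]
  rw [integral_add (integrable_of_continuous ha)
    (integrable_of_continuous (continuous_const.fun_mul hp)), integral_const_mul, ha1, hp1, mul_one]

lemma H1C.eq_of_fisher_eq_zero {ι : Type} [Fintype ι] [DecidableEq ι] {f p : UnitAddTorus ι → ℝ}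
    {g : ι → UnitAddTorus ι → ℝ} (hf : H1C f g) (hf0 : ∀ z, 0 < f z) (hp : Continuous p)
    (hp0 : ∀ z, 0 < p z) (hI : ∫ z, (∑ i, g i z ^ 2) / f z * p z = 0) (z : UnitAddTorus ι) :
    f z = ∫ z, f z := by
  have hc : Continuous fun z => p z / f z := hp.div hf.cont fun z => (hf0 z).ne'
  have hs : Integrable fun z => ∑ i, g i z ^ 2 :=
    integrable_finsetSum _ fun i _ => integrable_sq (hf.memLp i)
  obtain ⟨K, -, hK⟩ := exists_bound hc
  have hi : Integrable fun z => (∑ i, g i z ^ 2) / f z * p z := by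
    refine (hs.mul_bdd hc.aestronglyMeasurable (ae_of_all _ hK)).congr (ae_of_all _ fun z => ?_)
    simp only; ring
  have h1 := (integral_eq_zero_iff_of_nonneg (fun z => mul_nonneg (div_nonneg
    (Finset.sum_nonneg fun i _ => sq_nonneg _) (hf0 z).le) (hp0 z).le) hi).1 hI
  refine hf.eq_integral_of_integral_sq_eq_zero (fun i => ?_) z
  rw [← integral_zero (UnitAddTorus ι) ℝ (μ := volume)]
  refine integral_congr_ae ?_
  filter_upwards [h1] with z hz
  have h2 : ∑ i, g i z ^ 2 = 0 := by
    have h3 : (∑ i, g i z ^ 2) / f z * p z = 0 := hz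
    simpa [(hf0 z).ne', (hp0 z).ne'] using h3
  exact (Finset.sum_eq_zero_iff_of_nonneg fun i _ => sq_nonneg _).1 h2 i (Finset.mem_univ i)

/-- Uniqueness of the stationary state. -/
lemma IsStationaryState.unique (hβ : 0 < β) (hF : TorusContDiff 1 F) (hM : IsLipschitzInY F M)
    (hp : IsStationaryState alg β F p Bp) (hp0 : ∀ z, 0 < p z) (hρ : 0 < ρ)
    (hL : ∀ x, SatisfiesLSI (conditional p x) ρ) (hMρ : 0 < β⁻¹ - M / ρ / 2)
    {q : State m k → ℝ} {Bq : Bias m} (hq : IsStationaryState alg β F q Bq) :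
    q = p ∧ Bq =ᵐ[volume] Bp := by
  have hqp : q = p := by
    obtain ⟨gp, hpg⟩ := hp.exists_h1C hβ hF
    obtain ⟨gq, hqg⟩ := hq.exists_h1C hβ hF
    set D := (4 * ((M : ℝ) / ρ) + 1) / 2 with hD
    have hD0 : 0 < D := by positivity
    -- The loss `D ε` is then half of the gap, and `δ = 0` because stationary marginals are `1`. The
    -- dissipation inequality, with left-hand side zero, forces the Fisher information to vanish.
    set ε := (β⁻¹ - M / ρ / 2) / (2 * D) with hεd
    have hε : 0 < ε := by positivity
    have hεD : D * ε = (β⁻¹ - M / ρ / 2) / 2 := by rw [hεd]; field_simp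
    have h1 := integral_mul_log_le_of_marginal hF hM hp hp0 (hp.marginal_eq_one hβ hF) hρ hL hpg hqg
      hq.nonneg hq.bias (r := fun _ => 0) continuous_const
      (fun φ hφ => by simpa using hq.equation φ hφ) hε le_rfl (by norm_num)
      (fun x => by simp [hq.marginal_eq_one hβ hF])
    simp only [zero_mul, integral_zero, zero_add] at h1
    have hf0 := div_add_pos hq.nonneg hp0 hε
    have hI0 := fisher_nonneg (g := fun i z => (gq i z - q z / p z * gp i z) / p z) hf0 hp0
    have hI : ∫ z, (∑ i, ((gq i z - q z / p z * gp i z) / p z) ^ 2) / (q z / p z + ε) * p z = 0 := by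
      refine le_antisymm ?_ hI0
      by_contra! hlt
      have := mul_pos (show 0 < β⁻¹ - M / ρ / 2 - D * ε by linarith) hlt
      rw [← hD] at h1
      linarith
    have hf := hqg.div_add hq.nonneg hpg hp0 ε
    have h2 := hf.eq_of_fisher_eq_zero hf0 hp.continuous hp0 hI
    set K := ∫ z, (q z / p z + ε) with hK
    have h3 := integral_div_add_mul hq.continuous hq.mass hp.continuous hp0 hp.mass ε
    simp only [h2] at h3
    rw [integral_const_mul, hp.mass, mul_one] at h3
    ext z
    have h4 := h2 z
    rw [h3] at h4
    have h5 : q z / p z = 1 := by linarith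
    rwa [div_eq_one_iff_eq (hp0 z).ne'] at h5
  refine ⟨hqp, ?_⟩
  subst hqp
  have h1 := IsBias.integral_sq_sub_le hF hq.continuous hq.nonneg hp.continuous hp.nonneg hq.bias
    hp.bias
  simp only [sub_self, ne_eq, OfNat.ofNat_ne_zero, not_false_eq_true, zero_pow,
    Finset.sum_const_zero, integral_zero] at h1
  have hm1 := hq.bias.memLp hF hq.continuous hq.nonneg
  have hm2 := hp.bias.memLp hF hp.continuous hp.nonneg
  have hi : Integrable fun x => ∑ j, (Bq x j - Bp x j) ^ 2 :=
    integrable_finsetSum _ fun j _ => integrable_sq ((hm1 j).sub (hm2 j))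
  have h0 : ∀ x, 0 ≤ ∑ j, (Bq x j - Bp x j) ^ 2 := fun x => Finset.sum_nonneg fun j _ => sq_nonneg _
  have h2 := (integral_eq_zero_iff_of_nonneg h0 hi).1 (le_antisymm h1 (integral_nonneg h0))
  filter_upwards [h2] with x hx
  ext j
  have h3 := (Finset.sum_eq_zero_iff_of_nonneg fun j _ => sq_nonneg _).1 hx j (Finset.mem_univ j)
  exact sub_eq_zero.1 (pow_eq_zero_iff two_ne_zero |>.1 h3)

variable {π : ℝ → State m k → ℝ} {B : ℝ → Bias m}

/-- The regularized relative entropy. -/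
def regEntropy (π : ℝ → State m k → ℝ) (p : State m k → ℝ) (ε t : ℝ) : ℝ :=
  ∫ z, (π t z / p z + ε) * Real.log (π t z / p z + ε) * p z

lemma IsSolution.integral_timeDeriv (h : IsSolution alg β F π B) {t : ℝ} (ht : 0 < t) :
    ∫ z, timeDeriv π t z = 0 := by
  have h1 := hasDerivAt_integral_of_continuousOn (μ := (volume : Measure (State m k))) isOpen_Ioi
    (F := π) (F' := timeDeriv π) h.continuousOn_Ioi h.continuousOn_timeDeriv
    (fun s hs z => h.hasDerivAt hs z) ht
  refine h1.unique ((hasDerivAt_const t (1 : ℝ)).congr_of_eventuallyEq ?_)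
  filter_upwards [Ioi_mem_nhds ht] with s hs using h.mass s (le_of_lt hs)

/-- The integrand has time derivative `∂_t π (log f + 1)`, and the second term integrates to zero by
conservation of mass. -/
lemma IsSolution.hasDerivAt_regEntropy (h : IsSolution alg β F π B) (hp : Continuous p)
    (hp0 : ∀ z, 0 < p z) {ε t : ℝ} (hε : 0 < ε) (ht : 0 < t) :
    HasDerivAt (regEntropy π p ε) (∫ z, timeDeriv π t z * Real.log (π t z / p z + ε)) t := by
  have hpc : ContinuousOn (fun q : ℝ × State m k => p q.2) (Ioi 0 ×ˢ univ) :=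
    (hp.comp continuous_snd).continuousOn
  have hfc : ContinuousOn (fun q : ℝ × State m k => π q.1 q.2 / p q.2 + ε) (Ioi 0 ×ˢ univ) :=
    (h.continuousOn_Ioi.div hpc fun q _ => (hp0 _).ne').add continuousOn_const
  have hf0 : ∀ s ∈ Ioi (0 : ℝ), ∀ z, 0 < π s z / p z + ε := fun s hs z =>
    div_add_pos (h.nonneg s (le_of_lt hs)) hp0 hε z
  have hlog : ContinuousOn (fun q : ℝ × State m k => Real.log (π q.1 q.2 / p q.2 + ε))
      (Ioi 0 ×ˢ univ) := hfc.log fun q hq => (hf0 _ hq.1 _).ne'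
  have h1 := hasDerivAt_integral_of_continuousOn (μ := (volume : Measure (State m k))) isOpen_Ioi
    (F := fun s z => (π s z / p z + ε) * Real.log (π s z / p z + ε) * p z)
    (F' := fun s z => timeDeriv π s z * Real.log (π s z / p z + ε) + timeDeriv π s z)
    ((hfc.mul hlog).mul hpc) ((h.continuousOn_timeDeriv.mul hlog).add h.continuousOn_timeDeriv)
    (fun s hs z => by
      have h2 := ((h.hasDerivAt hs z).div_const (p z)).add_const ε
      have hpos := (hf0 s hs z).ne'
      refine ((h2.mul (h2.log hpos)).mul_const (p z)).congr_deriv ?_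
      rw [mul_div_cancel₀ _ hpos, add_mul, div_mul_cancel₀ _ (hp0 z).ne', mul_right_comm,
        div_mul_cancel₀ _ (hp0 z).ne']) ht
  refine h1.congr_deriv ?_
  have hlc := continuous_of_continuousOn_prod (G := fun s z => Real.log (π s z / p z + ε)) hlog ht
  have hrc := continuous_of_continuousOn_prod h.continuousOn_timeDeriv ht
  rw [integral_add (integrable_of_continuous (hrc.fun_mul hlc)) (integrable_of_continuous hrc),
    h.integral_timeDeriv ht, add_zero]

lemma IsSolution.continuous_apply (h : IsSolution alg β F π B) {t : ℝ} (ht : 0 ≤ t) :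
    Continuous (π t) :=
  continuous_of_continuousOn_prod h.continuousOn ht

lemma continuous_regEntropy {t : ℝ} (hπ : Continuous (π t)) (hp : Continuous p)
    (hp0 : ∀ z, 0 < p z) : Continuous fun ε => regEntropy π p ε t := by
  refine continuous_integral_right
    (f := fun ε z => (π t z / p z + ε) * Real.log (π t z / p z + ε) * p z) ?_
  have h1 : Continuous fun q : ℝ × State m k => π t q.2 / p q.2 + q.1 :=
    ((hπ.comp continuous_snd).div (hp.comp continuous_snd) fun q => (hp0 _).ne').add continuous_fst
  exact (Real.continuous_mul_log.comp h1).mul (hp.comp continuous_snd)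

lemma IsSolution.entropy_eq (h : IsSolution alg β F π B) (hp : Continuous p)
    (hp0 : ∀ z, 0 < p z) (hp1 : ∫ z, p z = 1) {t : ℝ} (ht : 0 ≤ t) :
    entropy (π t) p = ENNReal.ofReal (regEntropy π p 0 t) := by
  have e : π t = fun z => π t z / p z * p z := by
    ext z; rw [div_mul_cancel₀ _ (hp0 z).ne']
  have hc := h.continuous_apply ht
  have h1 := klDiv_law_mul (f := fun z => π t z / p z) (hc.div hp fun z => (hp0 z).ne')
    (fun z => div_nonneg (h.nonneg t ht z) (hp0 z).le) hp hp0 hp1 (by rw [← e]; exact h.mass t ht)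
  rw [← e] at h1
  simpa only [entropy, regEntropy, add_zero] using h1

lemma IsSolution.exists_regEntropy_le (h : IsSolution alg β F π B) (hp : Continuous p)
    (hp0 : ∀ z, 0 < p z) (T : ℝ) :
    ∃ S, 0 ≤ S ∧ ∀ t ∈ Icc 0 T, regEntropy π p 0 t ≤ S := by
  have hpc : ContinuousOn (fun q : ℝ × State m k => p q.2) (Icc 0 T ×ˢ univ) :=
    (hp.comp continuous_snd).continuousOn
  have hπ := h.continuousOn.mono (prod_mono_left (t := univ) (fun t ht => ht.1 : Icc 0 T ⊆ Ici 0))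
  have hfc : ContinuousOn (fun q : ℝ × State m k => π q.1 q.2 / p q.2 + 0) (Icc 0 T ×ˢ univ) :=
    (hπ.div hpc fun q _ => (hp0 _).ne').add continuousOn_const
  have hc := (Real.continuous_mul_log.comp_continuousOn hfc).mul hpc
  obtain ⟨S, hS⟩ := (isCompact_Icc.prod isCompact_univ).exists_bound_of_continuousOn hc
  refine ⟨max S 0, le_max_right _ _, fun t ht => ?_⟩
  have h1 := norm_integral_le_of_norm_le_const (μ := (volume : Measure (State m k)))
    (f := fun z => (π t z / p z + 0) * Real.log (π t z / p z + 0) * p z) (C := S)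
    (ae_of_all _ fun z => hS (t, z) ⟨ht, mem_univ _⟩)
  rw [probReal_univ, mul_one] at h1
  exact (le_abs_self _).trans (h1.trans (le_max_left _ _))

/-- The differential inequality for the regularized entropy, integrated. -/
lemma IsSolution.regEntropy_le (hβ : 0 < β) (hF : TorusContDiff 1 F)
    (hM : IsLipschitzInY F M) (hp : IsStationaryState alg β F p Bp) (hp0 : ∀ z, 0 < p z)
    (hR : 0 < R) (hρ : 0 < ρ) (hLR : SatisfiesLSI p R)
    (hL : ∀ x, SatisfiesLSI (conditional p x) ρ) (h : IsSolution alg β F π B)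
    {C c D ε T : ℝ} (hC : 0 < C) (hc : 0 < c) (hD : D = (4 * (M / ρ) + 1) / 2)
    (hu : ∀ t, T ≤ t → ∀ x, |marginal (π t) x - 1| ≤ C * Real.exp (-c * t)) (hT : 0 < T)
    (hε : 0 < ε) (hCT : C * Real.exp (-c * T) ≤ 1 / 8)
    (hDT : D * (C * Real.exp (-c * T) + ε) ≤ β⁻¹ - M / ρ / 2) {t : ℝ} (ht : T ≤ t) :
    (regEntropy π p ε t - (1 + ε) * Real.log (1 + ε)) *
        Real.exp (2 * R * ((β⁻¹ - M / ρ / 2 - D * ε) * t + D * C / c * Real.exp (-c * t))) ≤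
      (regEntropy π p ε T - (1 + ε) * Real.log (1 + ε)) *
        Real.exp (2 * R * ((β⁻¹ - M / ρ / 2 - D * ε) * T + D * C / c * Real.exp (-c * T))) := by
  obtain ⟨gp, hpg⟩ := hp.exists_h1C hβ hF
  have hp1 := hp.marginal_eq_one hβ hF
  have hD0 : 0 < D := by rw [hD]; positivity
  set lam := β⁻¹ - M / ρ / 2 with hlam
  -- A primitive of the instantaneous rate `2 R (lam - D ε - D C e^{-ct})`. The error due to the
  -- marginal contributes only the bounded term in `e^{-ct}`.
  set Φ : ℝ → ℝ := fun t => 2 * R * ((lam - D * ε) * t + D * C / c * Real.exp (-c * t)) with hΦ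
  -- The shifted density has mass `1 + ε` under `p`, so the log-Sobolev inequality controls the
  -- entropy minus `(1 + ε) log (1 + ε)`.
  set E : ℝ → ℝ := fun t => regEntropy π p ε t - (1 + ε) * Real.log (1 + ε) with hE
  set e' : ℝ → ℝ := fun t => ∫ z, timeDeriv π t z * Real.log (π t z / p z + ε) with he'
  have hΦd : ∀ t, HasDerivAt Φ (2 * R * (lam - D * ε - D * (C * Real.exp (-c * t)))) t := fun t => by
    have h1 : HasDerivAt (fun t => Real.exp (-c * t)) (Real.exp (-c * t) * -c) t := by
      simpa using ((hasDerivAt_id t).const_mul (-c)).exp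
    have h2 : HasDerivAt (fun t => (lam - D * ε) * t) (lam - D * ε) t := by
      simpa using (hasDerivAt_id t).const_mul (lam - D * ε)
    refine ((h2.add (h1.const_mul (D * C / c))).const_mul (2 * R)).congr_deriv ?_
    field_simp
    ring
  have hd : ∀ t ∈ Ici T, HasDerivAt (fun t => E t * Real.exp (Φ t))
      (e' t * Real.exp (Φ t) + E t * (Real.exp (Φ t) *
        (2 * R * (lam - D * ε - D * (C * Real.exp (-c * t)))))) t := fun t ht =>
    ((h.hasDerivAt_regEntropy hp.continuous hp0 hε (hT.trans_le ht)).sub_const _).mul (hΦd t).exp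
  refine antitoneOn_of_hasDerivAt_nonpos (convex_Ici T) hd (fun t ht => ?_)
    (mem_Ici.2 le_rfl) ht ht
  have ht0 : 0 < t := hT.trans_le ht
  set δ := C * Real.exp (-c * t) with hδ
  have hδT : δ ≤ C * Real.exp (-c * T) := by
    refine mul_le_mul_of_nonneg_left (Real.exp_le_exp.2 ?_) hC.le
    nlinarith [mem_Ici.1 ht]
  have hδ0 : 0 ≤ δ := by positivity
  have hg := (h.hasGrad ht0).h1C
  have h0 := h.nonneg t ht0.le
  have hf0 := div_add_pos h0 hp0 hε
  have hdiss := integral_mul_log_le_of_marginal hF hM hp hp0 hp1 hρ hL hpg hg h0 (h.bias t ht0.le)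
    (continuous_of_continuousOn_prod h.continuousOn_timeDeriv ht0)
    (fun φ hφ => h.equation' ht0 hφ) hε hδ0 (hδT.trans hCT) (hu t ht)
  have hlsi := hLR.h1C hR (hg.div_add h0 hpg hp0 ε) hf0 hp.continuous hp0 hp.mass
  rw [integral_div_add_mul hg.cont (h.mass t ht0.le) hp.continuous hp0 hp.mass] at hlsi
  rw [← hD, ← hlam] at hdiss
  set I := ∫ z, (∑ i, ((pderiv i (π t) z - π t z / p z * gp i z) / p z) ^ 2) /
    (π t z / p z + ε) * p z with hI
  have hlsi' : 2 * R * E t ≤ I := by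
    have h1 := mul_le_mul_of_nonneg_left hlsi (show 0 ≤ 2 * R by positivity)
    have h2 : 2 * R * (1 / (2 * R) * I) = I := by field_simp
    rw [h2] at h1
    exact h1
  have hl0 : 0 ≤ lam - D * (δ + ε) := by
    have := mul_le_mul_of_nonneg_left (add_le_add_left hδT ε) hD0.le
    linarith
  have h3 : e' t + E t * (2 * R * (lam - D * ε - D * δ)) ≤ 0 := by
    have h4 := mul_le_mul_of_nonneg_left hlsi' hl0
    have h5 : e' t ≤ -(lam - D * (δ + ε)) * I := hdiss
    linarith
  calc _ = (e' t + E t * (2 * R * (lam - D * ε - D * δ))) * Real.exp (Φ t) := by ring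
    _ ≤ 0 := mul_nonpos_of_nonpos_of_nonneg h3 (Real.exp_pos _).le

/-- Exponential convergence to the stationary state in relative entropy. -/
lemma IsSolution.exists_entropy_le (hm : 0 < m) (hβ : 0 < β) (hF : TorusContDiff 1 F)
    (hM : IsLipschitzInY F M) (hp : IsStationaryState alg β F p Bp) (hp0 : ∀ z, 0 < p z)
    (hR : 0 < R) (hρ : 0 < ρ) (hLR : SatisfiesLSI p R)
    (hL : ∀ x, SatisfiesLSI (conditional p x) ρ) (hMρ : 0 < β⁻¹ - M / ρ / 2)
    (h : IsSolution alg β F π B) :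
    ∃ K : ℝ, 0 ≤ K ∧ ∀ t : ℝ, 0 ≤ t → entropy (π t) p ≤
      ENNReal.ofReal (K * Real.exp (-(2 * R * (β⁻¹ - M / ρ / 2)) * t)) := by
  have : Nonempty (Fin m) := ⟨⟨0, hm⟩⟩
  obtain ⟨C, c, hC, hc, hu⟩ := (h.heatEnergy hF).exists_abs_le_exp (inv_pos.2 hβ)
  set D := (4 * ((M : ℝ) / ρ) + 1) / 2 with hD
  have hD0 : 0 < D := by positivity
  set lam := β⁻¹ - M / ρ / 2 with hlam
  -- `T` does not depend on `ε`: the error due to the marginal uses at most half of the gap `lam`,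
  -- and the other half is left for `D ε`.
  obtain ⟨T, hT2, hT8, hTD⟩ : ∃ T : ℝ, 2 ≤ T ∧ C * Real.exp (-c * T) ≤ 1 / 8 ∧
      D * (C * Real.exp (-c * T)) ≤ lam / 2 := by
    have h1 : Tendsto (fun T : ℝ => C * Real.exp (-c * T)) atTop (𝓝 0) := by
      have h2 : Tendsto (fun T : ℝ => -c * T) atTop atBot :=
        tendsto_id.const_mul_atTop_of_neg (neg_lt_zero.2 hc)
      simpa using (Real.tendsto_exp_atBot.comp h2).const_mul C
    have h3 : Tendsto (fun T : ℝ => D * (C * Real.exp (-c * T))) atTop (𝓝 0) := by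
      simpa using h1.const_mul D
    exact ((eventually_ge_atTop 2).and ((h1.eventually_le_const (by norm_num)).and
      (h3.eventually_le_const (by positivity)))).exists
  obtain ⟨S, hS0, hS⟩ := h.exists_regEntropy_le hp.continuous hp0 T
  -- Limit `ε → 0` at the two fixed times `T` and `t`; the full rate `lam` is recovered.
  have hlim : ∀ t, T ≤ t → regEntropy π p 0 t *
      Real.exp (2 * R * (lam * t + D * C / c * Real.exp (-c * t))) ≤
      regEntropy π p 0 T * Real.exp (2 * R * (lam * T + D * C / c * Real.exp (-c * T))) := by
    intro t ht
    have hcont : ∀ s, 0 ≤ s → Tendsto (fun ε =>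
        (regEntropy π p ε s - (1 + ε) * Real.log (1 + ε)) *
          Real.exp (2 * R * ((lam - D * ε) * s + D * C / c * Real.exp (-c * s)))) (𝓝[>] 0)
        (𝓝 (regEntropy π p 0 s *
          Real.exp (2 * R * (lam * s + D * C / c * Real.exp (-c * s))))) := fun s hs => by
      have h1 : Continuous fun ε : ℝ => (1 + ε) * Real.log (1 + ε) :=
        Real.continuous_mul_log.comp (continuous_const.add continuous_id)
      have h2 := continuous_regEntropy (h.continuous_apply hs) hp.continuous hp0
      have h3 : Continuous fun ε : ℝ => Real.exp (2 * R * ((lam - D * ε) * s +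
          D * C / c * Real.exp (-c * s))) := by fun_prop
      have h4 := (((h2.sub h1).mul h3).tendsto 0).mono_left (nhdsWithin_le_nhds (s := Ioi 0))
      simpa [Pi.mul_def, Pi.sub_def] using h4
    refine le_of_tendsto_of_tendsto (hcont t (by linarith)) (hcont T (by linarith)) ?_
    have hsmall : ∀ᶠ ε in 𝓝[>] (0 : ℝ), ε < lam / 2 / D :=
      nhdsWithin_le_nhds (Iio_mem_nhds (by positivity))
    filter_upwards [hsmall, self_mem_nhdsWithin] with ε hε1 hε0
    have hεD : ε * D ≤ lam / 2 := (le_div_iff₀ hD0).1 hε1.le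
    exact h.regEntropy_le hβ hF hM hp hp0 hR hρ hLR hL hC hc hD
      (fun t ht => hu t (hT2.trans ht)) (by linarith) hε0 hT8
      (by rw [mul_add]; linarith) ht
  set A := Real.exp (2 * R * (lam * T + D * C / c * Real.exp (-c * T))) with hA
  refine ⟨S * A, by positivity, fun t ht => ?_⟩
  rw [h.entropy_eq hp.continuous hp0 hp.mass ht]
  refine ENNReal.ofReal_le_ofReal ?_
  -- Before `T` the entropy is bounded by compactness, and `A` makes the exponential at least `1`;
  -- after `T` the integrated inequality applies.
  rcases le_total t T with htT | hTt
  · have h1 : 1 ≤ A * Real.exp (-(2 * R * lam) * t) := by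
      rw [hA, ← Real.exp_add]
      refine Real.one_le_exp ?_
      have h2 : 0 ≤ D * C / c * Real.exp (-c * T) := by positivity
      have h3 : 0 ≤ lam * (T - t) := mul_nonneg hMρ.le (by linarith)
      have h4 : 0 ≤ 2 * R * (lam * (T - t) + D * C / c * Real.exp (-c * T)) := by positivity
      linarith
    calc _ ≤ S := hS t ⟨ht, htT⟩
      _ ≤ S * (A * Real.exp (-(2 * R * lam) * t)) := le_mul_of_one_le_right hS0 h1
      _ = _ := by ring
  · have h1 := (hlim t hTt).trans
      (mul_le_mul_of_nonneg_right (hS T ⟨by linarith, le_rfl⟩) (Real.exp_pos _).le)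
    rw [← le_div_iff₀ (Real.exp_pos _), div_eq_mul_inv, ← Real.exp_neg] at h1
    refine h1.trans (mul_le_mul_of_nonneg_left (Real.exp_le_exp.2 ?_) (by positivity))
    have h2 : 0 ≤ 2 * R * (D * C / c * Real.exp (-c * t)) := by positivity
    linarith

end Main

end ABF

end

theorem mainTheorem1 (m k : ℕ) (hm : 0 < m) (alg : ABF.Algorithm) (β : ℝ) (hβ : 0 < β)
    (F : ABF.Force m k) (hF : ABF.TorusContDiff 1 F)
    (M : ℝ≥0) (hM : ABF.IsLipschitzInY F M)
    (p : ABF.State m k → ℝ) (Bp : ABF.Bias m)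
    (hp : ABF.IsStationaryState alg β F p Bp) (hpos : ∀ z, 0 < p z)
    (R ρ : ℝ) (hR : 0 < R) (hρ : 0 < ρ)
    (hLSI : ABF.SatisfiesLSI p R)
    (hLSIcond : ∀ x : UnitAddTorus (Fin m), ABF.SatisfiesLSI (ABF.conditional p x) ρ)
    (hMρ : (M : ℝ) * β < 2 * ρ) :
    (∀ (π : ℝ → ABF.State m k → ℝ) (B : ℝ → ABF.Bias m),
      ABF.IsAdmissibleInitial (π 0) → ABF.IsSolution alg β F π B →
      ∃ K : ℝ, 0 ≤ K ∧ ∀ t : ℝ, 0 ≤ t →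
        ABF.entropy (π t) p ≤
          ENNReal.ofReal (K * Real.exp (-(2 * R * (1 - M * β / (2 * ρ)) * β⁻¹) * t))) ∧
    (∀ (q : ABF.State m k → ℝ) (Bq : ABF.Bias m), ABF.IsStationaryState alg β F q Bq →
      q = p ∧ Bq =ᵐ[volume] Bp) := by
  have e : (1 - M * β / (2 * ρ)) * β⁻¹ = β⁻¹ - M / ρ / 2 := by field_simp
  have hlam : 0 < β⁻¹ - M / ρ / 2 := by
    rw [← e]
    refine mul_pos (sub_pos.2 ?_) (inv_pos.2 hβ)
    rwa [div_lt_one (by positivity)]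
  refine ⟨fun π B _ hπ => ?_, fun q Bq hq =>
    hp.unique hβ hF hM hpos hρ hLSIcond hlam hq⟩
  rw [mul_assoc (2 * R), e]
  exact hπ.exists_entropy_le hm hβ hF hM hp hpos hR hρ hLSI hLSIcond hlam
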